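/- Let $Z_1,Z_2,\dots$ be i.i.d. random vectors in $\mathbb R^q$ with the law of $Z$, which is continuous (no atoms), and write $m(z,\theta)$ for a real function, measurable in $z$, with $\theta\in\Theta\subset\mathbb R^d$; $\dot m,\ddot m$ denote its gradient and Hessian in $\theta$. **Assumptions.** (1) $\Theta$ is compact (and convex). (2) $m(z,\cdot)$ is concave on $\Theta$ and twice continuously differentiable near $\Theta$, $E\,m^2(Z,\theta)<\infty$ for $\theta\in\Theta$, and $\theta\mapsto E\,m(Z,\theta)$ has a unique maximizer $\theta_0$ on $\Theta$, which is an interior point. (3) For $\theta\in\Theta$, $-E\,\ddot m(Z,\theta)$ is positive definite and $E\,\ddot m_{k,l}^2(Z,\theta)<\infty$; there is $\psi$ with $E\psi^2(Z)<\infty$ and $|\ddot m_{k,l}(z,\theta_1)-\ddot m_{k,l}(z,\theta_2)|\le\psi(z)\|\theta_1-\theta_2\|$ for all $\theta_1,\theta_2\in\Theta$ and all $k,l$. (4) For $\theta\in\Theta$, $E\{\dot m(Z,\theta)\dot m^{T}(Z,\theta)\}$ exists and is positive definite; with $\hat\theta_n$ a maximizer over $\Theta$ of $M_n(\theta)=\frac1n\sum_{i=1}^n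 m(Z_i,\theta)$ that is a measurable function of $D_n=(Z_1,\dots,Z_n)$, $\frac1n\sum_{i=1}^n\|\dot m(Z_i,\theta)\|^4=O_P(1)$ uniformly over the $\theta\in\Theta$ in some ball of fixed radius around $\hat\theta_n$. **Algorithm.** Fix $\alpha\in(0,1)$ and $b\ge1$. Let $s_0=s_{0,n}$ and $s_n<n$ be integers, $\varrho_n=s_n/(bn)$; all uniform random numbers below are independent of each other and of $D_n$. The upper $\rho$-th sample quantile of $N$ numbers is their $\lceil N(1-\rho)\rceil$-th smallest. *Pilot step:* for $i\le n$ draw $u_i^0\sim U(0,1)$ and let $S^0=\{i\le n:u^0_i\le s_0/n\}$, $s_0^*=|S^0|$. Let $\tilde\theta^{0*}$ be a maximizer over $\Theta$ of $\sum_{i\in S^0}m(Z_i,\theta)/s_0^*$ that is a measurable function of $D_n$ and of the $u^0_i$; let $H^{0*}$ be the upper $\varrho_n$-th sample quantile of $\{\|\dot m(Z_i,\tilde\theta^{0*})\|\}_{i\in S^0}$, and $\Psi^{0*}=\sum_{i\in S^0}\{\|\dot m(Z_i,\tilde\theta^{0*})\|\wedge H^{0*}\}/s_0^*$. *Second step:*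 with $$\tilde\pi_i=(1-\alpha)\frac{\|\dot m(Z_i,\tilde\theta^{0*})\|\wedge H^{0*}}{n\Psi^{0*}}+\frac{\alpha}{n},$$ draw $u_i\sim U(0,1)$, include $Z_i$ if and only if $u_i\le s_n\tilde\pi_i$, and let $\tilde\theta^{\alpha}_{s_n,P}$ be any (measurable) maximizer over $\Theta$ of $\frac1n\sum_{i:\,u_i\le s_n\tilde\pi_i}m(Z_i,\theta)/\{(s_n\tilde\pi_i)\wedge1\}$. **Variance.** Let $t_i=\|\dot m(Z_i,\hat\theta_n)\|$ with order statistics $t_{(1)}\le\dots\le t_{(n)}$ and $t_{(n+1)}=\infty$. For a threshold $h$ let $$\pi_i=(1-\alpha)\frac{t_i\wedge h}{\sum_{j=1}^n(t_j\wedge h)}+\frac{\alpha}{n},\qquad p_i=(s_n\pi_i)\wedge1,$$ $$\Lambda^\alpha_{n,P}=\frac{s_n}{n^2}\sum_{i=1}^n\frac{1-p_i}{p_i}\,\dot m(Z_i,\hat\theta_n)\dot m^{T}(Z_i,\hat\theta_n),\qquad V^\alpha_{n,P}(\hat\theta_n)=\ddot M_n^{-1}(\hat\theta_n)\,\Lambda^\alpha_{n,P}\,\ddot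 M_n^{-1}(\hat\theta_n).$$ (If all $s_n\pi_i\le1$, then $\Lambda^\alpha_{n,P}=\frac1{n^2}\sum_i\frac{1-s_n\pi_i}{\pi_i}\dot m\dot m^{T}$.) **Theorem.** Let Assumptions (1)–(4) hold, and let $n\to\infty$, $s_0\to\infty$, $s_n\to\infty$, $s_0=o(n)$ and $\varrho_n\to\varrho\in[0,1)$. (a) If $\varrho=0$, let $h=H=\sum_{i=1}^{n-g}t_{(i)}/(s_n-g)$, where $0\le g<s_n$ is the integer with $\frac{t_{(n-g)}}{\sum_{i\le n-g}t_{(i)}}<\frac1{s_n-g}$ and $\frac{t_{(n-g+1)}}{\sum_{i\le n-g+1}t_{(i)}}\ge\frac1{s_n-g+1}$ (the latter void if $g=0$). (b) If $\varrho>0$, let $h=H_{\varrho_n}$ be the upper $\varrho_n$-th sample quantile of $t_1,\dots,t_n$. In this case assume also that the upper $\varrho$-quantile $\zeta$ of $\|\dot m(Z,\theta_0)\|$ is unique and positive and, if $b>1$, that $E[\{1-p(Z)\}\dot m(Z,\theta_0)\dot m^{T}(Z,\theta_0)]$ is positive definite, where $$p(z)=\Big[b\varrho\Big\{(1-\alpha)\frac{\|\dot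 m(z,\theta_0)\|\wedge\zeta}{E(\|\dot m(Z,\theta_0)\|\wedge\zeta)}+\alpha\Big\}\Big]\wedge1 .$$ In both cases, given $D_n$ and the pilot estimates $(\tilde\theta^{0*},H^{0*},\Psi^{0*})$, $$\sqrt{s_n}\,\{V^\alpha_{n,P}(\hat\theta_n)\}^{-1/2}(\tilde\theta^\alpha_{s_n,P}-\hat\theta_n)\to N(0,I)$$ in conditional distribution in probability: for every $x\in\mathbb R^d$, the conditional probability that the left-hand side is componentwise $\le x$ converges in probability to $\Pr\{N(0,I)\le x\}$. -/

import Mathlib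

open MeasureTheory ProbabilityTheory Filter Topology
open scoped Matrix MatrixOrder

noncomputable section

namespace PoissonSubsampling

/-- Observations live in `ℝ^q`. -/
abbrev Obs (q : ℕ) := EuclideanSpace ℝ (Fin q)

/-- Parameters live in `ℝ^d`. -/
abbrev Param (d : ℕ) := EuclideanSpace ℝ (Fin d)

variable {q d n : ℕ}

/-- The Hessian matrix of `m(z, ·)` at `θ`. -/
def hess (m : Obs q → Param d → ℝ) (z : Obs q) (θ : Param d) : Matrix (Fin d) (Fin d) ℝ :=
  Matrix.of fun k l =>
    fderiv ℝ (fderiv ℝ (m z)) θ (EuclideanSpace.single k 1) (EuclideanSpace.single l 1)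

/-- The norm of the gradient of `m(z, ·)` at `θ`. -/
def gradNorm (m : Obs q → Param d → ℝ) (z : Obs q) (θ : Param d) : ℝ :=
  ‖gradient (m z) θ‖

/-- `θ` maximizes `f` over the parameter set `Θ`. -/
def IsMaximizer (Θ : Set (Param d)) (f : Param d → ℝ) (θ : Param d) : Prop :=
  θ ∈ Θ ∧ IsMaxOn f Θ θ

/-- The regularity conditions on the objective `m`, the parameter set `Θ`, the law `ν` of one
observation and the true parameter `θ₀`. -/
structure Regularity (ν : Measure (Obs q)) (m : Obs q → Param d → ℝ) (Θ : Set (Param d))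
    (θ₀ : Param d) : Prop where
  /-- compact parameter set -/
  compact : IsCompact Θ
  /-- the true parameter is an interior point -/
  interior : θ₀ ∈ interior Θ
  measurable : ∀ θ, Measurable fun z => m z θ
  /-- concavity in the parameter (the convexity of `Θ` is part of it) -/
  concave : ∀ z, ConcaveOn ℝ Θ (m z)
  sq_integrable : ∀ θ ∈ Θ, MemLp (fun z => m z θ) 2 ν
  /-- `θ₀` is the unique maximizer of the expected objective -/
  unique_max : ∀ θ ∈ Θ, θ ≠ θ₀ → ∫ z, m z θ ∂ν < ∫ z, m z θ₀ ∂ν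
  smooth : ∀ z, ∀ θ ∈ Θ, ContDiffAt ℝ 2 (m z) θ
  hess_sq_integrable : ∀ θ ∈ Θ, ∀ k l, MemLp (fun z => hess m z θ k l) 2 ν
  hess_posDef : ∀ θ ∈ Θ, (-(Matrix.of fun k l => ∫ z, hess m z θ k l ∂ν)).PosDef
  hess_lipschitz : ∃ ψ : Obs q → ℝ, MemLp ψ 2 ν ∧
    ∀ z, ∀ θ₁ ∈ Θ, ∀ θ₂ ∈ Θ, ∀ k l, |hess m z θ₁ k l - hess m z θ₂ k l| ≤ ψ z * ‖θ₁ - θ₂‖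
  grad_sq_integrable : ∀ θ ∈ Θ, MemLp (fun z => gradient (m z) θ) 2 ν
  grad_posDef : ∀ θ ∈ Θ,
    (Matrix.of fun k l => ∫ z, gradient (m z) θ k * gradient (m z) θ l ∂ν).PosDef

/-- The first `n` observations. -/
def data {Ω : Type*} (Z : ℕ → Ω → Obs q) (n : ℕ) (ω : Ω) : Fin n → Obs q := fun i => Z i ω

/-- On a neighbourhood of the estimators `θhat n`, the averages of the fourth powers of the
gradient norms are bounded in probability. -/
def FourthMomentBounded {Ω : Type*} [MeasurableSpace Ω] (P : Measure Ω) (Z : ℕ → Ω → Obs q)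
    (m : Obs q → Param d → ℝ) (Θ : Set (Param d)) (θhat : ℕ → Ω → Param d) : Prop :=
  ∃ r : ℝ, 0 < r ∧ ∀ ε : ℝ, 0 < ε → ∃ K : ℝ, ∀ᶠ n : ℕ in atTop,
    P {ω | ∃ θ ∈ Θ, ‖θ - θhat n ω‖ < r ∧
      K < (∑ i, gradNorm m (data Z n ω i) θ ^ 4) / n} ≤ ENNReal.ofReal ε

/-! Order statistics, sample quantiles and population quantiles -/

/-- The `k`-th smallest of the values `t i`, `i ∈ S` (for `1 ≤ k ≤ #S`). -/
def orderStat {ι : Type*} (S : Finset ι) (t : ι → ℝ) (k : ℕ) : ℝ :=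
  sInf {x : ℝ | k ≤ (S.filter fun i => t i ≤ x).card}

/-- The upper `ρ`-th sample quantile of the values `t i`, `i ∈ S`: the order statistic of rank
`⌈#S (1 - ρ)⌉`. -/
def upperSampleQuantile {ι : Type*} (S : Finset ι) (t : ι → ℝ) (ρ : ℝ) : ℝ :=
  orderStat S t ⌈(S.card : ℝ) * (1 - ρ)⌉₊

/-- `x` is an upper `ρ`-quantile of the law of `t` under `ν`. -/
def IsUpperQuantile (ν : Measure (Obs q)) (t : Obs q → ℝ) (ρ x : ℝ) : Prop :=
  ν.real {z | x < t z} ≤ ρ ∧ ρ ≤ ν.real {z | x ≤ t z}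

/-! Full data quantities -/

/-- The full data objective `M_n`. -/
def fullObjective (m : Obs q → Param d → ℝ) (D : Fin n → Obs q) (θ : Param d) : ℝ :=
  (∑ i, m (D i) θ) / n

/-- The Hessian matrix of the full data objective. -/
def fullHess (m : Obs q → Param d → ℝ) (D : Fin n → Obs q) (θ : Param d) :
    Matrix (Fin d) (Fin d) ℝ :=
  (n : ℝ)⁻¹ • ∑ i, hess m (D i) θ

/-- `g` is the number of data points that optimal Poisson subsampling with expected size `s`
includes for sure, for the gradient norms `t`. For `g = 0` the second inequality holds by the
convention that the order statistic of rank `n + 1` is infinite. -/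
def IsCutoff (s : ℕ) (t : Fin n → ℝ) (g : ℕ) : Prop :=
  g < s ∧
  orderStat Finset.univ t (n - g) / ∑ i ∈ Finset.Icc 1 (n - g), orderStat Finset.univ t i
    < 1 / ((s : ℝ) - g) ∧
  (g = 0 ∨ 1 / ((s : ℝ) - g + 1) ≤ orderStat Finset.univ t (n - g + 1) /
    ∑ i ∈ Finset.Icc 1 (n - g + 1), orderStat Finset.univ t i)

/-- The number `g` of the data points that are included for sure. -/
def cutoff (s : ℕ) (t : Fin n → ℝ) : ℕ := sInf {g | IsCutoff s t g}

/-- The threshold `H` of optimal Poisson subsampling with expected size `s`. -/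
def optThreshold (s : ℕ) (t : Fin n → ℝ) : ℝ :=
  (∑ i ∈ Finset.Icc 1 (n - cutoff s t), orderStat Finset.univ t i) / ((s : ℝ) - cutoff s t)

/-- The probabilities `(t_i ∧ H) / ∑_j (t_j ∧ H)`. -/
def thresholdProb (t : Fin n → ℝ) (H : ℝ) (i : Fin n) : ℝ :=
  min (t i) H / ∑ j, min (t j) H

/-- Mixture with the uniform distribution: `(1 - α) π_i + α / n`. -/
def mixProb (α : ℝ) (p : Fin n → ℝ) (i : Fin n) : ℝ := (1 - α) * p i + α / n

/-- The actual inclusion probabilities `(s π_i) ∧ 1` under Poisson subsampling. -/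
def inclusionProb (s : ℕ) (p : Fin n → ℝ) (i : Fin n) : ℝ := min ((s : ℝ) * p i) 1

/-- The matrix `(s / n²) ∑_i (1 - p_i) ∇m(Z_i, θ) ∇m(Z_i, θ)ᵀ / p_i`, where `p_i = (s π_i) ∧ 1`.
If all `s π_i ≤ 1`, this is `(1 / n²) ∑_i (1 - s π_i) ∇m(Z_i, θ) ∇m(Z_i, θ)ᵀ / π_i`. -/
def scoreVar (m : Obs q → Param d → ℝ) (s : ℕ) (p : Fin n → ℝ) (D : Fin n → Obs q)
    (θ : Param d) : Matrix (Fin d) (Fin d) ℝ :=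
  ((s : ℝ) / (n : ℝ) ^ 2) • ∑ i, ((1 - inclusionProb s p i) / inclusionProb s p i) •
    Matrix.vecMulVec (gradient (m (D i)) θ).ofLp (gradient (m (D i)) θ).ofLp

/-- The asymptotic variance matrix: the inverse Hessian of the full data objective on both sides
of `scoreVar`. -/
def asympVar (m : Obs q → Param d → ℝ) (s : ℕ) (p : Fin n → ℝ) (D : Fin n → Obs q)
    (θ : Param d) : Matrix (Fin d) (Fin d) ℝ :=
  (fullHess m D θ)⁻¹ * scoreVar m s p D θ * (fullHess m D θ)⁻¹

/-! The two-step Poisson subsampling algorithm; `u₀` and `u` are the uniform random numbers of the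
pilot step and of the second step -/

/-- The pilot subsample (as a set of indices), of expected size `s₀`. -/
def pilotSet (s₀ : ℕ) (u₀ : Fin n → ℝ) : Finset (Fin n) :=
  Finset.univ.filter fun i => u₀ i ≤ (s₀ : ℝ) / n

/-- The objective function of the pilot step. -/
def pilotObjective (m : Obs q → Param d → ℝ) (D : Fin n → Obs q) (S : Finset (Fin n))
    (θ : Param d) : ℝ :=
  ∑ i ∈ S, m (D i) θ / S.card

/-- The pilot threshold: the upper `ρ`-th sample quantile of the gradient norms over the pilot
subsample, at the pilot estimate `θp`. -/
def pilotThreshold (m : Obs q → Param d → ℝ) (D : Fin n → Obs q) (S : Finset (Fin n)) (ρ : ℝ)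
    (θp : Param d) : ℝ :=
  upperSampleQuantile S (fun i => gradNorm m (D i) θp) ρ

/-- The mean of the gradient norms, cut at `H`, over the pilot subsample. -/
def pilotMean (m : Obs q → Param d → ℝ) (D : Fin n → Obs q) (S : Finset (Fin n)) (H : ℝ)
    (θp : Param d) : ℝ :=
  ∑ i ∈ S, min (gradNorm m (D i) θp) H / S.card

/-- The approximated optimal subsampling probabilities before mixing, from the pilot estimates
`θp`, `H` and `Ψ`. -/
def approxProb (m : Obs q → Param d → ℝ) (D : Fin n → Obs q) (θp : Param d) (H Ψ : ℝ)
    (i : Fin n) : ℝ :=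
  min (gradNorm m (D i) θp) H / (n * Ψ)

/-- The second-step objective function, for the subsampling probabilities `p`: the data point `i`
is included if and only if `u_i ≤ s p_i`. -/
def subObjective (m : Obs q → Param d → ℝ) (D : Fin n → Obs q) (s : ℕ) (p u : Fin n → ℝ)
    (θ : Param d) : ℝ :=
  (n : ℝ)⁻¹ * ∑ i ∈ Finset.univ.filter (fun i => u i ≤ (s : ℝ) * p i),
    m (D i) θ / min ((s : ℝ) * p i) 1

/-! Population quantities -/

/-- The limiting inclusion probability of an observation `z`, where `ρ` is the limit of
`s / (b n)` and `ζ` is the upper `ρ`-quantile of the gradient norm at `θ₀`. -/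
def limitInclusion (ν : Measure (Obs q)) (m : Obs q → Param d → ℝ) (b α ρ : ℝ) (θ₀ : Param d)
    (ζ : ℝ) (z : Obs q) : ℝ :=
  min (b * ρ * ((1 - α) * (min (gradNorm m z θ₀) ζ / ∫ y, min (gradNorm m y θ₀) ζ ∂ν) + α)) 1

/-- Uniqueness and positivity of the upper `ρ`-quantile of the gradient norm at `θ₀` and, for
`b > 1`, positive definiteness of the gradient moment matrix restricted to what is not included
for sure in the limit. -/
def QuantileRegular (ν : Measure (Obs q)) (m : Obs q → Param d → ℝ) (b α ρ : ℝ)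
    (θ₀ : Param d) : Prop :=
  ∃ ζ : ℝ, 0 < ζ ∧ (∀ x, IsUpperQuantile ν (fun z => gradNorm m z θ₀) ρ x ↔ x = ζ) ∧
    (1 < b → (Matrix.of fun k l => ∫ z, (1 - limitInclusion ν m b α ρ θ₀ ζ z) *
      (gradient (m z) θ₀ k * gradient (m z) θ₀ l) ∂ν).PosDef)

/-! Convergence in conditional distribution -/

/-- The random vectors `Δ n` converge to `N(0, I)` in conditional distribution given `𝓖 n`, in
probability. -/
def CondConvStdGaussian {Ω : Type*} [MeasurableSpace Ω] (P : Measure Ω)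
    (𝓖 : ℕ → MeasurableSpace Ω) (Δ : ℕ → Ω → Fin d → ℝ) : Prop :=
  ∀ x : Fin d → ℝ, TendstoInMeasure P (fun n => P⟦{ω | ∀ j, Δ n ω j ≤ x j} | 𝓖 n⟧) atTop
    (fun _ => (stdGaussian (EuclideanSpace ℝ (Fin d))).real {y | ∀ j, y j ≤ x j})

/-- The standardized error `√s V^{-1/2} (θsub - θhat)`. -/
def standardized (s : ℕ) (V : Matrix (Fin d) (Fin d) ℝ) (θsub θhat : Param d) : Fin d → ℝ :=
  √(s : ℝ) • ((CFC.sqrt V)⁻¹ *ᵥ (θsub - θhat).ofLp)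

/-- The uniform distribution on `[0, 1]`. -/
def unif : Measure ℝ := volume.restrict (Set.Icc 0 1)

end PoissonSubsampling

end

/-!
# Asymptotic normality of the two-step Poisson subsampling estimator

Given the data and the pilot estimates, the second step is a randomization by independent uniform
variables, and the score of the inverse probability weighted objective at the full data estimator
`θhat` is a sum of independent centred terms: the full data score vanishes at the interior
maximizer `θhat`, so only the relative errors `htNoise` of the inclusion indicators remain. The
theorem follows from a central limit theorem for such sums, applied conditionally, and from a
linearization of the estimating equation.

*Central limit theorem.* Comparison of characteristic functions by a second order Taylor expansion
yields a version that is uniform over all deterministic arrays whose variance is near to the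
identity and whose Lyapunov sum is small (`exists_htVec_orthant_approx`). The random numbers are
independent of the conditioning `σ`-algebra, so that conditional probabilities are found by
integrating them out; on the event that variance and Lyapunov sum behave, the uniform bound
applies. A remainder that tends to zero in probability is absorbed by shifting the orthant
(`condConvStdGaussian_of_htVec`).

*Linearization.* The averages over the full data, over the pilot sample and over the inverse
probability weighted subsample all obey a weak law of large numbers for square integrable
functions (`LLN`); for the last, the mixture with the uniform distribution keeps the inclusion
probabilities above `α s / n`. This law alone implies consistency of the maximizers
(`tendsto_argmax`) and local uniform convergence of the weighted Hessian matrices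
(`eventually_hess_near`). Hence the scaled error of the subsampling estimator solves a linear
system with the mean Hessian matrix and the noise in the score, up to smaller terms
(`Experiment.tendsto_noiseScore_add`).

*Variance.* The score variance depends on the subsampling probabilities through the gradient
norms, truncated at a threshold. If these converge in mean, then the score variance converges
(`tendsto_scoreVar`), and the limit is the same for the pilot thresholds, which drive the
algorithm, and for the full data thresholds, which enter the standardization. For a vanishing
sampling fraction the thresholds exceed every level below the essential supremum of the gradient
norm, so truncation is negligible; for a positive sampling fraction they converge to the
population quantile by its uniqueness. In both cases the limit is positive definite; for `b = 1`
the limiting inclusion probabilities are less than one by Markov's inequality.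

Convergence in probability is expressed as convergence along the filter `whp` on pairs `(n, ω)`.
-/

open MeasureTheory ProbabilityTheory Filter Topology
open scoped Matrix MatrixOrder

namespace PoissonSubsampling

/-! ### Convergence in probability as convergence along a filter -/

/-- The filter of the events that hold with probability tending to one: a set of pairs `(n, ω)`
belongs to it if the outer measure of its complement at stage `n` tends to zero. Convergence in
probability is convergence along this filter, so that continuous mapping and squeezing arguments
are instances of the general calculus of limits, with no measurability involved. -/
def whp {Ω : Type*} [MeasurableSpace Ω] (P : Measure Ω) : Filter (ℕ × Ω) where
  sets := {S | Tendsto (fun n => P {ω | (n, ω) ∉ S}) atTop (𝓝 0)}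
  univ_sets := by simp
  sets_of_superset := by
    intro S T hS hST
    refine tendsto_of_tendsto_of_tendsto_of_le_of_le tendsto_const_nhds hS (fun _ => zero_le)
      fun n => measure_mono fun ω hω h => hω (hST h)
  inter_sets := by
    intro S T hS hT
    have h := Tendsto.add (show Tendsto (fun n => P {ω | (n, ω) ∉ S}) atTop (𝓝 0) from hS)
      (show Tendsto (fun n => P {ω | (n, ω) ∉ T}) atTop (𝓝 0) from hT)
    rw [add_zero] at h
    refine tendsto_of_tendsto_of_tendsto_of_le_of_le tendsto_const_nhds h (fun _ => zero_le)
      fun n => ?_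
    refine le_trans (measure_mono ?_) (measure_union_le _ _)
    intro ω hω
    by_contra hc
    simp only [Set.mem_union, Set.mem_ofPred_eq, not_or, not_not] at hc
    exact hω hc

section whp

variable {Ω : Type*} [MeasurableSpace Ω] {P : Measure Ω}

lemma eventually_whp {p : ℕ × Ω → Prop} :
    (∀ᶠ x in whp P, p x) ↔ Tendsto (fun n => P {ω | ¬ p (n, ω)}) atTop (𝓝 0) := Iff.rfl

lemma eventually_whp_of_ae {p : ℕ × Ω → Prop} (h : ∀ᶠ n in atTop, ∀ᵐ ω ∂P, p (n, ω)) :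
    ∀ᶠ x in whp P, p x := by
  rw [eventually_whp]
  refine tendsto_const_nhds.congr' ?_
  filter_upwards [h] with n hn
  exact (ae_iff.1 hn).symm

lemma tendsto_fst_whp : Tendsto Prod.fst (whp P) atTop := by
  intro S hS
  exact eventually_whp_of_ae (p := fun x => x.1 ∈ S)
    ((show ∀ᶠ n in atTop, n ∈ S from hS).mono fun n hn => ae_of_all _ fun _ => hn)

/-- An eventually vanishing upper bound up to every `ε` gives an event of probability tending to
one. -/
lemma eventually_whp_of_le {p : ℕ × Ω → Prop}
    (h : ∀ ε : ℝ, 0 < ε → ∀ᶠ n in atTop, P {ω | ¬ p (n, ω)} ≤ ENNReal.ofReal ε) :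
    ∀ᶠ x in whp P, p x := by
  rw [eventually_whp, ENNReal.tendsto_nhds_zero]
  intro ε hε
  rcases eq_or_ne ε ⊤ with rfl | hε'
  · simp
  · filter_upwards [h ε.toReal (ENNReal.toReal_pos hε.ne' hε')] with n hn
    rwa [ENNReal.ofReal_toReal hε'] at hn

/-- Markov's inequality for second moments. -/
lemma tendsto_zero_whp_of_lintegral_sq {X : ℕ → Ω → ℝ}
    (hX : ∀ n, AEMeasurable (X n) P)
    (h : Tendsto (fun n => ∫⁻ ω, ENNReal.ofReal (X n ω ^ 2) ∂P) atTop (𝓝 0)) :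
    Tendsto (fun x : ℕ × Ω => X x.1 x.2) (whp P) (𝓝 0) := by
  rw [Metric.tendsto_nhds]
  intro ε hε
  rw [eventually_whp]
  have hε2 : ENNReal.ofReal (ε ^ 2) ≠ 0 := by simp; positivity
  have h2 := ENNReal.Tendsto.const_mul (a := (ENNReal.ofReal (ε ^ 2))⁻¹) h
    (Or.inr (ENNReal.inv_ne_top.2 hε2))
  rw [mul_zero] at h2
  refine tendsto_of_tendsto_of_tendsto_of_le_of_le tendsto_const_nhds h2 (fun _ => zero_le)
    fun n => ?_
  have h3 := meas_ge_le_lintegral_div (μ := P) (f := fun ω => ENNReal.ofReal (X n ω ^ 2))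
    (by have := hX n; fun_prop) hε2 ENNReal.ofReal_ne_top
  rw [div_eq_mul_inv, mul_comm] at h3
  refine le_trans (measure_mono ?_) h3
  intro ω hω
  simp only [dist_zero_right, Real.norm_eq_abs, not_lt, Set.mem_ofPred_eq] at hω ⊢
  refine ENNReal.ofReal_le_ofReal ?_
  rw [← sq_abs (X n ω)]
  gcongr

/-- Boundedness in probability. -/
def BddInProb {Ω : Type*} [MeasurableSpace Ω] (P : Measure Ω) (X : ℕ × Ω → ℝ) : Prop :=
  ∀ ε : ℝ, 0 < ε → ∃ K : ℝ, ∀ᶠ n in atTop, P {ω | K < |X (n, ω)|} ≤ ENNReal.ofReal ε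

lemma BddInProb.mul_tendsto_zero {X Y : ℕ × Ω → ℝ} (hX : BddInProb P X)
    (hY : Tendsto Y (whp P) (𝓝 0)) : Tendsto (fun x => X x * Y x) (whp P) (𝓝 0) := by
  rw [Metric.tendsto_nhds]
  intro η hη
  refine eventually_whp_of_le fun ε hε => ?_
  obtain ⟨K, hK⟩ := hX (ε / 2) (by positivity)
  have hY' := Metric.tendsto_nhds.1 hY (η / (|K| + 1)) (by positivity)
  rw [eventually_whp, ENNReal.tendsto_nhds_zero] at hY'
  filter_upwards [hK, hY' (ENNReal.ofReal (ε / 2)) (by simpa using hε)] with n h1 h2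
  have : ENNReal.ofReal ε = ENNReal.ofReal (ε / 2) + ENNReal.ofReal (ε / 2) := by
    rw [← ENNReal.ofReal_add (by positivity) (by positivity)]; congr 1; ring
  rw [this]
  refine le_trans (measure_mono ?_) ((measure_union_le _ _).trans (add_le_add h1 h2))
  intro ω hω
  by_contra hc
  simp only [Set.mem_union, Set.mem_ofPred_eq, not_or, not_lt, dist_zero_right,
    Real.norm_eq_abs, not_le] at hc hω
  rw [abs_mul] at hω
  have h3 : |X (n, ω)| * |Y (n, ω)| ≤ (|K| + 1) * |Y (n, ω)| := by
    gcongr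
    linarith [hc.1, le_abs_self K]
  have h4 := hc.2
  rw [lt_div_iff₀ (by positivity)] at h4
  linarith

lemma BddInProb.of_le {X Y : ℕ × Ω → ℝ} (hX : BddInProb P X)
    (h : ∀ᶠ x in whp P, |Y x| ≤ |X x|) : BddInProb P Y := by
  intro ε hε
  obtain ⟨K, hK⟩ := hX (ε / 2) (by positivity)
  rw [eventually_whp, ENNReal.tendsto_nhds_zero] at h
  refine ⟨K, ?_⟩
  filter_upwards [hK, h (ENNReal.ofReal (ε / 2)) (by simpa using hε)] with n h1 h2
  have : ENNReal.ofReal ε = ENNReal.ofReal (ε / 2) + ENNReal.ofReal (ε / 2) := by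
    rw [← ENNReal.ofReal_add (by positivity) (by positivity)]; congr 1; ring
  rw [this]
  refine le_trans (measure_mono ?_) ((measure_union_le _ _).trans (add_le_add h1 h2))
  intro ω hω
  by_contra hc
  simp only [Set.mem_union, Set.mem_ofPred_eq, not_or, not_not, not_lt] at hc hω
  linarith [hc.1, hc.2]

lemma BddInProb.const_mul {X : ℕ × Ω → ℝ} (hX : BddInProb P X) (c : ℝ) :
    BddInProb P (fun x => c * X x) := by
  intro ε hε
  obtain ⟨K, hK⟩ := hX ε hε
  refine ⟨|c| * K, ?_⟩
  filter_upwards [hK] with n h1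
  refine le_trans (measure_mono ?_) h1
  intro ω hω
  simp only [Set.mem_ofPred_eq, abs_mul] at hω ⊢
  exact lt_of_mul_lt_mul_left hω (abs_nonneg c)

lemma BddInProb.add {X Y : ℕ × Ω → ℝ} (hX : BddInProb P X) (hY : BddInProb P Y) :
    BddInProb P (fun x => X x + Y x) := by
  intro ε hε
  obtain ⟨K, hK⟩ := hX (ε / 2) (by positivity)
  obtain ⟨K', hK'⟩ := hY (ε / 2) (by positivity)
  refine ⟨K + K', ?_⟩
  filter_upwards [hK, hK'] with n h1 h2
  have : ENNReal.ofReal ε = ENNReal.ofReal (ε / 2) + ENNReal.ofReal (ε / 2) := by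
    rw [← ENNReal.ofReal_add (by positivity) (by positivity)]; congr 1; ring
  rw [this]
  refine le_trans (measure_mono ?_) ((measure_union_le _ _).trans (add_le_add h1 h2))
  intro ω hω
  by_contra hc
  simp only [Set.mem_union, Set.mem_ofPred_eq, not_or, not_lt] at hc hω
  linarith [abs_add_le (X (n, ω)) (Y (n, ω))]

lemma BddInProb.sum {ι : Type*} (s : Finset ι) {X : ι → ℕ × Ω → ℝ}
    (h : ∀ i ∈ s, BddInProb P (X i)) : BddInProb P (fun x => ∑ i ∈ s, X i x) := by
  classical
  induction s using Finset.induction_on with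
  | empty =>
    intro ε hε
    exact ⟨0, by simp⟩
  | insert a s ha ih =>
    simp only [Finset.sum_insert ha]
    exact (h a (by simp)).add (ih fun i hi => h i (by simp [hi]))

lemma BddInProb.of_lintegral_sq_le {X : ℕ → Ω → ℝ} (hX : ∀ n, AEMeasurable (X n) P) (C : ℝ)
    (h : ∀ᶠ n in atTop, ∫⁻ ω, ENNReal.ofReal (X n ω ^ 2) ∂P ≤ ENNReal.ofReal C) :
    BddInProb P (fun x => X x.1 x.2) := by
  intro ε hε
  have hK : 0 < √((|C| + 1) / ε) := by positivity
  refine ⟨√((|C| + 1) / ε), ?_⟩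
  filter_upwards [h] with n hn
  have h0 : ENNReal.ofReal ((|C| + 1) / ε) ≠ 0 := by
    simp only [ne_eq, ENNReal.ofReal_eq_zero, not_le]; positivity
  have h3 := meas_ge_le_lintegral_div (μ := P) (f := fun ω => ENNReal.ofReal (X n ω ^ 2))
    (by have := hX n; fun_prop) h0 ENNReal.ofReal_ne_top
  rw [ENNReal.div_eq_inv_mul] at h3
  refine (measure_mono ?_).trans (h3.trans ?_)
  · intro ω hω
    simp only [Set.mem_ofPred_eq] at hω ⊢
    refine ENNReal.ofReal_le_ofReal ?_
    rw [← sq_abs (X n ω)]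
    exact (Real.sqrt_le_left (abs_nonneg _)).1 hω.le
  · rw [← ENNReal.ofReal_inv_of_pos (by positivity)]
    refine (mul_le_mul' le_rfl hn).trans ?_
    rw [← ENNReal.ofReal_mul (by positivity)]
    refine ENNReal.ofReal_le_ofReal ?_
    rw [inv_div, div_mul_eq_mul_div, div_le_iff₀ (by positivity)]
    nlinarith [le_abs_self C]

end whp

/-! ### The centred inclusion indicators -/

/-- The relative error of an inverse probability weighted inclusion indicator: a data point with
nominal inclusion probability `r` is included if the uniform random number `u` is at most `r`. -/
noncomputable def htNoise (r u : ℝ) : ℝ := (if u ≤ r then 1 else 0) / min r 1 - 1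

instance : IsProbabilityMeasure unif := ⟨by simp [unif]⟩

lemma unif_real_Iic {r : ℝ} (hr : 0 ≤ r) : unif.real (Set.Iic r) = min r 1 := by
  have h : Set.Iic r ∩ Set.Icc 0 1 = Set.Icc 0 (min r 1) := by
    ext x; simp only [Set.mem_inter_iff, Set.mem_Iic, Set.mem_Icc, le_min_iff]; tauto
  rw [unif, Measure.real, Measure.restrict_apply measurableSet_Iic, h, Real.volume_Icc,
    sub_zero, ENNReal.toReal_ofReal (by positivity)]

lemma integral_ite_le_unif {E : Type*} [NormedAddCommGroup E] [NormedSpace ℝ E] [CompleteSpace E]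
    {r : ℝ} (hr : 0 ≤ r) (a b : E) :
    ∫ u, (if u ≤ r then a else b) ∂unif = min r 1 • a + (1 - min r 1) • b := by
  have h : (fun u : ℝ => if u ≤ r then a else b) =
      fun u => (Set.Iic r).indicator (fun _ => a - b) u + b := by
    funext u; by_cases hu : u ≤ r <;> simp [Set.indicator, hu]
  rw [h, integral_add ((integrable_const _).indicator measurableSet_Iic) (integrable_const _),
    integral_indicator_const _ measurableSet_Iic, unif_real_Iic hr]
  simp only [integral_const, probReal_univ, one_smul]
  module

lemma measurable_htNoise : Measurable fun x : ℝ × ℝ => htNoise x.1 x.2 := by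
  unfold htNoise
  refine ((Measurable.ite (measurableSet_le measurable_snd measurable_fst) measurable_const
    measurable_const).div (by fun_prop)).sub_const 1

lemma integral_comp_htNoise {E : Type*} [NormedAddCommGroup E] [NormedSpace ℝ E] [CompleteSpace E]
    {r : ℝ} (hr : 0 < r) (F : ℝ → E) :
    ∫ u, F (htNoise r u) ∂unif =
      min r 1 • F (1 / min r 1 - 1) + (1 - min r 1) • F (-1) := by
  rw [← integral_ite_le_unif hr.le]
  congr 1; funext u
  by_cases hu : u ≤ r <;> simp [htNoise, hu]

lemma abs_htNoise_le {r : ℝ} (hr : 0 < r) (u : ℝ) : |htNoise r u| ≤ 1 / min r 1 := by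
  have hp : 0 < min r 1 := lt_min hr one_pos
  have hp1 : 1 ≤ 1 / min r 1 := by rw [le_div_iff₀ hp]; simp
  unfold htNoise
  split_ifs <;> rw [abs_le] <;> constructor <;> simp at * <;> linarith

lemma memLp_htNoise {r : ℝ} (hr : 0 < r) : MemLp (htNoise r) 2 unif := by
  refine MemLp.of_bound (measurable_htNoise.comp measurable_prodMk_left).aestronglyMeasurable
    (1 / min r 1) (ae_of_all _ fun u => ?_)
  exact abs_htNoise_le hr u

lemma integral_htNoise {r : ℝ} (hr : 0 < r) : ∫ u, htNoise r u ∂unif = 0 := by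
  have hp : 0 < min r 1 := lt_min hr one_pos
  rw [integral_comp_htNoise hr (fun x => x)]
  simp only [smul_eq_mul]
  field_simp
  ring

lemma integral_htNoise_sq {r : ℝ} (hr : 0 < r) :
    ∫ u, htNoise r u ^ 2 ∂unif = (1 - min r 1) / min r 1 := by
  have hp : 0 < min r 1 := lt_min hr one_pos
  rw [integral_comp_htNoise hr (fun x => x ^ 2)]
  simp only [smul_eq_mul]
  field_simp
  ring

lemma memLp_htSum {n : ℕ} (c r : Fin n → ℝ) (hr : ∀ i, 0 < r i) :
    MemLp (fun u : Fin n → ℝ => ∑ i, c i * htNoise (r i) (u i)) 2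
      (Measure.pi fun _ : Fin n => unif) := by
  refine memLp_finsetSum _ fun i _ => ?_
  exact ((memLp_htNoise (hr i)).comp_measurePreserving
    (measurePreserving_eval (fun _ : Fin n => unif) i)).const_mul (c i)

lemma integral_htSum_sq {n : ℕ} (c r : Fin n → ℝ) (hr : ∀ i, 0 < r i) :
    ∫ u : Fin n → ℝ, (∑ i, c i * htNoise (r i) (u i)) ^ 2 ∂(Measure.pi fun _ : Fin n => unif) =
      ∑ i, c i ^ 2 * ((1 - min (r i) 1) / min (r i) 1) := by
  have h := variance_sum_pi (μ := fun _ : Fin n => unif)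
    (X := fun i u => c i * htNoise (r i) u) fun i => (memLp_htNoise (hr i)).const_mul (c i)
  have h1 : (∑ i, fun u : Fin n → ℝ => c i * htNoise (r i) (u i)) =
      fun u => ∑ i, c i * htNoise (r i) (u i) := by
    funext u; simp
  have hint : ∀ i, Integrable (fun u : Fin n → ℝ => c i * htNoise (r i) (u i))
      (Measure.pi fun _ : Fin n => unif) := fun i =>
    ((((memLp_htNoise (hr i)).comp_measurePreserving
      (measurePreserving_eval (fun _ : Fin n => unif) i)).const_mul (c i)).integrable (by simp))
  have h0 : ∫ u : Fin n → ℝ, ∑ i, c i * htNoise (r i) (u i) ∂(Measure.pi fun _ => unif) = 0 := by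
    rw [integral_finsetSum _ fun i _ => hint i]
    refine Finset.sum_eq_zero fun i _ => ?_
    rw [integral_const_mul]
    have := integral_comp_eval (μ := fun _ : Fin n => unif) (i := i) (f := htNoise (r i))
      (memLp_htNoise (hr i)).aestronglyMeasurable
    rw [this, integral_htNoise (hr i), mul_zero]
  rw [h1, variance_of_integral_eq_zero (memLp_htSum c r hr).aemeasurable h0] at h
  rw [h]
  refine Finset.sum_congr rfl fun i _ => ?_
  rw [variance_of_integral_eq_zero ((memLp_htNoise (hr i)).const_mul (c i)).aemeasurable]
  · simp only [mul_pow]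
    rw [integral_const_mul, integral_htNoise_sq (hr i)]
  · rw [integral_const_mul, integral_htNoise (hr i), mul_zero]

/-- If the inclusion probabilities are bounded below by `ρ ≤ 1`, inverse probability weighting
increases second moments by the factor `1 / ρ` at most. -/
lemma lintegral_htSum_sq_le {n : ℕ} (c r : Fin n → ℝ) {ρ : ℝ} (hρ : 0 < ρ) (hρ1 : ρ ≤ 1)
    (hr : ∀ i, ρ ≤ r i) :
    ∫⁻ u : Fin n → ℝ, ENNReal.ofReal ((∑ i, c i * htNoise (r i) (u i)) ^ 2)
      ∂(Measure.pi fun _ : Fin n => unif) ≤ ENNReal.ofReal (ρ⁻¹ * ∑ i, c i ^ 2) := by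
  have hr0 : ∀ i, 0 < r i := fun i => hρ.trans_le (hr i)
  rw [← ofReal_integral_eq_lintegral_ofReal (memLp_htSum c r hr0).integrable_sq
    (ae_of_all _ fun u => sq_nonneg _), integral_htSum_sq c r hr0, Finset.mul_sum]
  refine ENNReal.ofReal_le_ofReal (Finset.sum_le_sum fun i _ => ?_)
  rw [mul_comm]
  refine mul_le_mul_of_nonneg_right ?_ (sq_nonneg _)
  have hp : 0 < min (r i) 1 := lt_min (hr0 i) one_pos
  have hp' : ρ ≤ min (r i) 1 := le_min (hr i) hρ1
  rw [div_le_iff₀ hp, inv_mul_eq_div, le_div_iff₀ hρ]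
  nlinarith

/-! ### A central limit theorem for arrays of weighted inclusion indicators -/

lemma norm_exp_mul_I_sub_taylor_le (x : ℝ) :
    ‖Complex.exp (x * Complex.I) - (1 + x * Complex.I - x ^ 2 / 2)‖ ≤ 4 * |x| ^ 3 := by
  rcases le_total |x| 1 with hx | hx
  · have h := Complex.norm_exp_sub_sum_le_norm_mul_exp (x * Complex.I) 3
    have hn : ‖(x : ℂ) * Complex.I‖ = |x| := by simp
    rw [hn] at h
    have h2 : ∑ m ∈ Finset.range 3, ((x : ℂ) * Complex.I) ^ m / (m.factorial : ℂ) =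
        1 + x * Complex.I - x ^ 2 / 2 := by
      simp [Finset.sum_range_succ, mul_pow, Nat.factorial]; ring
    rw [h2] at h
    refine h.trans ?_
    have h3 : Real.exp |x| ≤ 4 :=
      (Real.exp_le_exp.2 hx).trans (Real.exp_one_lt_d9.le.trans (by norm_num))
    nlinarith [pow_nonneg (abs_nonneg x) 3]
  · have h1 : ‖Complex.exp (x * Complex.I)‖ = 1 := Complex.norm_exp_ofReal_mul_I x
    have h2 : ‖(1 : ℂ) + x * Complex.I - x ^ 2 / 2‖ ≤ 1 + |x| + |x| ^ 2 / 2 := by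
      refine (norm_sub_le _ _).trans (add_le_add ((norm_add_le _ _).trans ?_) ?_)
      · simp
      · simp
    refine (norm_sub_le _ _).trans ?_
    rw [h1]
    have h4 : |x| ≤ |x| ^ 2 := by nlinarith
    have h5 : |x| ^ 2 ≤ |x| ^ 3 := by nlinarith
    nlinarith

lemma norm_prod_sub_prod_le_sum {ι : Type*} (s : Finset ι) (a b : ι → ℂ)
    (ha : ∀ i ∈ s, ‖a i‖ ≤ 1) (hb : ∀ i ∈ s, ‖b i‖ ≤ 1) :
    ‖∏ i ∈ s, a i - ∏ i ∈ s, b i‖ ≤ ∑ i ∈ s, ‖a i - b i‖ := by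
  classical
  induction s using Finset.induction_on with
  | empty => simp
  | insert j s hj ih =>
    rw [Finset.prod_insert hj, Finset.prod_insert hj, Finset.sum_insert hj]
    have ih' := ih (fun i hi => ha i (by simp [hi])) (fun i hi => hb i (by simp [hi]))
    have hB : ‖∏ i ∈ s, b i‖ ≤ 1 := by
      rw [norm_prod]
      exact Finset.prod_le_one (fun _ _ => norm_nonneg _) fun i hi => hb i (by simp [hi])
    have h : a j * ∏ i ∈ s, a i - b j * ∏ i ∈ s, b i =
        (a j - b j) * ∏ i ∈ s, b i + a j * (∏ i ∈ s, a i - ∏ i ∈ s, b i) := by ring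
    rw [h]
    refine (norm_add_le _ _).trans (add_le_add ?_ ?_)
    · rw [norm_mul]; exact mul_le_of_le_one_right (norm_nonneg _) hB
    · rw [norm_mul]
      exact (mul_le_of_le_one_left (norm_nonneg _) (ha j (by simp))).trans ih'

/-- The characteristic function of one centred indicator, compared with the normal one of the same
variance; `η` balances the second against the fourth moment in the bound of the third one. -/
lemma norm_integral_exp_htNoise_sub_le {r : ℝ} (hr : 0 < r) (a : ℝ) {η : ℝ} (hη : 0 < η) :
    ‖∫ u, Complex.exp ((a * htNoise r u : ℝ) * Complex.I) ∂unif -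
        Complex.exp ((-(a ^ 2 * ((1 - min r 1) / min r 1)) / 2 : ℝ))‖ ≤
      2 * η * (a ^ 2 * ((1 - min r 1) / min r 1)) + (4 / η + 1) * (a ^ 4 / min r 1 ^ 3) := by
  have hp : 0 < min r 1 := lt_min hr one_pos
  have hp1 : min r 1 ≤ 1 := min_le_right _ _
  rw [integral_comp_htNoise hr (fun x => Complex.exp ((a * x : ℝ) * Complex.I))]
  generalize min r 1 = p at hp hp1 ⊢
  set σ := (1 - p) / p with hσ
  have hσ0 : 0 ≤ σ := div_nonneg (by linarith) hp.le
  set T : ℝ → ℂ := fun x => 1 + x * Complex.I - x ^ 2 / 2 with hT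
  have hcube : ∀ x : ℝ, |x| ^ 3 ≤ (η * x ^ 2 + x ^ 4 / η) / 2 := by
    intro x
    have h1 : x ^ 2 = |x| ^ 2 := (sq_abs x).symm
    have h2 : x ^ 4 = |x| ^ 4 := by rw [show x ^ 4 = (x ^ 2) ^ 2 by ring, h1]; ring
    rw [h1, h2, le_div_iff₀ two_pos]
    have : η * |x| ^ 2 + |x| ^ 4 / η - |x| ^ 3 * 2 = |x| ^ 2 * (η - |x|) ^ 2 / η := by
      field_simp; ring
    have h3 : 0 ≤ |x| ^ 2 * (η - |x|) ^ 2 / η := by positivity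
    linarith
  have hmean : p • T (a * (1 / p - 1) : ℝ) + (1 - p) • T (a * (-1) : ℝ) =
      ((1 - a ^ 2 * σ / 2 : ℝ) : ℂ) := by
    simp only [hT, hσ, Complex.real_smul]
    push_cast
    have : (p : ℂ) ≠ 0 := by exact_mod_cast hp.ne'
    field_simp
    ring
  have hexp : ‖((1 - a ^ 2 * σ / 2 : ℝ) : ℂ) - Complex.exp ((-(a ^ 2 * σ) / 2 : ℝ))‖ ≤
      a ^ 4 / p ^ 3 := by
    rw [← Complex.ofReal_exp, ← Complex.ofReal_sub, Complex.norm_real, Real.norm_eq_abs]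
    have hv : 0 ≤ a ^ 2 * σ / 2 := by positivity
    generalize hvv : a ^ 2 * σ / 2 = v at hv
    have e1 : -(a ^ 2 * σ) / 2 = -v := by rw [← hvv]; ring
    have e2 : v ^ 2 ≤ a ^ 4 / p ^ 3 := by
      have : σ ^ 2 ≤ 1 / p ^ 3 := by
        rw [hσ, div_pow, div_le_div_iff₀ (by positivity) (by positivity)]
        have : (1 - p) ^ 2 * p ≤ 1 := by nlinarith [mul_nonneg hp.le hp.le]
        nlinarith [sq_nonneg p]
      have h4 : v ^ 2 = a ^ 4 * σ ^ 2 / 4 := by rw [← hvv]; ring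
      rw [h4, div_eq_mul_one_div (a ^ 4)]
      have : a ^ 4 * σ ^ 2 ≤ a ^ 4 * (1 / p ^ 3) := by gcongr
      have : 0 ≤ a ^ 4 * σ ^ 2 := by positivity
      linarith
    refine le_trans ?_ e2
    rw [e1, abs_le]
    have h5 := Real.add_one_le_exp (-v)
    have h6 : Real.exp (-v) ≤ 1 - v + v ^ 2 := by
      rcases le_total v 1 with h | h
      · have := Real.norm_exp_sub_one_sub_id_le (x := -v)
          (by rw [norm_neg, Real.norm_of_nonneg hv]; exact h)
        rw [Real.norm_eq_abs, norm_neg, Real.norm_of_nonneg hv] at this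
        have := (abs_le.1 this).2
        linarith
      · have : Real.exp (-v) ≤ 1 := Real.exp_le_one_iff.2 (by linarith)
        nlinarith
    constructor <;> nlinarith [sq_nonneg v]
  have hdiff : ‖(p • Complex.exp ((a * (1 / p - 1) : ℝ) * Complex.I) +
      (1 - p) • Complex.exp ((a * (-1) : ℝ) * Complex.I)) -
      (p • T (a * (1 / p - 1) : ℝ) + (1 - p) • T (a * (-1) : ℝ))‖ ≤
      2 * η * (a ^ 2 * σ) + 4 / η * (a ^ 4 / p ^ 3) := by
    rw [add_sub_add_comm, ← smul_sub, ← smul_sub]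
    refine (norm_add_le _ _).trans ?_
    rw [norm_smul, norm_smul, Real.norm_of_nonneg hp.le, Real.norm_of_nonneg (sub_nonneg.2 hp1)]
    have t1 := (norm_exp_mul_I_sub_taylor_le (a * (1 / p - 1))).trans
      (mul_le_mul_of_nonneg_left (hcube _) (by norm_num))
    have t2 := (norm_exp_mul_I_sub_taylor_le (a * (-1))).trans
      (mul_le_mul_of_nonneg_left (hcube _) (by norm_num))
    refine (add_le_add (mul_le_mul_of_nonneg_left t1 hp.le)
      (mul_le_mul_of_nonneg_left t2 (sub_nonneg.2 hp1))).trans ?_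
    have e : p * (4 * ((η * (a * (1 / p - 1)) ^ 2 + (a * (1 / p - 1)) ^ 4 / η) / 2)) +
        (1 - p) * (4 * ((η * (a * (-1)) ^ 2 + (a * (-1)) ^ 4 / η) / 2)) =
        2 * η * (a ^ 2 * σ) + 2 / η * (a ^ 4 * ((1 - p) * ((1 - p) ^ 3 + p ^ 3) / p ^ 3)) := by
      rw [hσ]; field_simp; ring
    rw [e]
    have h7 : (1 - p) * ((1 - p) ^ 3 + p ^ 3) / p ^ 3 ≤ 2 * (1 / p ^ 3) := by
      rw [mul_one_div]
      gcongr
      have : (1 - p) ^ 3 ≤ 1 := pow_le_one₀ (by linarith) (by linarith)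
      have : p ^ 3 ≤ 1 := pow_le_one₀ hp.le hp1
      have : 0 ≤ (1 - p) ^ 3 := pow_nonneg (by linarith) 3
      have : 0 ≤ p ^ 3 := by positivity
      nlinarith
    have h8 : a ^ 4 * ((1 - p) * ((1 - p) ^ 3 + p ^ 3) / p ^ 3) ≤ a ^ 4 * (2 * (1 / p ^ 3)) := by
      gcongr
    have h9 := mul_le_mul_of_nonneg_left h8 (show 0 ≤ 2 / η by positivity)
    have e3 : 2 / η * (a ^ 4 * (2 * (1 / p ^ 3))) = 4 / η * (a ^ 4 / p ^ 3) := by field_simp; ring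
    linarith
  rw [hmean] at hdiff
  refine (norm_sub_le_norm_sub_add_norm_sub _ ((1 - a ^ 2 * σ / 2 : ℝ) : ℂ) _).trans ?_
  linarith [add_le_add hdiff hexp]

/-- The weighted sum of centred inclusion indicators with vector weights `v i`. -/
noncomputable def htVec {d n : ℕ} (v : Fin n → Param d) (r u : Fin n → ℝ) : Param d :=
  ∑ i, htNoise (r i) (u i) • v i

lemma measurable_htVec {d n : ℕ} (v : Fin n → Param d) (r : Fin n → ℝ) :
    Measurable (htVec v r) := by
  unfold htVec
  refine Finset.measurable_fun_sum _ fun i _ => ?_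
  exact ((measurable_htNoise.comp measurable_prodMk_left).comp (measurable_pi_apply i)).smul_const _

lemma norm_charFun_htVec_sub_le {d n : ℕ} (v : Fin n → Param d) (r : Fin n → ℝ)
    (hr : ∀ i, 0 < r i) {δ : ℝ} (hδ : 0 < δ)
    (hvar : ∀ τ : Param d, |∑ i, inner ℝ (v i) τ ^ 2 * ((1 - min (r i) 1) / min (r i) 1) -
      ‖τ‖ ^ 2| ≤ δ * ‖τ‖ ^ 2)
    (hfour : ∑ i, ‖v i‖ ^ 4 / min (r i) 1 ^ 3 ≤ δ) (τ : Param d) :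
    ‖charFun ((Measure.pi fun _ : Fin n => unif).map (htVec v r)) τ -
      Complex.exp (-(‖τ‖ : ℂ) ^ 2 / 2)‖ ≤
      2 * √δ * ((1 + δ) * ‖τ‖ ^ 2) + (4 / √δ + 1) * (‖τ‖ ^ 4 * δ) + δ * ‖τ‖ ^ 2 := by
  set σ : Fin n → ℝ := fun i => (1 - min (r i) 1) / min (r i) 1 with hσ
  have hp : ∀ i, 0 < min (r i) 1 := fun i => lt_min (hr i) one_pos
  have hσ0 : ∀ i, 0 ≤ σ i := fun i => div_nonneg (sub_nonneg.2 (min_le_right _ _)) (hp i).le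
  set a : Fin n → ℝ := fun i => inner ℝ (v i) τ with ha
  set b : Fin n → ℂ := fun i => Complex.exp ((-(a i ^ 2 * σ i) / 2 : ℝ)) with hb
  have h1 : charFun ((Measure.pi fun _ : Fin n => unif).map (htVec v r)) τ =
      ∏ i, ∫ u, Complex.exp ((a i * htNoise (r i) u : ℝ) * Complex.I) ∂unif := by
    rw [charFun_apply, integral_map (measurable_htVec v r).aemeasurable
      (by fun_prop), ← integral_fintype_prod_eq_prod]
    congr 1; funext u
    rw [← Complex.exp_sum]
    congr 1
    rw [htVec, sum_inner]
    push_cast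
    rw [Finset.sum_mul]
    refine Finset.sum_congr rfl fun i _ => ?_
    rw [real_inner_smul_left]
    push_cast
    ring
  have h2 : ∏ i, b i = Complex.exp ((-(∑ i, a i ^ 2 * σ i) / 2 : ℝ)) := by
    rw [hb, ← Complex.exp_sum]
    congr 1
    push_cast
    rw [← Finset.sum_div, Finset.sum_neg_distrib]
  set Q := ∑ i, a i ^ 2 * σ i with hQ
  have hQ0 : 0 ≤ Q := Finset.sum_nonneg fun i _ => mul_nonneg (sq_nonneg _) (hσ0 i)
  have hQd : |Q - ‖τ‖ ^ 2| ≤ δ * ‖τ‖ ^ 2 := hvar τ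
  have h3 : ‖∏ i, ∫ u, Complex.exp ((a i * htNoise (r i) u : ℝ) * Complex.I) ∂unif - ∏ i, b i‖ ≤
      2 * √δ * Q + (4 / √δ + 1) * ∑ i, (a i ^ 4 / min (r i) 1 ^ 3) := by
    refine (norm_prod_sub_prod_le_sum _ _ _ (fun i _ => ?_) (fun i _ => ?_)).trans ?_
    · refine (norm_integral_le_integral_norm _).trans ?_
      simp only [Complex.norm_exp_ofReal_mul_I, integral_const, probReal_univ, smul_eq_mul,
        mul_one, le_refl]
    · rw [hb]
      simp only
      rw [← Complex.ofReal_exp, Complex.norm_real, Real.norm_eq_abs, Real.abs_exp,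
        Real.exp_le_one_iff]
      have := mul_nonneg (sq_nonneg (a i)) (hσ0 i)
      linarith
    · rw [hQ, Finset.mul_sum, Finset.mul_sum, ← Finset.sum_add_distrib]
      exact Finset.sum_le_sum fun i _ =>
        norm_integral_exp_htNoise_sub_le (hr i) (a i) (Real.sqrt_pos.2 hδ)
  have h4 : ∑ i, (a i ^ 4 / min (r i) 1 ^ 3) ≤ ‖τ‖ ^ 4 * δ := by
    calc ∑ i, (a i ^ 4 / min (r i) 1 ^ 3) ≤ ∑ i, ‖τ‖ ^ 4 * (‖v i‖ ^ 4 / min (r i) 1 ^ 3) := by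
          refine Finset.sum_le_sum fun i _ => ?_
          rw [← mul_div_assoc]
          have := hp i
          gcongr
          have h := abs_real_inner_le_norm (v i) τ
          calc a i ^ 4 = |a i| ^ 4 := by rw [pow_abs, abs_of_nonneg (by positivity)]
            _ ≤ (‖v i‖ * ‖τ‖) ^ 4 := by gcongr
            _ = ‖τ‖ ^ 4 * ‖v i‖ ^ 4 := by ring
      _ = ‖τ‖ ^ 4 * ∑ i, (‖v i‖ ^ 4 / min (r i) 1 ^ 3) := by rw [Finset.mul_sum]
      _ ≤ ‖τ‖ ^ 4 * δ := by gcongr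
  have h5 : ‖∏ i, b i - Complex.exp (-(‖τ‖ : ℂ) ^ 2 / 2)‖ ≤ δ * ‖τ‖ ^ 2 := by
    have e : Complex.exp (-(‖τ‖ : ℂ) ^ 2 / 2) = ((Real.exp (-‖τ‖ ^ 2 / 2) : ℝ) : ℂ) := by
      push_cast; rfl
    rw [h2, e, ← Complex.ofReal_exp, ← Complex.ofReal_sub, Complex.norm_real, Real.norm_eq_abs]
    -- the exponential is Lipschitz with constant one on the negative half-line
    have hL : ∀ x y : ℝ, x ≤ y → y ≤ 0 → |Real.exp x - Real.exp y| ≤ y - x := by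
      intro x y hxy hy
      rw [abs_sub_comm, abs_of_nonneg (sub_nonneg.2 (Real.exp_le_exp.2 hxy))]
      have e1 : Real.exp x = Real.exp y * Real.exp (x - y) := by rw [← Real.exp_add]; ring_nf
      have e2 := Real.add_one_le_exp (x - y)
      have e3 : Real.exp y ≤ 1 := Real.exp_le_one_iff.2 hy
      have e4 := Real.exp_pos y
      rw [e1]
      nlinarith
    have hn : 0 ≤ ‖τ‖ ^ 2 := by positivity
    obtain ⟨hl, hu⟩ := abs_le.1 hQd
    rcases le_total Q (‖τ‖ ^ 2) with h | h
    · rw [abs_sub_comm]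
      refine (hL _ _ (by linarith) (by linarith)).trans ?_
      linarith
    · refine (hL _ _ (by linarith) (by linarith)).trans ?_
      linarith
  rw [h1]
  refine (norm_sub_le_norm_sub_add_norm_sub _ (∏ i, b i) _).trans ?_
  have h6 : Q ≤ (1 + δ) * ‖τ‖ ^ 2 := by linarith [(abs_le.1 hQd).2]
  have hs := Real.sqrt_pos.2 hδ
  have h7 : 2 * √δ * Q ≤ 2 * √δ * ((1 + δ) * ‖τ‖ ^ 2) := by gcongr
  have h8 : (4 / √δ + 1) * ∑ i, (a i ^ 4 / min (r i) 1 ^ 3) ≤ (4 / √δ + 1) * (‖τ‖ ^ 4 * δ) := by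
    gcongr
  linarith

lemma stdGaussian_setOf_coord_eq {d : ℕ} (j : Fin d) (c : ℝ) :
    stdGaussian (Param d) {y | y j = c} = 0 := by
  have hm : MeasurableSet {y : Param d | y j = c} :=
    measurableSet_eq_fun (by fun_prop) measurable_const
  rw [← map_pi_eq_stdGaussian, Measure.map_apply (by fun_prop) hm]
  have h := (measurePreserving_eval (fun _ : Fin d => gaussianReal 0 1) j).measure_preimage
    (s := {c}) (measurableSet_singleton c).nullMeasurableSet
  have := nullSingletonClass_gaussianReal (μ := 0) (v := 1) one_ne_zero
  rw [measure_singleton] at h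
  exact h

lemma ae_stdGaussian_coord_ne {d : ℕ} (x : Fin d → ℝ) :
    ∀ᵐ y ∂stdGaussian (Param d), ∀ j, y j ≠ x j :=
  ae_all_iff.2 fun j => by
    rw [ae_iff]; simpa using stdGaussian_setOf_coord_eq j (x j)

lemma measurableSet_orthant {d : ℕ} (x : Fin d → ℝ) :
    MeasurableSet {y : Param d | ∀ j, y j ≤ x j} :=
  measurableSet_setOfPred.2 (Measurable.forall fun j => measurableSet_setOfPred.1
    (measurableSet_le (by fun_prop) measurable_const))

lemma stdGaussian_frontier_orthant {d : ℕ} (x : Fin d → ℝ) :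
    stdGaussian (Param d) (frontier {y | ∀ j, y j ≤ x j}) = 0 := by
  refine measure_mono_null ?_ (ae_iff.1 (ae_stdGaussian_coord_ne x))
  intro y hy hne
  have hcl : IsClosed {y : Param d | ∀ j, y j ≤ x j} := by
    simp only [Set.ofPred_forall]
    exact isClosed_iInter fun j => isClosed_le (by fun_prop) continuous_const
  rw [hcl.frontier_eq] at hy
  refine hy.2 (mem_interior_iff_mem_nhds.2 ?_)
  have : ∀ᶠ z in 𝓝 y, ∀ j, z j < x j := eventually_all.2 fun j =>
    (show Continuous fun z : Param d => z j by fun_prop).continuousAt.eventually_lt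
      continuousAt_const ((hy.1 j).lt_of_ne (hne j))
  filter_upwards [this] with z hz j using (hz j).le

lemma tendsto_stdGaussian_orthant {d : ℕ} (x : Fin d → ℝ) :
    Tendsto (fun η : ℝ => (stdGaussian (Param d)).real {y | ∀ j, y j ≤ x j + η}) (𝓝 0)
      (𝓝 ((stdGaussian (Param d)).real {y | ∀ j, y j ≤ x j})) := by
  have key : ∀ w : Fin d → ℝ, (stdGaussian (Param d)).real {y | ∀ j, y j ≤ w j} =
      ∫ y, {y : Param d | ∀ j, y j ≤ w j}.indicator (fun _ => (1 : ℝ)) y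
        ∂stdGaussian (Param d) := by
    intro w
    rw [integral_indicator_const _ (measurableSet_orthant w)]; simp
  simp only [key]
  refine tendsto_integral_filter_of_dominated_convergence (fun _ => 1)
    (Eventually.of_forall fun η =>
      (measurable_const.indicator (measurableSet_orthant _)).aestronglyMeasurable)
    (Eventually.of_forall fun η => ae_of_all _ fun y => ?_) (integrable_const _) ?_
  · by_cases h : y ∈ {y : Param d | ∀ j, y j ≤ x j + η} <;> simp [Set.indicator, h]
  · filter_upwards [ae_stdGaussian_coord_ne x] with y hy
    refine tendsto_const_nhds.congr' ?_
    have : ∀ᶠ η : ℝ in 𝓝 0, ∀ j, (y j ≤ x j + η ↔ y j ≤ x j) := by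
      refine eventually_all.2 fun j => ?_
      have hc : Continuous fun η : ℝ => x j + η := by fun_prop
      rcases lt_or_gt_of_ne (hy j) with h | h
      · filter_upwards [continuousAt_const.eventually_lt hc.continuousAt
          (show y j < x j + 0 by simpa using h)] with η hη
        exact ⟨fun _ => h.le, fun _ => hη.le⟩
      · filter_upwards [hc.continuousAt.eventually_lt continuousAt_const
          (show x j + 0 < y j by simpa using h)] with η hη
        exact ⟨fun h' => absurd h' (not_le.2 hη), fun h' => absurd h' (not_le.2 h)⟩
    filter_upwards [this] with η hη
    simp [Set.indicator, hη]

/-- A quantitative form of the Lyapunov central limit theorem, uniform over all arrays of weights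
and inclusion probabilities whose variance is near to the identity and whose Lyapunov sum is
small. -/
theorem exists_htVec_orthant_approx {d : ℕ} (x : Fin d → ℝ) {ε : ℝ} (hε : 0 < ε) :
    ∃ δ : ℝ, 0 < δ ∧ ∀ (n : ℕ) (v : Fin n → Param d) (r : Fin n → ℝ), (∀ i, 0 < r i) →
      (∀ τ : Param d, |∑ i, inner ℝ (v i) τ ^ 2 * ((1 - min (r i) 1) / min (r i) 1) -
        ‖τ‖ ^ 2| ≤ δ * ‖τ‖ ^ 2) →
      ∑ i, ‖v i‖ ^ 4 / min (r i) 1 ^ 3 ≤ δ →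
      |(Measure.pi fun _ : Fin n => unif).real {u | ∀ j, htVec v r u j ≤ x j} -
        (stdGaussian (Param d)).real {y | ∀ j, y j ≤ x j}| < ε := by
  by_contra! hcon
  have hδ : ∀ k : ℕ, (0 : ℝ) < 1 / ((k : ℝ) + 1) := fun k => by positivity
  choose n v r hr hvar hfour hbad using fun k : ℕ => hcon (1 / ((k : ℝ) + 1)) (hδ k)
  let μ : ℕ → ProbabilityMeasure (Param d) := fun k =>
    ⟨(Measure.pi fun _ : Fin (n k) => unif).map (htVec (v k) (r k)),
      Measure.isProbabilityMeasure_map (measurable_htVec _ _).aemeasurable⟩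
  let γ : ProbabilityMeasure (Param d) := ⟨stdGaussian (Param d), inferInstance⟩
  have hδ0 : Tendsto (fun k : ℕ => 1 / ((k : ℝ) + 1)) atTop (𝓝 0) :=
    tendsto_one_div_add_atTop_nhds_zero_nat
  have hs0 : Tendsto (fun k : ℕ => √(1 / ((k : ℝ) + 1))) atTop (𝓝 0) := by
    simpa using hδ0.sqrt
  have hμ : Tendsto μ atTop (𝓝 γ) := by
    refine ProbabilityMeasure.tendsto_of_tendsto_charFun fun τ => ?_
    rw [tendsto_iff_norm_sub_tendsto_zero]
    refine squeeze_zero (fun _ => norm_nonneg _) (fun k => ?_)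
      (g := fun k : ℕ => 2 * √(1 / ((k : ℝ) + 1)) * ((1 + 1 / ((k : ℝ) + 1)) * ‖τ‖ ^ 2) +
        (4 * √(1 / ((k : ℝ) + 1)) + 1 / ((k : ℝ) + 1)) * ‖τ‖ ^ 4 +
          1 / ((k : ℝ) + 1) * ‖τ‖ ^ 2) ?_
    · have h := norm_charFun_htVec_sub_le (v k) (r k) (hr k) (hδ k) (hvar k) (hfour k) τ
      have hg : charFun ((γ : ProbabilityMeasure (Param d)) : Measure (Param d)) τ =
          Complex.exp (-(‖τ‖ : ℂ) ^ 2 / 2) := charFun_stdGaussian τ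
      rw [hg]
      refine h.trans (le_of_eq ?_)
      have hsq := Real.mul_self_sqrt (hδ k).le
      have hpos := Real.sqrt_pos.2 (hδ k)
      generalize √(1 / ((k : ℝ) + 1)) = t at hsq hpos ⊢
      rw [← hsq]
      field_simp
    · have := (((hs0.const_mul 2).mul ((hδ0.const_add 1).mul_const (‖τ‖ ^ 2))).add
        (((hs0.const_mul 4).add hδ0).mul_const (‖τ‖ ^ 4))).add (hδ0.mul_const (‖τ‖ ^ 2))
      simpa using this
  have hlim := ProbabilityMeasure.tendsto_measure_of_null_frontier_of_tendsto hμ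
    (E := {y : Param d | ∀ j, y j ≤ x j}) (by
      rw [ProbabilityMeasure.null_iff_toMeasure_null]; exact stdGaussian_frontier_orthant x)
  have hlim' := (NNReal.continuous_coe.tendsto _).comp hlim
  have hev := Metric.tendsto_nhds.1 hlim' ε hε
  obtain ⟨k, hk⟩ := hev.exists
  refine absurd hk (not_lt.2 ?_)
  refine (hbad k).trans (le_of_eq ?_)
  rw [Real.dist_eq]
  congr 2
  · have := map_measureReal_apply (μ := Measure.pi fun _ : Fin (n k) => unif)
      (measurable_htVec (v k) (r k)) (measurableSet_orthant x)
    exact this.symm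

/-! ### Calculus and measurability of the objective -/

section calculus

variable {q d : ℕ} {ν : Measure (Obs q)} {m : Obs q → Param d → ℝ} {Θ : Set (Param d)}
  {θ₀ : Param d}

lemma gradient_apply (f : Param d → ℝ) (θ : Param d) (k : Fin d) :
    gradient f θ k = fderiv ℝ f θ (EuclideanSpace.single k 1) := by
  rw [← inner_gradient_left, EuclideanSpace.inner_single_right]; simp

lemma norm_gradient_sub (f : Param d → ℝ) (θ₁ θ₂ : Param d) :
    ‖gradient f θ₁ - gradient f θ₂‖ = ‖fderiv ℝ f θ₁ - fderiv ℝ f θ₂‖ := by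
  rw [gradient, gradient, ← map_sub, LinearIsometryEquiv.norm_map]

lemma norm_gradient (f : Param d → ℝ) (θ : Param d) : ‖gradient f θ‖ = ‖fderiv ℝ f θ‖ := by
  rw [gradient, LinearIsometryEquiv.norm_map]

lemma sum_smul_single (v : Param d) : ∑ k, v k • EuclideanSpace.single k (1 : ℝ) = v := by
  have := (EuclideanSpace.basisFun (Fin d) ℝ).sum_repr v
  simpa using this

lemma norm_clm_le_of_forall_single (φ : Param d →L[ℝ] ℝ) {c : ℝ}
    (h : ∀ k, |φ (EuclideanSpace.single k 1)| ≤ c) : ‖φ‖ ≤ d * c := by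
  have hcd : 0 ≤ d * c := by
    rcases Nat.eq_zero_or_pos d with h0 | h0
    · subst h0; simp
    · exact mul_nonneg (by positivity) ((abs_nonneg _).trans (h ⟨0, h0⟩))
  refine φ.opNorm_le_bound hcd fun v => ?_
  rw [Real.norm_eq_abs]
  nth_rw 1 [← sum_smul_single v]
  rw [map_sum]
  refine (Finset.abs_sum_le_sum_abs _ _).trans ?_
  calc ∑ k, |φ (v k • EuclideanSpace.single k (1 : ℝ))| ≤ ∑ _k : Fin d, ‖v‖ * c := by
        refine Finset.sum_le_sum fun k _ => ?_
        rw [map_smul, smul_eq_mul, abs_mul]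
        exact mul_le_mul (EuclideanSpace.norm_eq v ▸ PiLp.norm_apply_le v k) (h k) (abs_nonneg _)
          (norm_nonneg _)
    _ = d * c * ‖v‖ := by simp; ring

lemma norm_clm₂_le_of_forall_single (φ : Param d →L[ℝ] Param d →L[ℝ] ℝ) {c : ℝ}
    (h : ∀ k l, |φ (EuclideanSpace.single k 1) (EuclideanSpace.single l 1)| ≤ c) :
    ‖φ‖ ≤ d * (d * c) := by
  have hcd : 0 ≤ d * c := by
    rcases Nat.eq_zero_or_pos d with h0 | h0
    · subst h0; simp
    · exact mul_nonneg (by positivity) ((abs_nonneg _).trans (h ⟨0, h0⟩ ⟨0, h0⟩))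
  refine φ.opNorm_le_bound (by positivity) fun v => ?_
  nth_rw 1 [← sum_smul_single v]
  rw [map_sum]
  refine (norm_sum_le _ _).trans ?_
  calc ∑ k, ‖φ (v k • EuclideanSpace.single k (1 : ℝ))‖ ≤ ∑ _k : Fin d, ‖v‖ * (d * c) := by
        refine Finset.sum_le_sum fun k _ => ?_
        rw [map_smul, norm_smul]
        exact mul_le_mul (PiLp.norm_apply_le v k) (norm_clm_le_of_forall_single _ (h k))
          (norm_nonneg _) (norm_nonneg _)
    _ = d * (d * c) * ‖v‖ := by simp; ring

namespace Regularity

lemma convex (h : Regularity ν m Θ θ₀) : Convex ℝ Θ := (h.concave 0).1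

lemma mem (h : Regularity ν m Θ θ₀) : θ₀ ∈ Θ := interior_subset h.interior

lemma differentiableAt (h : Regularity ν m Θ θ₀) (z : Obs q) {θ : Param d} (hθ : θ ∈ Θ) :
    DifferentiableAt ℝ (m z) θ := (h.smooth z θ hθ).differentiableAt (by simp)

lemma differentiableAt_fderiv (h : Regularity ν m Θ θ₀) (z : Obs q) {θ : Param d} (hθ : θ ∈ Θ) :
    DifferentiableAt ℝ (fderiv ℝ (m z)) θ :=
  ((h.smooth z θ hθ).fderiv_right (m := 1) (by norm_num)).differentiableAt (by simp)

lemma hess_symm (h : Regularity ν m Θ θ₀) (z : Obs q) {θ : Param d} (hθ : θ ∈ Θ) (k l : Fin d) :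
    hess m z θ k l = hess m z θ l k := by
  have := (h.smooth z θ hθ).isSymmSndFDerivAt (by simp)
  exact this _ _

/-- Square integrable envelopes: `C₀` bounds the gradients and the increments of the objective,
`C₁` the increments of the gradients and of the Hessian matrices. -/
lemma exists_envelopes (h : Regularity ν m Θ θ₀) [IsProbabilityMeasure ν] :
    ∃ C₀ C₁ : Obs q → ℝ, MemLp C₀ 2 ν ∧ MemLp C₁ 2 ν ∧ (∀ z, 0 ≤ C₀ z) ∧ (∀ z, 0 ≤ C₁ z) ∧
      (∀ z, ∀ θ ∈ Θ, ‖gradient (m z) θ‖ ≤ C₀ z) ∧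
      (∀ z, ∀ θ₁ ∈ Θ, ∀ θ₂ ∈ Θ, ‖gradient (m z) θ₁ - gradient (m z) θ₂‖ ≤ C₁ z * ‖θ₁ - θ₂‖) ∧
      (∀ z, ∀ θ₁ ∈ Θ, ∀ θ₂ ∈ Θ, |m z θ₁ - m z θ₂| ≤ C₀ z * ‖θ₁ - θ₂‖) ∧
      (∀ z, ∀ θ₁ ∈ Θ, ∀ θ₂ ∈ Θ, ∀ k l, |hess m z θ₁ k l - hess m z θ₂ k l| ≤
        C₁ z * ‖θ₁ - θ₂‖) := by
  obtain ⟨ψ, hψ, hL⟩ := h.hess_lipschitz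
  have hD : 0 ≤ Metric.diam Θ := Metric.diam_nonneg
  set D := Metric.diam Θ
  have hdist : ∀ θ₁ ∈ Θ, ∀ θ₂ ∈ Θ, ‖θ₁ - θ₂‖ ≤ D := fun θ₁ h1 θ₂ h2 => by
    rw [← dist_eq_norm]; exact Metric.dist_le_diam_of_mem h.compact.isBounded h1 h2
  set B : Obs q → ℝ := fun z => ∑ k, ∑ l, |hess m z θ₀ k l| + |ψ z| * D with hB
  set C₁ : Obs q → ℝ := fun z => d * (d * B z) + |ψ z| with hC₁
  set C₀ : Obs q → ℝ := fun z => ‖gradient (m z) θ₀‖ + C₁ z * D with hC₀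
  have hBm : MemLp B 2 ν := by
    refine MemLp.add (memLp_finsetSum _ fun k _ => memLp_finsetSum _ fun l _ => ?_) ?_
    · exact (h.hess_sq_integrable θ₀ h.mem k l).abs
    · exact hψ.abs.mul_const D
  have hC₁m : MemLp C₁ 2 ν := ((hBm.const_mul d).const_mul d).add hψ.abs
  have hB0 : ∀ z, 0 ≤ B z := fun z => by positivity
  have hC₁0 : ∀ z, 0 ≤ C₁ z := fun z => by have := hB0 z; positivity
  have hC₀0 : ∀ z, 0 ≤ C₀ z := fun z => by have := hC₁0 z; positivity
  have hgrad : ∀ z, ∀ θ₁ ∈ Θ, ∀ θ₂ ∈ Θ, ‖gradient (m z) θ₁ - gradient (m z) θ₂‖ ≤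
      C₁ z * ‖θ₁ - θ₂‖ := by
    intro z θ₁ h1 θ₂ h2
    rw [norm_gradient_sub]
    refine h.convex.norm_image_sub_le_of_norm_fderiv_le (𝕜 := ℝ)
      (fun θ hθ => h.differentiableAt_fderiv z hθ) (fun θ hθ => ?_) h2 h1
    refine (norm_clm₂_le_of_forall_single _ (c := B z) fun k l => ?_).trans
      (le_add_of_nonneg_right (abs_nonneg _))
    change |hess m z θ k l| ≤ _
    have e1 := hL z θ hθ θ₀ h.mem k l
    have e2 : |hess m z θ₀ k l| ≤ ∑ k, ∑ l, |hess m z θ₀ k l| :=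
      (Finset.single_le_sum (f := fun l => |hess m z θ₀ k l|) (fun _ _ => abs_nonneg _)
        (Finset.mem_univ l)).trans (Finset.single_le_sum (f := fun k => ∑ l, |hess m z θ₀ k l|)
        (fun _ _ => Finset.sum_nonneg fun _ _ => abs_nonneg _) (Finset.mem_univ k))
    have e3 : ψ z * ‖θ - θ₀‖ ≤ |ψ z| * D :=
      mul_le_mul (le_abs_self _) (hdist θ hθ θ₀ h.mem) (norm_nonneg _) (abs_nonneg _)
    have e4 : |hess m z θ k l| ≤ |hess m z θ₀ k l| + |hess m z θ k l - hess m z θ₀ k l| := by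
      have := abs_add_le (hess m z θ₀ k l) (hess m z θ k l - hess m z θ₀ k l)
      simpa using this
    simp only [hB]
    linarith
  have hgb : ∀ z, ∀ θ ∈ Θ, ‖gradient (m z) θ‖ ≤ C₀ z := by
    intro z θ hθ
    have e1 := hgrad z θ hθ θ₀ h.mem
    have e2 := norm_sub_norm_le (gradient (m z) θ) (gradient (m z) θ₀)
    have e3 : C₁ z * ‖θ - θ₀‖ ≤ C₁ z * D :=
      mul_le_mul_of_nonneg_left (hdist θ hθ θ₀ h.mem) (hC₁0 z)
    simp only [hC₀]
    linarith
  refine ⟨C₀, C₁, (h.grad_sq_integrable θ₀ h.mem).norm.add (hC₁m.mul_const D), hC₁m, hC₀0, hC₁0,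
    hgb, hgrad, ?_, ?_⟩
  · intro z θ₁ h1 θ₂ h2
    refine h.convex.norm_image_sub_le_of_norm_fderiv_le (𝕜 := ℝ)
      (fun θ hθ => h.differentiableAt z hθ) (fun θ hθ => ?_) h2 h1
    rw [← norm_gradient]
    exact hgb z θ hθ
  · intro z θ₁ h1 θ₂ h2 k l
    refine (hL z θ₁ h1 θ₂ h2 k l).trans (mul_le_mul_of_nonneg_right ?_ (norm_nonneg _))
    have : 0 ≤ (d : ℝ) * (d * B z) := by have := hB0 z; positivity
    simp only [hC₁]
    linarith [le_abs_self (ψ z)]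

lemma continuousOn_gradient (h : Regularity ν m Θ θ₀) (z : Obs q) (k : Fin d) :
    ContinuousOn (fun θ => gradient (m z) θ k) Θ := by
  simp only [gradient_apply]
  intro θ hθ
  exact ((h.differentiableAt_fderiv z hθ).continuousAt.clm_apply continuousAt_const
    ).continuousWithinAt

lemma continuousOn_hess (h : Regularity ν m Θ θ₀) (z : Obs q) (k l : Fin d) :
    ContinuousOn (fun θ => hess m z θ k l) Θ := by
  intro θ hθ
  have h1 : ContinuousAt (fderiv ℝ (fderiv ℝ (m z))) θ :=
    (((h.smooth z θ hθ).fderiv_right (m := 1) (by norm_num)).fderiv_right (m := 0)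
      (by norm_num)).continuousAt
  exact ((h1.clm_apply continuousAt_const).clm_apply continuousAt_const).continuousWithinAt

lemma measurable_gradient (h : Regularity ν m Θ θ₀) {θ : Param d} (hθ : θ ∈ Θ) (k : Fin d) :
    Measurable fun z => gradient (m z) θ k := by
  simp only [gradient_apply]
  refine measurable_of_tendsto_metrizable (f := fun (j : ℕ) z => ((j : ℝ) + 1) •
    (m z (θ + ((j : ℝ) + 1)⁻¹ • EuclideanSpace.single k 1) - m z θ))
    (fun j => ((h.measurable _).sub (h.measurable _)).const_mul _) (tendsto_pi_nhds.2 fun z => ?_)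
  refine (h.differentiableAt z hθ).hasFDerivAt.lim _ ?_
  have : Tendsto (fun j : ℕ => (j : ℝ) + 1) atTop atTop :=
    tendsto_atTop_add_const_right _ _ tendsto_natCast_atTop_atTop
  exact tendsto_norm_atTop_atTop.comp this

lemma measurable_hess (h : Regularity ν m Θ θ₀) {θ : Param d} (hθ : θ ∈ Θ) (k l : Fin d) :
    Measurable fun z => hess m z θ k l := by
  -- first at interior points, where the difference quotients of the gradient stay in `Θ`
  have hint : ∀ θ ∈ _root_.interior Θ, Measurable fun z => hess m z θ k l := by
    intro θ hθ
    have hc : Tendsto (fun j : ℕ => (j : ℝ) + 1) atTop atTop :=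
      tendsto_atTop_add_const_right _ _ tendsto_natCast_atTop_atTop
    have hmem : ∀ᶠ j : ℕ in atTop,
        θ + ((j : ℝ) + 1)⁻¹ • EuclideanSpace.single k (1 : ℝ) ∈ Θ := by
      have : Tendsto (fun j : ℕ => θ + ((j : ℝ) + 1)⁻¹ • EuclideanSpace.single k (1 : ℝ)) atTop
          (𝓝 θ) := by
        simpa using ((tendsto_inv_atTop_zero.comp hc).smul_const
          (EuclideanSpace.single k (1 : ℝ))).const_add θ
      exact this.eventually (mem_interior_iff_mem_nhds.1 hθ)
    obtain ⟨N, hN⟩ := eventually_atTop.1 hmem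
    refine measurable_of_tendsto_metrizable (f := fun (j : ℕ) z => (((j + N : ℕ) : ℝ) + 1) •
      (gradient (m z) (θ + (((j + N : ℕ) : ℝ) + 1)⁻¹ • EuclideanSpace.single k 1) l -
        gradient (m z) θ l))
      (fun j => ((h.measurable_gradient (hN _ (by omega)) l).sub
        (h.measurable_gradient (interior_subset hθ) l)).const_mul _)
      (tendsto_pi_nhds.2 fun z => ?_)
    simp only [gradient_apply]
    have h1 := (h.differentiableAt_fderiv z (interior_subset hθ)).hasFDerivAt.lim
      (EuclideanSpace.single k 1)
      (tendsto_norm_atTop_atTop.comp (hc.comp (tendsto_add_atTop_nat N)))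
    exact ((ContinuousLinearMap.apply ℝ ℝ (EuclideanSpace.single l (1 : ℝ))).continuous.tendsto
      _).comp h1
  have hc : Tendsto (fun j : ℕ => ((j : ℝ) + 2)⁻¹) atTop (𝓝 0) :=
    tendsto_inv_atTop_zero.comp
      (tendsto_atTop_add_const_right _ _ tendsto_natCast_atTop_atTop)
  have hmem : ∀ j : ℕ, θ + ((j : ℝ) + 2)⁻¹ • (θ₀ - θ) ∈ _root_.interior Θ := by
    intro j
    refine h.convex.add_smul_sub_mem_interior hθ h.interior ⟨by positivity, ?_⟩
    exact inv_le_one_of_one_le₀ (by linarith [Nat.cast_nonneg (α := ℝ) j])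
  refine measurable_of_tendsto_metrizable
    (f := fun (j : ℕ) z => hess m z (θ + ((j : ℝ) + 2)⁻¹ • (θ₀ - θ)) k l)
    (fun j => hint _ (hmem j)) (tendsto_pi_nhds.2 fun z => ?_)
  refine ((h.continuousOn_hess z k l) θ hθ).tendsto.comp
    (tendsto_nhdsWithin_iff.2 ⟨?_, Eventually.of_forall fun j => interior_subset (hmem j)⟩)
  simpa using (hc.smul_const (θ₀ - θ)).const_add θ

end Regularity

/-- A function that is measurable in `z` and continuous in `θ ∈ Θ` can be evaluated at measurable
arguments. -/
lemma measurable_eval_of_continuousOn {Ω : Type*} [MeasurableSpace Ω] {F : Obs q → Param d → ℝ}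
    (hc : ∀ z, ContinuousOn (F z) Θ) (hm : ∀ θ ∈ Θ, Measurable fun z => F z θ)
    {Y : Ω → Obs q} {T : Ω → Param d} (hY : Measurable Y) (hT : Measurable T)
    (hTΘ : ∀ ω, T ω ∈ Θ) : Measurable fun ω => F (Y ω) (T ω) := by
  have h := stronglyMeasurable_uncurry_of_continuous_of_stronglyMeasurable
    (u := fun (θ : Θ) z => F z θ) (fun z => (hc z).domRestrict)
    (fun θ => (hm θ θ.2).stronglyMeasurable)
  exact h.measurable.comp ((hT.subtype_mk (h := hTΘ)).prodMk hY)

/-- First order expansion of a weighted score, on a convex set on which the weighted Hessian matrix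
is near to `A`. -/
lemma weighted_score_expansion (h : Regularity ν m Θ θ₀) {N : ℕ} (z : Fin N → Obs q)
    (w : Fin N → ℝ) (A : Matrix (Fin d) (Fin d) ℝ) {η : ℝ} {s : Set (Param d)} (hs : Convex ℝ s)
    (hsΘ : s ⊆ Θ) (hη : ∀ θ ∈ s, ∀ k l, |∑ i, w i * hess m (z i) θ k l - A k l| ≤ η)
    {θ₁ θ₂ : Param d} (h1 : θ₁ ∈ s) (h2 : θ₂ ∈ s) (l : Fin d) :
    |∑ i, w i * gradient (m (z i)) θ₁ l - ∑ i, w i * gradient (m (z i)) θ₂ l -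
      ∑ k, (θ₁ - θ₂) k * A k l| ≤ d * η * ‖θ₁ - θ₂‖ := by
  let e : Fin d → Param d := fun k => EuclideanSpace.single k 1
  let φ : Param d →L[ℝ] ℝ := ∑ k, A k l • EuclideanSpace.proj k
  have hd : ∀ θ ∈ s, ∀ i, HasFDerivAt (fun θ => w i * fderiv ℝ (m (z i)) θ (e l))
      (w i • (ContinuousLinearMap.apply ℝ ℝ (e l)).comp (fderiv ℝ (fderiv ℝ (m (z i))) θ)) θ := by
    intro θ hθ i
    exact ((ContinuousLinearMap.apply ℝ ℝ (e l)).hasFDerivAt.comp θ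
      (h.differentiableAt_fderiv (z i) (hsΘ hθ)).hasFDerivAt).const_mul (w i)
  have hd' : ∀ θ ∈ s, HasFDerivAt (fun θ => ∑ i, w i * fderiv ℝ (m (z i)) θ (e l))
      (∑ i, w i • (ContinuousLinearMap.apply ℝ ℝ (e l)).comp
        (fderiv ℝ (fderiv ℝ (m (z i))) θ)) θ :=
    fun θ hθ => HasFDerivAt.fun_sum fun i _ => hd θ hθ i
  have key := hs.norm_image_sub_le_of_norm_fderiv_le' (𝕜 := ℝ) (φ := φ) (C := d * η)
    (fun θ hθ => (hd' θ hθ).differentiableAt) (fun θ hθ => ?_) h2 h1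
  · simp only [gradient_apply]
    have e1 : φ (θ₁ - θ₂) = ∑ k, (θ₁ - θ₂) k * A k l := by
      simp [φ, mul_comm]
    rw [← e1]
    exact key
  · rw [(hd' θ hθ).fderiv]
    refine norm_clm_le_of_forall_single _ fun k => ?_
    convert! hη θ hθ k l using 2
    simp [φ, e, hess]

end calculus

/-! ### Consistency of weighted M-estimators -/

/-- The weights `W` satisfy the weak law of large numbers for square integrable functions of the
observations. -/
def LLN {q : ℕ} {Ω : Type*} [MeasurableSpace Ω] (P : Measure Ω) (ν : Measure (Obs q))
    (Z : ℕ → Ω → Obs q) (W : (n : ℕ) → Ω → Fin n → ℝ) : Prop :=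
  ∀ f : Obs q → ℝ, MemLp f 2 ν → Tendsto
    (fun x : ℕ × Ω => ∑ i, W x.1 x.2 i * f (data Z x.1 x.2 i)) (whp P) (𝓝 (∫ z, f z ∂ν))

section consistency

variable {q d : ℕ} {ν : Measure (Obs q)} [IsProbabilityMeasure ν] {m : Obs q → Param d → ℝ}
  {Θ : Set (Param d)} {θ₀ : Param d} {Ω : Type*} [MeasurableSpace Ω] {P : Measure Ω}
  {Z : ℕ → Ω → Obs q} {W : (n : ℕ) → Ω → Fin n → ℝ}

/-- Weighted M-estimators are consistent: the objective is Lipschitz, so that a finite net of the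
parameters away from `θ₀` controls it uniformly there. -/
theorem tendsto_argmax (h : Regularity ν m Θ θ₀) (hW : LLN P ν Z W)
    (hW0 : ∀ n ω i, 0 ≤ W n ω i) {T : ℕ → Ω → Param d}
    (hT : ∀ n ω, IsMaximizer Θ (fun θ => ∑ i, W n ω i * m (data Z n ω i) θ) (T n ω)) :
    Tendsto (fun x : ℕ × Ω => T x.1 x.2) (whp P) (𝓝 θ₀) := by
  obtain ⟨C₀, C₁, hC₀, -, hC₀0, -, -, -, hLip, -⟩ := h.exists_envelopes
  set M : Param d → ℝ := fun θ => ∫ z, m z θ ∂ν with hM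
  set c := ∫ z, C₀ z ∂ν with hc
  have hc0 : 0 ≤ c := integral_nonneg hC₀0
  have hMint : ∀ θ ∈ Θ, Integrable (fun z => m z θ) ν := fun θ hθ =>
    (h.sq_integrable θ hθ).integrable (by simp)
  have hMLip : ∀ θ₁ ∈ Θ, ∀ θ₂ ∈ Θ, |M θ₁ - M θ₂| ≤ c * ‖θ₁ - θ₂‖ := by
    intro θ₁ h1 θ₂ h2
    rw [hM, ← integral_sub (hMint _ h1) (hMint _ h2)]
    refine (abs_integral_le_integral_abs).trans ?_
    rw [hc, ← integral_mul_const]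
    exact integral_mono ((hMint _ h1).sub (hMint _ h2)).abs
      ((hC₀.integrable (by simp)).mul_const _) fun z => hLip z θ₁ h1 θ₂ h2
  rw [Metric.tendsto_nhds]
  intro η hη
  set K := Θ \ Metric.ball θ₀ η with hK
  have hKc : IsCompact K := h.compact.diff Metric.isOpen_ball
  obtain ⟨κ, hκ, hgap⟩ : ∃ κ > 0, ∀ θ ∈ K, M θ ≤ M θ₀ - 3 * κ := by
    rcases K.eq_empty_or_nonempty with he | hne
    · exact ⟨1, one_pos, by simp [he]⟩
    · have hcont : ContinuousOn M K := by
        have : LipschitzOnWith c.toNNReal M K := LipschitzOnWith.of_dist_le_mul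
          fun x hx y hy => by
            rw [Real.dist_eq, dist_eq_norm, Real.coe_toNNReal _ hc0]
            exact hMLip x hx.1 y hy.1
        exact this.continuousOn
      obtain ⟨θ₁, h1, hmax⟩ := hKc.exists_isMaxOn hne hcont
      have hne' : θ₁ ≠ θ₀ := fun he => h1.2 (he ▸ Metric.mem_ball_self hη)
      refine ⟨(M θ₀ - M θ₁) / 3, by linarith [h.unique_max θ₁ h1.1 hne'], fun θ hθ => ?_⟩
      have := isMaxOn_iff.1 hmax θ hθ
      linarith
  obtain ⟨t, htK, htf, htc⟩ := hKc.finite_cover_balls (e := κ / (c + 1)) (by positivity)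
  have hpt : ∀ θ ∈ Θ, ∀ᶠ x in whp P,
      |∑ i, W x.1 x.2 i * m (data Z x.1 x.2 i) θ - M θ| < κ / 2 := by
    intro θ hθ
    have := Metric.tendsto_nhds.1 (hW _ (h.sq_integrable θ hθ)) (κ / 2) (by positivity)
    simpa only [Real.dist_eq] using this
  have hnet : ∀ᶠ x in whp P, ∀ θ ∈ t,
      |∑ i, W x.1 x.2 i * m (data Z x.1 x.2 i) θ - M θ| < κ / 2 :=
    (htf.eventually_all).2 fun θ hθ => hpt θ (htK hθ).1
  have hC := (hW _ hC₀).eventually (gt_mem_nhds (show c < c + 1 by linarith))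
  filter_upwards [hnet, hpt θ₀ h.mem, hC] with x hx1 hx2 hx3
  by_contra hfar
  obtain ⟨hTΘ, hTmax⟩ := hT x.1 x.2
  have hTK : T x.1 x.2 ∈ K := ⟨hTΘ, hfar⟩
  obtain ⟨θ, hθt, hθ⟩ := Set.mem_iUnion₂.1 (htc hTK)
  have e1 := abs_lt.1 (hx1 θ hθt)
  have e2 := abs_lt.1 hx2
  have e3 := hgap θ (htK hθt)
  have e4 := isMaxOn_iff.1 hTmax θ₀ h.mem
  have e5 : ∑ i, W x.1 x.2 i * m (data Z x.1 x.2 i) (T x.1 x.2) -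
      ∑ i, W x.1 x.2 i * m (data Z x.1 x.2 i) θ ≤ κ := by
    rw [← Finset.sum_sub_distrib]
    calc _ ≤ ∑ i, W x.1 x.2 i * C₀ (data Z x.1 x.2 i) * ‖T x.1 x.2 - θ‖ := by
          refine Finset.sum_le_sum fun i _ => ?_
          rw [← mul_sub, mul_assoc]
          exact mul_le_mul_of_nonneg_left
            ((le_abs_self _).trans (hLip _ _ hTΘ _ (htK hθt).1)) (hW0 _ _ _)
      _ = (∑ i, W x.1 x.2 i * C₀ (data Z x.1 x.2 i)) * ‖T x.1 x.2 - θ‖ := by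
          rw [Finset.sum_mul]
      _ ≤ (c + 1) * (κ / (c + 1)) := by
          refine mul_le_mul hx3.le ?_ (norm_nonneg _) (by positivity)
          rw [← dist_eq_norm]
          exact (Metric.mem_ball.1 hθ).le
      _ = κ := by field_simp
  linarith [e1.1, e1.2, e2.1, e2.2]

/-- The weighted Hessian matrix is near to its limit, uniformly near `θ₀`. -/
theorem eventually_hess_near (h : Regularity ν m Θ θ₀) (hW : LLN P ν Z W)
    (hW0 : ∀ n ω i, 0 ≤ W n ω i) {ε : ℝ} (hε : 0 < ε) :
    ∃ ρ > 0, ∀ᶠ x in whp P, ∀ θ ∈ Θ, ‖θ - θ₀‖ < ρ → ∀ k l,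
      |∑ i, W x.1 x.2 i * hess m (data Z x.1 x.2 i) θ k l - ∫ z, hess m z θ₀ k l ∂ν| ≤ ε := by
  obtain ⟨C₀, C₁, -, hC₁, -, hC₁0, -, -, -, hH⟩ := h.exists_envelopes
  set c := ∫ z, C₁ z ∂ν with hc
  have hc0 : 0 ≤ c := integral_nonneg hC₁0
  refine ⟨ε / (2 * (c + 1)), by positivity, ?_⟩
  have hpt : ∀ᶠ x in whp P, ∀ k l,
      |∑ i, W x.1 x.2 i * hess m (data Z x.1 x.2 i) θ₀ k l - ∫ z, hess m z θ₀ k l ∂ν| <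
        ε / 2 := by
    refine eventually_all.2 fun k => eventually_all.2 fun l => ?_
    have := Metric.tendsto_nhds.1 (hW _ (h.hess_sq_integrable θ₀ h.mem k l)) (ε / 2) (by positivity)
    simpa only [Real.dist_eq] using this
  have hC := (hW _ hC₁).eventually (gt_mem_nhds (show c < c + 1 by linarith))
  filter_upwards [hpt, hC] with x hx1 hx2 θ hθ hθρ k l
  have e5 : |∑ i, W x.1 x.2 i * hess m (data Z x.1 x.2 i) θ k l -
      ∑ i, W x.1 x.2 i * hess m (data Z x.1 x.2 i) θ₀ k l| ≤ ε / 2 := by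
    rw [← Finset.sum_sub_distrib]
    refine (Finset.abs_sum_le_sum_abs _ _).trans ?_
    calc _ ≤ ∑ i, W x.1 x.2 i * C₁ (data Z x.1 x.2 i) * ‖θ - θ₀‖ := by
          refine Finset.sum_le_sum fun i _ => ?_
          rw [← mul_sub, mul_assoc, abs_mul, abs_of_nonneg (hW0 _ _ _)]
          exact mul_le_mul_of_nonneg_left (hH _ _ hθ _ h.mem k l) (hW0 _ _ _)
      _ = (∑ i, W x.1 x.2 i * C₁ (data Z x.1 x.2 i)) * ‖θ - θ₀‖ := by
          rw [Finset.sum_mul]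
      _ ≤ (c + 1) * (ε / (2 * (c + 1))) :=
          mul_le_mul hx2.le hθρ.le (norm_nonneg _) (by positivity)
      _ = ε / 2 := by field_simp
  have e6 := abs_sub_le (∑ i, W x.1 x.2 i * hess m (data Z x.1 x.2 i) θ k l)
    (∑ i, W x.1 x.2 i * hess m (data Z x.1 x.2 i) θ₀ k l) (∫ z, hess m z θ₀ k l ∂ν)
  linarith [hx1 k l]

end consistency

/-! ### Laws of large numbers for the three sampling schemes -/

section noise

variable {Ω : Type*} {mΩ : MeasurableSpace Ω} {P : Measure Ω} [IsProbabilityMeasure P]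

lemma lintegral_comp_of_indepFun {β E : Type*} {mβ : MeasurableSpace β} {mE : MeasurableSpace E}
    {X : Ω → β} {V : Ω → E} (hX : Measurable X) (hV : Measurable V) (hind : IndepFun X V P)
    {F : β × E → ENNReal} (hF : Measurable F) :
    ∫⁻ ω, F (X ω, V ω) ∂P = ∫⁻ ω, ∫⁻ u, F (X ω, u) ∂(P.map V) ∂P := by
  have := (indepFun_iff_map_prod_eq_prod_map_map hX.aemeasurable hV.aemeasurable).1 hind
  have hp : IsProbabilityMeasure (P.map V) := Measure.isProbabilityMeasure_map hV.aemeasurable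
  rw [← lintegral_map hF (hX.prodMk hV), this, lintegral_prod _ hF.aemeasurable,
    lintegral_map hF.lintegral_prod_right' hX]

lemma _root_.Measurable.htNoise {β : Type*} {mβ : MeasurableSpace β} {f g : β → ℝ}
    (hf : Measurable f) (hg : Measurable g) : Measurable fun x => htNoise (f x) (g x) :=
  measurable_htNoise.comp (hf.prodMk hg)

lemma measurable_htSum {β : Type*} {mβ : MeasurableSpace β} {n : ℕ} {c r : β → Fin n → ℝ}
    {V : β → Fin n → ℝ} (hc : Measurable c) (hr : Measurable r) (hV : Measurable V) :
    Measurable fun x => ∑ i, c x i * htNoise (r x i) (V x i) := by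
  have h1 : ∀ i, Measurable fun x => htNoise (r x i) (V x i) := fun i =>
    (measurable_pi_iff.1 hr i).htNoise (measurable_pi_iff.1 hV i)
  have h2 : ∀ i, Measurable fun x => c x i := fun i => measurable_pi_iff.1 hc i
  exact Finset.measurable_fun_sum _ fun i _ => (h2 i).mul (h1 i)

lemma lintegral_htSum_comp_sq_le {β : Type*} {mβ : MeasurableSpace β} {n : ℕ} {X : Ω → β}
    {V : Ω → Fin n → ℝ} (hX : Measurable X) (hV : Measurable V) (hind : IndepFun X V P)
    (hlaw : P.map V = Measure.pi fun _ => unif) {c r : β → Fin n → ℝ} (hc : Measurable c)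
    (hr : Measurable r) {ρ : ℝ} (hρ : 0 < ρ) (hρ1 : ρ ≤ 1) (hρr : ∀ x i, ρ ≤ r x i) :
    ∫⁻ ω, ENNReal.ofReal ((∑ i, c (X ω) i * htNoise (r (X ω) i) (V ω i)) ^ 2) ∂P ≤
      ∫⁻ ω, ENNReal.ofReal (ρ⁻¹ * ∑ i, c (X ω) i ^ 2) ∂P := by
  rw [lintegral_comp_of_indepFun hX hV hind
    (F := fun y => ENNReal.ofReal ((∑ i, c y.1 i * htNoise (r y.1 i) (y.2 i)) ^ 2)), hlaw]
  · refine lintegral_mono fun ω => ?_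
    exact lintegral_htSum_sq_le (c (X ω)) (r (X ω)) hρ hρ1 (hρr (X ω))
  · exact ((measurable_htSum (hc.comp measurable_fst) (hr.comp measurable_fst)
      measurable_snd).pow_const 2).ennreal_ofReal

end noise

/-- The version of the second moment bound in which weights and inclusion probabilities are
measurable with respect to a `σ`-algebra that is independent of the uniform random numbers. -/
lemma lintegral_htSum_sq_le_of_indep {Ω : Type*} {𝓕 mΩ : MeasurableSpace Ω} {P : Measure Ω}
    [IsProbabilityMeasure P] (h𝓕 : 𝓕 ≤ mΩ) {n : ℕ}
    {V : Ω → Fin n → ℝ} (hV : Measurable V)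
    (hind : Indep 𝓕 (MeasurableSpace.comap V inferInstance) P)
    (hlaw : P.map V = Measure.pi fun _ => unif) {c r : Ω → Fin n → ℝ} (hc : Measurable[𝓕] c)
    (hr : Measurable[𝓕] r) {ρ : ℝ} (hρ : 0 < ρ) (hρ1 : ρ ≤ 1) (hρr : ∀ ω i, ρ ≤ r ω i) :
    ∫⁻ ω, ENNReal.ofReal ((∑ i, c ω i * htNoise (r ω i) (V ω i)) ^ 2) ∂P ≤
      ∫⁻ ω, ENNReal.ofReal (ρ⁻¹ * ∑ i, c ω i ^ 2) ∂P := by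
  refine @lintegral_htSum_comp_sq_le Ω mΩ P _ Ω 𝓕 n id V (measurable_id'' h𝓕) hV ?_ hlaw c r hc hr
    ρ hρ hρ1 hρr
  refine (@IndepFun_iff_Indep Ω Ω _ mΩ 𝓕 _ id V P).2 ?_
  rw [MeasurableSpace.comap_id]
  exact hind

section lln

variable {q : ℕ} {ν : Measure (Obs q)} [IsProbabilityMeasure ν] {Ω : Type*} {mΩ : MeasurableSpace Ω}
  {P : Measure Ω} [IsProbabilityMeasure P] {Z : ℕ → Ω → Obs q}

lemma measurable_data (hZ : ∀ i, Measurable (Z i)) (n : ℕ) : Measurable (data Z n) :=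
  measurable_pi_lambda _ fun _ => hZ _

lemma tendsto_whp_of_ae {X : ℕ → Ω → ℝ} {c : ℝ} (hX : ∀ n, AEStronglyMeasurable (X n) P)
    (h : ∀ᵐ ω ∂P, Tendsto (fun n => X n ω) atTop (𝓝 c)) :
    Tendsto (fun x : ℕ × Ω => X x.1 x.2) (whp P) (𝓝 c) := by
  have := tendstoInMeasure_iff_dist.1 (tendstoInMeasure_of_tendsto_ae (g := fun _ => c) hX h)
  rw [Metric.tendsto_nhds]
  intro ε hε
  rw [eventually_whp]
  simpa only [not_lt] using this ε hε

variable (hZ : ∀ i, Measurable (Z i))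
  (hdata : ∀ n, P.map (data Z n) = Measure.pi fun _ : Fin n => ν)

include hZ hdata

omit [IsProbabilityMeasure P] in
lemma measurePreserving_obs (i : ℕ) : MeasurePreserving (Z i) P ν := by
  have h1 : MeasurePreserving (data Z (i + 1)) P (Measure.pi fun _ => ν) :=
    ⟨measurable_data hZ _, hdata _⟩
  exact (measurePreserving_eval (fun _ : Fin (i + 1) => ν) (Fin.last i)).comp h1

omit [IsProbabilityMeasure P] in
lemma ae_data_congr {f g : Obs q → ℝ} (hfg : f =ᵐ[ν] g) (n : ℕ) :
    ∀ᵐ ω ∂P, ∀ i, f (data Z n ω i) = g (data Z n ω i) :=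
  ae_all_iff.2 fun i => (measurePreserving_obs hZ hdata i).quasiMeasurePreserving.ae hfg

lemma indepFun_obs : Pairwise (Function.onFun (fun X Y => IndepFun X Y P) Z) := by
  intro i j hij
  set n := max i j + 1
  have h : iIndepFun (fun (k : Fin n) => Z k) P := by
    rw [iIndepFun_iff_map_fun_eq_pi_map fun k => (hZ _).aemeasurable]
    simp only [(measurePreserving_obs hZ hdata _).map_eq]
    exact hdata n
  exact h.indepFun (i := ⟨i, by omega⟩) (j := ⟨j, by omega⟩) (by simpa using hij)

lemma tendsto_average {f : Obs q → ℝ} (hf : Integrable f ν) :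
    Tendsto (fun x : ℕ × Ω => ∑ i, (x.1 : ℝ)⁻¹ * f (data Z x.1 x.2 i)) (whp P)
      (𝓝 (∫ z, f z ∂ν)) := by
  have hg : Measurable (hf.1.mk f) := hf.1.stronglyMeasurable_mk.measurable
  have hfg : f =ᵐ[ν] hf.1.mk f := hf.1.ae_eq_mk
  set g := hf.1.mk f
  have hgi : Integrable g ν := hf.congr hfg
  have hs : ∀ᵐ ω ∂P, Tendsto (fun n : ℕ => (∑ i ∈ Finset.range n, g (Z i ω)) / n) atTop
      (𝓝 (∫ z, g z ∂ν)) := by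
    have := strong_law_ae_real (fun i ω => g (Z i ω))
      ((measurePreserving_obs hZ hdata 0).integrable_comp_of_integrable hgi)
      (fun i j hij => (indepFun_obs hZ hdata hij).comp hg hg)
      (fun i => (⟨(hZ i).aemeasurable, (hZ 0).aemeasurable, by
        rw [(measurePreserving_obs hZ hdata i).map_eq,
          (measurePreserving_obs hZ hdata 0).map_eq]⟩ :
            IdentDistrib (Z i) (Z 0) P P).comp hg)
    have he : ∫ ω, g (Z 0 ω) ∂P = ∫ z, g z ∂ν := by
      rw [← (measurePreserving_obs hZ hdata 0).map_eq, integral_map (hZ 0).aemeasurable]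
      exact hg.aestronglyMeasurable
    rw [he] at this
    exact this
  have h1 := tendsto_whp_of_ae (fun n => ((Finset.measurable_fun_sum _ fun i _ =>
    hg.comp (hZ i)).div_const _).aestronglyMeasurable) hs
  rw [integral_congr_ae hfg]
  refine h1.congr' ?_
  refine eventually_whp_of_ae (Eventually.of_forall fun n => ?_)
  filter_upwards [ae_data_congr hZ hdata hfg n] with ω hω
  simp only [hω]
  rw [← Finset.mul_sum, div_eq_inv_mul, Finset.sum_range]
  rfl

lemma lln_full : LLN P ν Z fun n _ _ => (n : ℝ)⁻¹ :=
  fun _ hf => tendsto_average hZ hdata (hf.integrable (by simp))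

/-- Inverse probability weights satisfy the law of large numbers if the expected sample size, as
bounded below by `n * ρ n`, tends to infinity. -/
theorem lln_ht {𝓕 : ℕ → MeasurableSpace Ω} (h𝓕 : ∀ n, 𝓕 n ≤ mΩ)
    (h𝓕d : ∀ n, Measurable[𝓕 n] (data Z n)) {V : (n : ℕ) → Ω → Fin n → ℝ}
    (hV : ∀ n, Measurable (V n))
    (hind : ∀ n, Indep (𝓕 n) (MeasurableSpace.comap (V n) inferInstance) P)
    (hlaw : ∀ n, P.map (V n) = Measure.pi fun _ => unif) {r : (n : ℕ) → Ω → Fin n → ℝ}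
    (hr : ∀ n, Measurable[𝓕 n] (r n)) {ρ : ℕ → ℝ}
    (hρ : ∀ᶠ n in atTop, 0 < ρ n ∧ ρ n ≤ 1 ∧ ∀ ω i, ρ n ≤ r n ω i)
    (hnρ : Tendsto (fun n : ℕ => (n : ℝ) * ρ n) atTop atTop) :
    LLN P ν Z fun n ω i => (n : ℝ)⁻¹ * (1 + htNoise (r n ω i) (V n ω i)) := by
  intro f hf
  have hg : Measurable (hf.1.mk f) := hf.1.stronglyMeasurable_mk.measurable
  have hfg : f =ᵐ[ν] hf.1.mk f := hf.1.ae_eq_mk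
  set g := hf.1.mk f
  have hgi : MemLp g 2 ν := hf.ae_eq hfg
  have hcm : ∀ n, Measurable[𝓕 n] fun ω (i : Fin n) => (n : ℝ)⁻¹ * g (data Z n ω i) := fun n =>
    @measurable_pi_lambda _ _ _ (𝓕 n) _ _ fun i =>
      ((hg.comp (measurable_pi_apply i)).comp (h𝓕d n)).const_mul _
  have hnoise : Tendsto (fun x : ℕ × Ω => ∑ i, (x.1 : ℝ)⁻¹ * g (data Z x.1 x.2 i) *
      htNoise (r x.1 x.2 i) (V x.1 x.2 i)) (whp P) (𝓝 0) := by
    refine tendsto_zero_whp_of_lintegral_sq (X := fun n ω => ∑ i, (n : ℝ)⁻¹ * g (data Z n ω i) *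
      htNoise (r n ω i) (V n ω i)) (fun n => (measurable_htSum ((hcm n).mono (h𝓕 n) le_rfl)
        ((hr n).mono (h𝓕 n) le_rfl) (hV n)).aemeasurable) ?_
    have hlim : Tendsto (fun n : ℕ => ENNReal.ofReal (((n : ℝ) * ρ n)⁻¹ * ∫ z, g z ^ 2 ∂ν)) atTop
        (𝓝 0) := by
      have := ENNReal.tendsto_ofReal ((tendsto_inv_atTop_zero.comp hnρ).mul_const (∫ z, g z ^ 2 ∂ν))
      simpa using this
    refine tendsto_of_tendsto_of_tendsto_of_le_of_le' tendsto_const_nhds hlim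
      (Eventually.of_forall fun _ => zero_le) ?_
    filter_upwards [hρ, eventually_gt_atTop 0] with n ⟨h1, h2, h3⟩ hn
    refine (lintegral_htSum_sq_le_of_indep (h𝓕 n) (hV n) (hind n) (hlaw n) (hcm n) (hr n)
      h1 h2 h3).trans ?_
    have hint : ∀ i : Fin n, Integrable (fun ω => g (data Z n ω i) ^ 2) P := fun i =>
      (measurePreserving_obs hZ hdata i).integrable_comp_of_integrable hgi.integrable_sq
    have hint' : Integrable (fun ω => (ρ n)⁻¹ * ∑ i, ((n : ℝ)⁻¹ * g (data Z n ω i)) ^ 2) P := by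
      refine Integrable.const_mul (integrable_finsetSum _ fun i _ => ?_) _
      simp only [mul_pow]
      exact (hint i).const_mul _
    rw [← ofReal_integral_eq_lintegral_ofReal hint' (ae_of_all _ fun ω => by positivity)]
    refine ENNReal.ofReal_le_ofReal (le_of_eq ?_)
    simp only [mul_pow]
    rw [integral_const_mul, integral_finsetSum _ fun i _ => (hint i).const_mul _]
    have he : ∀ i : Fin n, ∫ ω, ((n : ℝ)⁻¹) ^ 2 * g (data Z n ω i) ^ 2 ∂P =
        ((n : ℝ)⁻¹) ^ 2 * ∫ z, g z ^ 2 ∂ν := by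
      intro i
      rw [integral_const_mul, ← (measurePreserving_obs hZ hdata i).map_eq,
        integral_map (hZ i).aemeasurable (hg.pow_const 2).aestronglyMeasurable]
      rfl
    simp only [he, Finset.sum_const, Finset.card_univ, Fintype.card_fin, nsmul_eq_mul]
    have : (n : ℝ) ≠ 0 := by positivity
    field_simp
  have hsum := (tendsto_average hZ hdata (hgi.integrable (by simp))).add hnoise
  rw [add_zero] at hsum
  rw [integral_congr_ae hfg]
  refine hsum.congr' (eventually_whp_of_ae (Eventually.of_forall fun n => ?_))
  filter_upwards [ae_data_congr hZ hdata hfg n] with ω hω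
  simp only [hω]
  rw [← Finset.sum_add_distrib]
  exact Finset.sum_congr rfl fun i _ => by ring

/-- The weights `1 / #S` on the indices in `S`. -/
noncomputable def meanWeight {n : ℕ} (S : Finset (Fin n)) (i : Fin n) : ℝ :=
  if i ∈ S then (S.card : ℝ)⁻¹ else 0

omit hZ hdata in
lemma meanWeight_nonneg {n : ℕ} (S : Finset (Fin n)) (i : Fin n) : 0 ≤ meanWeight S i := by
  unfold meanWeight; split_ifs <;> positivity

omit hZ hdata in
lemma sum_meanWeight_mul {n : ℕ} (S : Finset (Fin n)) (f : Fin n → ℝ) :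
    ∑ i, meanWeight S i * f i = ∑ i ∈ S, f i / S.card := by
  simp only [meanWeight, ite_mul, zero_mul, Finset.sum_ite_mem, Finset.univ_inter]
  exact Finset.sum_congr rfl fun i _ => by ring

/-- The pilot subsample has a random size; its means are quotients of inverse probability weighted
sums, to which `lln_ht` applies. -/
theorem lln_pilot {U₀ : (n : ℕ) → Ω → Fin n → ℝ} (hU₀ : ∀ n, Measurable (U₀ n))
    (hind : ∀ n, Indep (MeasurableSpace.comap (data Z n) inferInstance)
      (MeasurableSpace.comap (U₀ n) inferInstance) P)
    (hlaw : ∀ n, P.map (U₀ n) = Measure.pi fun _ => unif) {s₀ : ℕ → ℕ}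
    (hs₀ : Tendsto s₀ atTop atTop)
    (hs₀_small : (fun n => (s₀ n : ℝ)) =o[atTop] (fun n => (n : ℝ))) :
    LLN P ν Z fun n ω => meanWeight (pilotSet (s₀ n) (U₀ n ω)) := by
  have hle : ∀ᶠ n in atTop, (s₀ n : ℝ) ≤ n := by
    filter_upwards [hs₀_small.def (show (0 : ℝ) < 1 by norm_num)] with n hn
    simpa using hn
  have h1 := lln_ht hZ hdata (fun n => (measurable_data hZ n).comap_le)
    (fun n => comap_measurable _) hU₀ hind hlaw (r := fun n _ _ => (s₀ n : ℝ) / n)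
    (fun n => measurable_const) (ρ := fun n => (s₀ n : ℝ) / n) (by
      filter_upwards [hle, hs₀.eventually_gt_atTop 0, eventually_gt_atTop 0] with n h1 h2 h3
      exact ⟨by positivity, div_le_one_of_le₀ h1 (by positivity), fun _ _ => le_rfl⟩)
    ((tendsto_natCast_atTop_atTop.comp hs₀).congr' (by
      filter_upwards [eventually_gt_atTop 0] with n hn
      simp only [Function.comp]
      field_simp))
  intro f hf
  have h2 := (h1 f hf).div (h1 (fun _ => 1) (memLp_const 1)) (by simp)
  simp only [integral_const, probReal_univ, smul_eq_mul, mul_one, div_one] at h2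
  refine h2.congr' ?_
  have hev : ∀ᶠ n in atTop, (s₀ n : ℝ) ≤ n ∧ 0 < s₀ n ∧ 0 < n := by
    filter_upwards [hle, hs₀.eventually_gt_atTop 0, eventually_gt_atTop 0] with n h1 h2 h3
    exact ⟨h1, h2, h3⟩
  filter_upwards [tendsto_fst_whp.eventually hev] with x ⟨hx1, hx2, hx3⟩
  have hw : ∀ i, (x.1 : ℝ)⁻¹ * (1 + htNoise ((s₀ x.1 : ℝ) / x.1) (U₀ x.1 x.2 i)) =
      if i ∈ pilotSet (s₀ x.1) (U₀ x.1 x.2) then (s₀ x.1 : ℝ)⁻¹ else 0 := by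
    intro i
    have hm : min ((s₀ x.1 : ℝ) / x.1) 1 = (s₀ x.1 : ℝ) / x.1 :=
      min_eq_left (div_le_one_of_le₀ hx1 (by positivity))
    simp only [htNoise, pilotSet, Finset.mem_filter, Finset.mem_univ, true_and, hm]
    split_ifs
    · field_simp; ring
    · simp
  simp only [Pi.div_apply, hw, sum_meanWeight_mul, ite_mul, zero_mul, Finset.sum_ite_mem,
    Finset.univ_inter]
  rw [← Finset.mul_sum, Finset.sum_const, ← Finset.sum_div, nsmul_eq_mul, mul_comm _ (s₀ x.1 : ℝ)⁻¹,
    mul_div_mul_left _ _ (by positivity)]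

end lln

/-! ### Order statistics, sample quantiles and the optimal threshold -/

section orderStat

variable {ι : Type*} {S : Finset ι} {t : ι → ℝ} {k : ℕ}

lemma exists_isLeast_orderStat (hk : 1 ≤ k) (hkS : k ≤ S.card) :
    ∃ i ∈ S, orderStat S t k = t i ∧
      IsLeast {x : ℝ | k ≤ (S.filter fun i => t i ≤ x).card} (t i) := by
  classical
  have hS : S.Nonempty := Finset.card_pos.1 (by omega)
  obtain ⟨i₁, hi₁, hmax⟩ := S.exists_max_image t hS
  have hne : (S.filter fun i => k ≤ (S.filter fun j => t j ≤ t i).card).Nonempty := by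
    refine ⟨i₁, Finset.mem_filter.2 ⟨hi₁, ?_⟩⟩
    rwa [Finset.filter_true_of_mem hmax]
  obtain ⟨i₀, hi₀, hmin⟩ := Finset.exists_min_image _ t hne
  obtain ⟨hi₀S, hi₀k⟩ := Finset.mem_filter.1 hi₀
  have hleast : IsLeast {x : ℝ | k ≤ (S.filter fun i => t i ≤ x).card} (t i₀) := by
    refine ⟨hi₀k, fun x hx => ?_⟩
    have hx' : k ≤ (S.filter fun i => t i ≤ x).card := hx
    obtain ⟨i₂, hi₂, hmax₂⟩ := Finset.exists_max_image _ t
      (Finset.card_pos.1 (lt_of_lt_of_le (by omega) hx'))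
    obtain ⟨hi₂S, hi₂x⟩ := Finset.mem_filter.1 hi₂
    refine (hmin i₂ (Finset.mem_filter.2 ⟨hi₂S, hx'.trans (Finset.card_le_card ?_)⟩)).trans hi₂x
    intro j hj
    exact Finset.mem_filter.2 ⟨(Finset.mem_filter.1 hj).1, hmax₂ j hj⟩
  exact ⟨i₀, hi₀S, hleast.csInf_eq, hleast⟩

lemma le_card_filter_orderStat (hk : 1 ≤ k) (hkS : k ≤ S.card) :
    k ≤ (S.filter fun i => t i ≤ orderStat S t k).card := by
  obtain ⟨i, -, h1, h2⟩ := exists_isLeast_orderStat (t := t) hk hkS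
  rw [h1]; exact h2.1

lemma orderStat_le (hk : 1 ≤ k) (hkS : k ≤ S.card) {x : ℝ}
    (hx : k ≤ (S.filter fun i => t i ≤ x).card) : orderStat S t k ≤ x := by
  obtain ⟨i, -, h1, h2⟩ := exists_isLeast_orderStat (t := t) hk hkS
  rw [h1]; exact h2.2 hx

/-- The two junk values are zero: the order statistic of rank zero is the infimum of the whole line,
and those of rank above `#S` are infima of the empty set. -/
lemma orderStat_of_not (h : ¬ (1 ≤ k ∧ k ≤ S.card)) : orderStat S t k = 0 := by
  rcases Nat.eq_zero_or_pos k with h0 | h0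
  · simp [orderStat, h0]
  · have : {x : ℝ | k ≤ (S.filter fun i => t i ≤ x).card} = ∅ := by
      ext x
      simp only [Set.mem_ofPred_eq, Set.mem_empty_iff_false, iff_false, not_le]
      exact lt_of_le_of_lt (Finset.card_filter_le _ _) (by omega)
    rw [orderStat, this, Real.sInf_empty]

lemma orderStat_nonneg (ht : ∀ i, 0 ≤ t i) : 0 ≤ orderStat S t k := by
  by_cases h : 1 ≤ k ∧ k ≤ S.card
  · obtain ⟨i, -, h1, -⟩ := exists_isLeast_orderStat (t := t) h.1 h.2
    rw [h1]; exact ht i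
  · rw [orderStat_of_not h]

lemma upperSampleQuantile_nonneg (ht : ∀ i, 0 ≤ t i) (ρ : ℝ) : 0 ≤ upperSampleQuantile S t ρ :=
  orderStat_nonneg ht

lemma card_filter_le_add_lt (K : ℝ) : ((S.filter fun i => t i ≤ K).card : ℝ) +
    (S.filter fun i => K < t i).card = S.card := by
  have := Finset.card_filter_add_card_filter_not (s := S) (fun i => t i ≤ K)
  simp only [not_le] at this
  exact_mod_cast this

lemma one_le_ceil_rank (hS : S.Nonempty) {ρ : ℝ} (hρ1 : ρ < 1) :
    1 ≤ ⌈(S.card : ℝ) * (1 - ρ)⌉₊ :=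
  Nat.one_le_ceil_iff.2 (mul_pos (by exact_mod_cast Finset.card_pos.2 hS) (by linarith))

lemma ceil_rank_le {ρ : ℝ} (hρ0 : 0 ≤ ρ) : ⌈(S.card : ℝ) * (1 - ρ)⌉₊ ≤ S.card :=
  Nat.ceil_le.2 (mul_le_of_le_one_right (by positivity) (by linarith))

lemma lt_upperSampleQuantile {ρ K : ℝ} (hρ0 : 0 ≤ ρ) (hρ1 : ρ < 1)
    (h : (S.card : ℝ) * ρ < (S.filter fun i => K < t i).card) : K < upperSampleQuantile S t ρ := by
  have hS : S.Nonempty := by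
    by_contra hS
    rw [Finset.not_nonempty_iff_eq_empty] at hS
    simp [hS] at h
  by_contra! hq
  have h1 := le_card_filter_orderStat (t := t) (one_le_ceil_rank hS hρ1) (ceil_rank_le hρ0)
  have h2 : (S.filter fun i => t i ≤ upperSampleQuantile S t ρ).card ≤
      (S.filter fun i => t i ≤ K).card :=
    Finset.card_le_card fun i hi => by
      simp only [Finset.mem_filter] at hi ⊢; exact ⟨hi.1, hi.2.trans hq⟩
  have h3 := Nat.ceil_le.1 (h1.trans h2)
  have h4 := card_filter_le_add_lt (S := S) (t := t) K
  linarith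

lemma upperSampleQuantile_le {ρ K : ℝ} (hρ0 : 0 ≤ ρ) (hρ1 : ρ < 1) (hK : 0 ≤ K)
    (h : ((S.filter fun i => K < t i).card : ℝ) ≤ S.card * ρ) : upperSampleQuantile S t ρ ≤ K := by
  rcases S.eq_empty_or_nonempty with hS | hS
  · rw [upperSampleQuantile, orderStat_of_not (by simp [hS])]; exact hK
  · refine orderStat_le (one_le_ceil_rank hS hρ1) (ceil_rank_le hρ0) (Nat.ceil_le.2 ?_)
    have h4 := card_filter_le_add_lt (S := S) (t := t) K
    linarith

end orderStat

lemma sum_meanWeight_indicator {n : ℕ} (S : Finset (Fin n)) (t : Fin n → ℝ) (K : ℝ) :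
    ∑ i, meanWeight S i * (if K < t i then 1 else 0) =
      ((S.filter fun i => K < t i).card : ℝ) / S.card := by
  rw [sum_meanWeight_mul, ← Finset.sum_div, Finset.sum_boole]

section cutoff

variable {n : ℕ} {t : Fin n → ℝ} {s : ℕ}

/-- The cutoff exists as soon as more than `s` of the values are positive. -/
lemma exists_isCutoff (ht : ∀ i, 0 ≤ t i) (hs : 0 < s) (hsn : s < n)
    (hpos : s < (Finset.univ.filter fun i => 0 < t i).card) : ∃ g, IsCutoff s t g := by
  classical
  let p : ℕ → Prop := fun g => g < s ∧ orderStat Finset.univ t (n - g) /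
    ∑ i ∈ Finset.Icc 1 (n - g), orderStat Finset.univ t i < 1 / ((s : ℝ) - g)
  have hp : ∃ g, p g := by
    refine ⟨s - 1, by omega, ?_⟩
    have e1 : n - (s - 1) = (n - s) + 1 := by omega
    have e2 : (s : ℝ) - ((s - 1 : ℕ) : ℝ) = 1 := by
      rw [Nat.cast_sub (by omega)]; simp
    rw [e1, e2, Finset.sum_Icc_succ_top (by omega), div_one]
    set A := ∑ i ∈ Finset.Icc 1 (n - s), orderStat Finset.univ t i with hA
    set x := orderStat Finset.univ t (n - s + 1) with hx
    have hx0 : 0 ≤ x := orderStat_nonneg ht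
    have hA0 : orderStat Finset.univ t (n - s) ≤ A :=
      Finset.single_le_sum (f := fun i => orderStat Finset.univ t i)
        (fun _ _ => orderStat_nonneg ht) (Finset.mem_Icc.2 ⟨by omega, le_rfl⟩)
    have hpos' : 0 < orderStat Finset.univ t (n - s) := by
      by_contra! hle
      have h1 := le_card_filter_orderStat (S := Finset.univ) (t := t) (k := n - s) (by omega)
        (by simp)
      have h2 := card_filter_le_add_lt (S := Finset.univ) (t := t) 0
      have h3 : (Finset.univ.filter fun i => t i ≤ orderStat Finset.univ t (n - s)).card ≤
          (Finset.univ.filter fun i => t i ≤ 0).card :=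
        Finset.card_le_card fun i hi => by
          simp only [Finset.mem_filter] at hi ⊢; exact ⟨hi.1, hi.2.trans hle⟩
      rw [Finset.card_univ, Fintype.card_fin] at h2
      have h4 : (Finset.univ.filter fun i => t i ≤ 0).card +
        (Finset.univ.filter fun i => 0 < t i).card = n := by exact_mod_cast h2
      omega
    rw [div_lt_one (by linarith)]
    linarith
  obtain ⟨h1, h2⟩ := Nat.find_spec hp
  refine ⟨Nat.find hp, h1, h2, ?_⟩
  rcases Nat.eq_zero_or_pos (Nat.find hp) with h0 | h0
  · exact Or.inl h0
  · refine Or.inr ?_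
    have hnot := Nat.find_min hp (m := Nat.find hp - 1) (by omega)
    generalize Nat.find hp = g at *
    have e1 : n - (g - 1) = n - g + 1 := by omega
    have e2 : (s : ℝ) - ((g - 1 : ℕ) : ℝ) = s - g + 1 := by
      rw [Nat.cast_sub (by omega)]; push_cast; ring
    simp only [p, e1, e2, not_and, not_lt] at hnot
    exact hnot (by omega)

/-- Fewer than `s` of the values exceed the optimal threshold. -/
lemma card_optThreshold_lt (ht : ∀ i, 0 ≤ t i) (hsn : s < n) (hex : ∃ g, IsCutoff s t g) :
    (Finset.univ.filter fun i => optThreshold s t < t i).card < s := by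
  obtain ⟨h1, h2, -⟩ : IsCutoff s t (cutoff s t) := Nat.sInf_mem hex
  have hH : optThreshold s t = (∑ i ∈ Finset.Icc 1 (n - cutoff s t),
    orderStat Finset.univ t i) / ((s : ℝ) - cutoff s t) := rfl
  generalize cutoff s t = g at *
  have hsg : (0 : ℝ) < s - g := by
    have : (g : ℝ) < s := by exact_mod_cast h1
    linarith
  have hle : orderStat Finset.univ t (n - g) ≤ optThreshold s t := by
    rw [hH]
    set A := ∑ i ∈ Finset.Icc 1 (n - g), orderStat Finset.univ t i with hA
    have hA0 : orderStat Finset.univ t (n - g) ≤ A :=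
      Finset.single_le_sum (f := fun i => orderStat Finset.univ t i)
        (fun _ _ => orderStat_nonneg ht) (Finset.mem_Icc.2 ⟨by omega, le_rfl⟩)
    have hA1 : 0 ≤ A := Finset.sum_nonneg fun i _ => orderStat_nonneg ht
    rcases hA1.eq_or_lt with h0 | h0
    · rw [← h0] at hA0 ⊢; simpa using hA0
    · rw [div_lt_div_iff₀ h0 hsg] at h2
      rw [le_div_iff₀ hsg]
      linarith
  have h3 := le_card_filter_orderStat (S := Finset.univ) (t := t) (k := n - g) (by omega)
    (by simp)
  have h4 : (Finset.univ.filter fun i => t i ≤ orderStat Finset.univ t (n - g)).card ≤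
      (Finset.univ.filter fun i => t i ≤ optThreshold s t).card :=
    Finset.card_le_card fun i hi => by
      simp only [Finset.mem_filter] at hi ⊢; exact ⟨hi.1, hi.2.trans hle⟩
  have h5 := card_filter_le_add_lt (S := Finset.univ) (t := t) (optThreshold s t)
  rw [Finset.card_univ, Fintype.card_fin] at h5
  have h6 : (Finset.univ.filter fun i => t i ≤ optThreshold s t).card +
    (Finset.univ.filter fun i => optThreshold s t < t i).card = n := by exact_mod_cast h5
  omega

end cutoff

/-! ### Limits of the thresholds and of the truncated gradient norms -/

section thresholds

variable {q d : ℕ} {ν : Measure (Obs q)} [IsProbabilityMeasure ν] {m : Obs q → Param d → ℝ}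
  {Θ : Set (Param d)} {θ₀ : Param d} {Ω : Type*} [MeasurableSpace Ω] {P : Measure Ω}
  {Z : ℕ → Ω → Obs q} {W : (n : ℕ) → Ω → Fin n → ℝ} {T : ℕ → Ω → Param d}

omit [IsProbabilityMeasure ν] in
lemma Regularity.measurable_gradNorm (h : Regularity ν m Θ θ₀) {θ : Param d} (hθ : θ ∈ Θ) :
    Measurable fun z => gradNorm m z θ := by
  unfold gradNorm
  simp only [EuclideanSpace.norm_eq]
  refine Measurable.sqrt (Finset.measurable_fun_sum _ fun k _ => ?_)
  exact ((h.measurable_gradient hθ k).norm).pow_const 2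

omit [IsProbabilityMeasure ν] in
lemma Regularity.memLp_gradNorm (h : Regularity ν m Θ θ₀) {θ : Param d} (hθ : θ ∈ Θ) :
    MemLp (fun z => gradNorm m z θ) 2 ν := (h.grad_sq_integrable θ hθ).norm

lemma gradNorm_nonneg (z : Obs q) (θ : Param d) : 0 ≤ gradNorm m z θ := norm_nonneg _

/-- The plugged-in gradient norms are near to those at `θ₀`, in weighted mean. -/
lemma tendsto_sum_abs_gradNorm_sub (h : Regularity ν m Θ θ₀) (hW : LLN P ν Z W)
    (hW0 : ∀ n ω i, 0 ≤ W n ω i) (hTΘ : ∀ n ω, T n ω ∈ Θ)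
    (hT : Tendsto (fun x : ℕ × Ω => T x.1 x.2) (whp P) (𝓝 θ₀)) :
    Tendsto (fun x : ℕ × Ω => ∑ i, W x.1 x.2 i * |gradNorm m (data Z x.1 x.2 i) (T x.1 x.2) -
      gradNorm m (data Z x.1 x.2 i) θ₀|) (whp P) (𝓝 0) := by
  obtain ⟨C₀, C₁, -, hC₁, -, -, -, hg, -, -⟩ := h.exists_envelopes
  have hT0 : Tendsto (fun x : ℕ × Ω => ‖T x.1 x.2 - θ₀‖) (whp P) (𝓝 0) :=
    tendsto_iff_norm_sub_tendsto_zero.1 hT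
  have hlim := (hW _ hC₁).mul hT0
  rw [mul_zero] at hlim
  refine squeeze_zero (fun x => Finset.sum_nonneg fun i _ => mul_nonneg (hW0 _ _ _)
    (abs_nonneg _)) (fun x => ?_) hlim
  rw [Finset.sum_mul]
  refine Finset.sum_le_sum fun i _ => ?_
  rw [mul_assoc]
  refine mul_le_mul_of_nonneg_left ?_ (hW0 _ _ _)
  exact (abs_norm_sub_norm_le _ _).trans (hg _ _ (hTΘ _ _) _ h.mem)

lemma memLp_indicator_lt (h : Regularity ν m Θ θ₀) (K : ℝ) :
    MemLp (fun z => if K < gradNorm m z θ₀ then (1 : ℝ) else 0) 2 ν := by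
  refine MemLp.of_bound (Measurable.ite (measurableSet_lt measurable_const
    (h.measurable_gradNorm h.mem)) measurable_const measurable_const).aestronglyMeasurable 1
    (ae_of_all _ fun z => ?_)
  split_ifs <;> simp

omit [IsProbabilityMeasure ν] in
lemma integral_indicator_lt (h : Regularity ν m Θ θ₀) (K : ℝ) :
    ∫ z, (if K < gradNorm m z θ₀ then (1 : ℝ) else 0) ∂ν = ν.real {z | K < gradNorm m z θ₀} := by
  have hm : MeasurableSet {z | K < gradNorm m z θ₀} :=
    measurableSet_lt measurable_const (h.measurable_gradNorm h.mem)
  rw [← integral_indicator_one hm]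
  refine integral_congr_ae (ae_of_all _ fun z => ?_)
  simp [Set.indicator]

lemma eventually_lt_fraction (h : Regularity ν m Θ θ₀) (hW : LLN P ν Z W)
    (hW0 : ∀ n ω i, 0 ≤ W n ω i) (hTΘ : ∀ n ω, T n ω ∈ Θ)
    (hT : Tendsto (fun x : ℕ × Ω => T x.1 x.2) (whp P) (𝓝 θ₀)) {K K' c : ℝ} (hK : K < K')
    (hc : c < ν.real {z | K' < gradNorm m z θ₀}) :
    ∀ᶠ x in whp P, c < ∑ i, W x.1 x.2 i *
      (if K < gradNorm m (data Z x.1 x.2 i) (T x.1 x.2) then 1 else 0) := by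
  have hlim := (hW _ (memLp_indicator_lt h K')).sub
    ((tendsto_sum_abs_gradNorm_sub h hW hW0 hTΘ hT).div_const (K' - K))
  rw [integral_indicator_lt h, zero_div, sub_zero] at hlim
  filter_upwards [hlim.eventually (lt_mem_nhds hc)] with x hx
  refine hx.trans_le ?_
  rw [Finset.sum_div, ← Finset.sum_sub_distrib]
  refine Finset.sum_le_sum fun i _ => ?_
  rw [mul_div_assoc, ← mul_sub]
  refine mul_le_mul_of_nonneg_left ?_ (hW0 _ _ _)
  generalize gradNorm m (data Z x.1 x.2 i) (T x.1 x.2) = a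
  generalize gradNorm m (data Z x.1 x.2 i) θ₀ = b
  have h0 : 0 ≤ |a - b| / (K' - K) := div_nonneg (abs_nonneg _) (by linarith)
  split_ifs with h1 h2 h2 <;> try linarith
  have : 1 ≤ |a - b| / (K' - K) := by
    rw [le_div_iff₀ (by linarith)]
    linarith [neg_abs_le (a - b)]
  linarith

lemma eventually_fraction_lt (h : Regularity ν m Θ θ₀) (hW : LLN P ν Z W)
    (hW0 : ∀ n ω i, 0 ≤ W n ω i) (hTΘ : ∀ n ω, T n ω ∈ Θ)
    (hT : Tendsto (fun x : ℕ × Ω => T x.1 x.2) (whp P) (𝓝 θ₀)) {K K' c : ℝ} (hK : K' < K)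
    (hc : ν.real {z | K' < gradNorm m z θ₀} < c) :
    ∀ᶠ x in whp P, ∑ i, W x.1 x.2 i *
      (if K < gradNorm m (data Z x.1 x.2 i) (T x.1 x.2) then 1 else 0) < c := by
  have hlim := (hW _ (memLp_indicator_lt h K')).add
    ((tendsto_sum_abs_gradNorm_sub h hW hW0 hTΘ hT).div_const (K - K'))
  rw [integral_indicator_lt h, zero_div, add_zero] at hlim
  filter_upwards [hlim.eventually (gt_mem_nhds hc)] with x hx
  refine lt_of_le_of_lt ?_ hx
  rw [Finset.sum_div, ← Finset.sum_add_distrib]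
  refine Finset.sum_le_sum fun i _ => ?_
  rw [mul_div_assoc, ← mul_add]
  refine mul_le_mul_of_nonneg_left ?_ (hW0 _ _ _)
  generalize gradNorm m (data Z x.1 x.2 i) (T x.1 x.2) = a
  generalize gradNorm m (data Z x.1 x.2 i) θ₀ = b
  have h0 : 0 ≤ |a - b| / (K - K') := div_nonneg (abs_nonneg _) (by linarith)
  split_ifs with h1 h2 h2 <;> try linarith
  have : 1 ≤ |a - b| / (K - K') := by
    rw [le_div_iff₀ (by linarith)]
    linarith [le_abs_self (a - b)]
  linarith

/-- Sample quantiles of the plugged-in gradient norms over a random set of indices are eventually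
above every level that is below the population quantile. -/
lemma eventually_lt_quantile (h : Regularity ν m Θ θ₀) {S : (n : ℕ) → Ω → Finset (Fin n)}
    (hS : LLN P ν Z fun n ω => meanWeight (S n ω)) (hTΘ : ∀ n ω, T n ω ∈ Θ)
    (hT : Tendsto (fun x : ℕ × Ω => T x.1 x.2) (whp P) (𝓝 θ₀)) {ρ : ℕ → ℝ} {ϱ : ℝ}
    (hρ : Tendsto ρ atTop (𝓝 ϱ)) (hρ0 : ∀ n, 0 ≤ ρ n) (hϱ1 : ϱ < 1) {K K' : ℝ} (hK : K < K')
    (hc : ϱ < ν.real {z | K' < gradNorm m z θ₀}) :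
    ∀ᶠ x in whp P, K < upperSampleQuantile (S x.1 x.2)
      (fun i => gradNorm m (data Z x.1 x.2 i) (T x.1 x.2)) (ρ x.1) := by
  obtain ⟨c, hc1, hc2⟩ := exists_between hc
  filter_upwards [eventually_lt_fraction h hS (fun _ _ => meanWeight_nonneg _) hTΘ hT hK hc2,
    tendsto_fst_whp.eventually (hρ.eventually (gt_mem_nhds hc1)),
    tendsto_fst_whp.eventually (hρ.eventually (gt_mem_nhds hϱ1))] with x hx1 hx2 hx3
  refine lt_upperSampleQuantile (hρ0 _) hx3 ?_
  rw [sum_meanWeight_indicator] at hx1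
  rcases Nat.eq_zero_or_pos (S x.1 x.2).card with h0 | h0
  · rw [h0] at hx1
    have := hρ0 x.1
    simp at hx1
    linarith
  · have h0' : (0 : ℝ) < (S x.1 x.2).card := by exact_mod_cast h0
    have h1 := (hx2.trans hx1)
    rw [lt_div_iff₀ h0'] at h1
    linarith

lemma eventually_quantile_le (h : Regularity ν m Θ θ₀) {S : (n : ℕ) → Ω → Finset (Fin n)}
    (hS : LLN P ν Z fun n ω => meanWeight (S n ω)) (hTΘ : ∀ n ω, T n ω ∈ Θ)
    (hT : Tendsto (fun x : ℕ × Ω => T x.1 x.2) (whp P) (𝓝 θ₀)) {ρ : ℕ → ℝ} {ϱ : ℝ}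
    (hρ : Tendsto ρ atTop (𝓝 ϱ)) (hρ0 : ∀ n, 0 ≤ ρ n) (hϱ1 : ϱ < 1) {K K' : ℝ} (hK : K' < K)
    (hK0 : 0 ≤ K) (hc : ν.real {z | K' < gradNorm m z θ₀} < ϱ) :
    ∀ᶠ x in whp P, upperSampleQuantile (S x.1 x.2)
      (fun i => gradNorm m (data Z x.1 x.2 i) (T x.1 x.2)) (ρ x.1) ≤ K := by
  obtain ⟨c, hc1, hc2⟩ := exists_between hc
  filter_upwards [eventually_fraction_lt h hS (fun _ _ => meanWeight_nonneg _) hTΘ hT hK hc1,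
    tendsto_fst_whp.eventually (hρ.eventually (lt_mem_nhds hc2)),
    tendsto_fst_whp.eventually (hρ.eventually (gt_mem_nhds hϱ1))] with x hx1 hx2 hx3
  refine upperSampleQuantile_le (hρ0 _) hx3 hK0 ?_
  rw [sum_meanWeight_indicator] at hx1
  rcases Nat.eq_zero_or_pos (S x.1 x.2).card with h0 | h0
  · rw [Finset.card_eq_zero] at h0; simp [h0]
  · have h0' : (0 : ℝ) < (S x.1 x.2).card := by exact_mod_cast h0
    have h1 := (hx1.trans hx2)
    rw [div_lt_iff₀ h0'] at h1
    linarith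

/-- Under uniqueness of the population quantile, sample quantiles are consistent. -/
lemma tendsto_quantile (h : Regularity ν m Θ θ₀) {S : (n : ℕ) → Ω → Finset (Fin n)}
    (hS : LLN P ν Z fun n ω => meanWeight (S n ω)) (hTΘ : ∀ n ω, T n ω ∈ Θ)
    (hT : Tendsto (fun x : ℕ × Ω => T x.1 x.2) (whp P) (𝓝 θ₀)) {ρ : ℕ → ℝ} {ϱ : ℝ}
    (hρ : Tendsto ρ atTop (𝓝 ϱ)) (hρ0 : ∀ n, 0 ≤ ρ n) (hϱ1 : ϱ < 1) {ζ : ℝ} (hζ : 0 < ζ)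
    (hlow : ∀ K < ζ, ϱ < ν.real {z | K < gradNorm m z θ₀})
    (hup : ∀ K, ζ < K → ν.real {z | K < gradNorm m z θ₀} < ϱ) :
    Tendsto (fun x : ℕ × Ω => upperSampleQuantile (S x.1 x.2)
      (fun i => gradNorm m (data Z x.1 x.2 i) (T x.1 x.2)) (ρ x.1)) (whp P) (𝓝 ζ) := by
  rw [Metric.tendsto_nhds]
  intro ε hε
  filter_upwards [eventually_lt_quantile h hS hTΘ hT hρ hρ0 hϱ1
      (show ζ - ε / 2 < ζ - ε / 4 by linarith) (hlow _ (by linarith)),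
    eventually_quantile_le h hS hTΘ hT hρ hρ0 hϱ1 (show ζ + ε / 4 < ζ + ε / 2 by linarith)
      (by linarith) (hup _ (by linarith))] with x h1 h2
  rw [Real.dist_eq, abs_lt]
  constructor <;> linarith

lemma tendsto_sum_abs_min_sub_min (h : Regularity ν m Θ θ₀) (hW : LLN P ν Z W)
    (hW0 : ∀ n ω i, 0 ≤ W n ω i) (hTΘ : ∀ n ω, T n ω ∈ Θ)
    (hT : Tendsto (fun x : ℕ × Ω => T x.1 x.2) (whp P) (𝓝 θ₀)) {H : ℕ → Ω → ℝ} {ζ : ℝ}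
    (hH : Tendsto (fun x : ℕ × Ω => H x.1 x.2) (whp P) (𝓝 ζ)) :
    Tendsto (fun x : ℕ × Ω => ∑ i, W x.1 x.2 i *
      |min (gradNorm m (data Z x.1 x.2 i) (T x.1 x.2)) (H x.1 x.2) -
        min (gradNorm m (data Z x.1 x.2 i) θ₀) ζ|) (whp P) (𝓝 0) := by
  have hlim := (tendsto_sum_abs_gradNorm_sub h hW hW0 hTΘ hT).add
    ((hW _ (memLp_const 1)).mul (tendsto_iff_norm_sub_tendsto_zero.1 hH))
  rw [mul_zero, add_zero] at hlim
  refine squeeze_zero (fun x => Finset.sum_nonneg fun i _ => mul_nonneg (hW0 _ _ _)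
    (abs_nonneg _)) (fun x => ?_) hlim
  rw [Finset.sum_mul, ← Finset.sum_add_distrib]
  refine Finset.sum_le_sum fun i _ => ?_
  rw [mul_one, ← mul_add]
  refine mul_le_mul_of_nonneg_left ?_ (hW0 _ _ _)
  exact (abs_min_sub_min_le_max _ _ _ _).trans
    (max_le_add_of_nonneg (abs_nonneg _) (abs_nonneg _))

/-- There is a level that the gradient norm exceeds with positive probability, while the mean excess
over it is small. -/
lemma exists_level (h : Regularity ν m Θ θ₀) (hpos : 0 < ν.real {z | 0 < gradNorm m z θ₀})
    {ε : ℝ} (hε : 0 < ε) : ∃ K K' : ℝ, K < K' ∧ 0 < ν.real {z | K' < gradNorm m z θ₀} ∧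
      ∫ z, max (gradNorm m z θ₀ - K) 0 ∂ν < ε := by
  set t : Obs q → ℝ := fun z => gradNorm m z θ₀ with ht
  have htm : Measurable t := h.measurable_gradNorm h.mem
  have hti : Integrable t ν := (h.memLp_gradNorm h.mem).integrable (by simp)
  by_cases hb : ∃ L, ν.real {z | L < t z} = 0
  · -- bounded gradient norms: take levels just below the essential supremum
    set A := {K : ℝ | 0 < ν.real {z | K < t z}} with hA
    have hanti : ∀ K K', K ≤ K' → ν.real {z | K' < t z} ≤ ν.real {z | K < t z} := fun K K' hK =>
      measureReal_mono fun z hz => lt_of_le_of_lt hK hz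
    obtain ⟨L, hL⟩ := hb
    have hbdd : BddAbove A := ⟨L, fun K hK => by
      by_contra! hlt
      have h1 : 0 < ν.real {z | K < t z} := hK
      linarith [hanti L K hlt.le]⟩
    have hne : A.Nonempty := ⟨0, hpos⟩
    have habove : ∀ᵐ z ∂ν, t z ≤ sSup A + ε / 4 := by
      have : ν.real {z | sSup A + ε / 4 < t z} = 0 := by
        by_contra hne0
        have : sSup A + ε / 4 ∈ A := lt_of_le_of_ne measureReal_nonneg (Ne.symm hne0)
        linarith [le_csSup hbdd this]
      rw [measureReal_eq_zero_iff] at this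
      rw [ae_iff]; simpa only [not_le] using this
    obtain ⟨a, haA, ha⟩ := exists_lt_of_lt_csSup hne (show sSup A - ε / 4 < sSup A by linarith)
    have haA' : 0 < ν.real {z | a < t z} := haA
    refine ⟨sSup A - ε / 2, sSup A - ε / 4, by linarith, haA'.trans_le (hanti _ _ ha.le), ?_⟩
    have hle : ∫ z, max (t z - (sSup A - ε / 2)) 0 ∂ν ≤ ∫ _z, 3 * ε / 4 ∂ν := by
      refine integral_mono_ae ((hti.sub (integrable_const _)).sup (integrable_const 0))
        (integrable_const _) ?_
      filter_upwards [habove] with z hz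
      exact max_le (by linarith) (by linarith)
    simp at hle
    linarith
  · push Not at hb
    have hlim : Tendsto (fun L : ℕ => ∫ z, max (t z - L) 0 ∂ν) atTop (𝓝 (∫ _z, (0 : ℝ) ∂ν)) := by
      refine tendsto_integral_of_dominated_convergence t
        (fun L => ((htm.sub_const _).max measurable_const).aestronglyMeasurable) hti
        (fun L => ae_of_all _ fun z => ?_) (ae_of_all _ fun z => ?_)
      · rw [Real.norm_of_nonneg (le_max_right _ _)]
        exact max_le (by linarith [Nat.cast_nonneg (α := ℝ) L]) (gradNorm_nonneg _ _)
      · refine tendsto_const_nhds.congr' ?_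
        obtain ⟨N, hN⟩ := exists_nat_ge (t z)
        filter_upwards [eventually_ge_atTop N] with L hL
        rw [max_eq_right]
        have : (N : ℝ) ≤ L := by exact_mod_cast hL
        linarith
    rw [integral_zero] at hlim
    obtain ⟨L, hL⟩ := (hlim.eventually (gt_mem_nhds hε)).exists
    exact ⟨L, L + 1, by linarith, lt_of_le_of_ne measureReal_nonneg (hb _).symm, hL⟩

/-- If the thresholds eventually exceed every level that is not essentially maximal, truncation is
asymptotically negligible. -/
lemma tendsto_sum_abs_min_sub (h : Regularity ν m Θ θ₀) (hW : LLN P ν Z W)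
    (hW0 : ∀ n ω i, 0 ≤ W n ω i) (hTΘ : ∀ n ω, T n ω ∈ Θ)
    (hT : Tendsto (fun x : ℕ × Ω => T x.1 x.2) (whp P) (𝓝 θ₀))
    (hpos : 0 < ν.real {z | 0 < gradNorm m z θ₀}) {H : ℕ → Ω → ℝ}
    (hH : ∀ K K' : ℝ, K < K' → 0 < ν.real {z | K' < gradNorm m z θ₀} →
      ∀ᶠ x in whp P, K < H x.1 x.2) :
    Tendsto (fun x : ℕ × Ω => ∑ i, W x.1 x.2 i *
      |min (gradNorm m (data Z x.1 x.2 i) (T x.1 x.2)) (H x.1 x.2) -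
        gradNorm m (data Z x.1 x.2 i) θ₀|) (whp P) (𝓝 0) := by
  rw [Metric.tendsto_nhds]
  intro ε hε
  obtain ⟨K, K', hKK, hK', hKε⟩ := exists_level h hpos hε
  have hmem : MemLp (fun z => max (gradNorm m z θ₀ - K) 0) 2 ν :=
    ((h.memLp_gradNorm h.mem).sub (memLp_const K)).sup (memLp_const 0)
  have hlim := (tendsto_sum_abs_gradNorm_sub h hW hW0 hTΘ hT).add (hW _ hmem)
  rw [zero_add] at hlim
  filter_upwards [hlim.eventually (gt_mem_nhds hKε), hH K K' hKK hK'] with x hx1 hx2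
  rw [Real.dist_eq, sub_zero, abs_of_nonneg (Finset.sum_nonneg fun i _ => mul_nonneg (hW0 _ _ _)
    (abs_nonneg _))]
  refine lt_of_le_of_lt ?_ hx1
  rw [← Finset.sum_add_distrib]
  refine Finset.sum_le_sum fun i _ => ?_
  rw [← mul_add]
  refine mul_le_mul_of_nonneg_left ?_ (hW0 _ _ _)
  generalize gradNorm m (data Z x.1 x.2 i) (T x.1 x.2) = a
  generalize gradNorm m (data Z x.1 x.2 i) θ₀ = b
  have h1 := le_max_left (b - K) 0
  have h2 := le_max_right (b - K) 0
  have h3 := le_abs_self (a - b)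
  have h4 := neg_abs_le (a - b)
  rw [abs_le]
  rcases le_total a (H x.1 x.2) with h5 | h5
  · rw [min_eq_left h5]; constructor <;> linarith
  · rw [min_eq_right h5]; constructor <;> linarith

end thresholds

/-! ### The limit of the conditional variance of the score -/

/-- With `c = s / n` and `a = n * π`, the factor `(s / n) (1 - p) / p` of the score variance is
`varFactor a c`. -/
noncomputable def varFactor (a c : ℝ) : ℝ := max (1 / a - c) 0

lemma varFactor_nonneg (a c : ℝ) : 0 ≤ varFactor a c := le_max_right _ _

lemma varFactor_le {α a c : ℝ} (hα : 0 < α) (ha : α ≤ a) (hc : 0 ≤ c) : varFactor a c ≤ 1 / α :=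
  max_le (by have := one_div_le_one_div_of_le hα ha; linarith) (by positivity)

lemma abs_varFactor_sub_le {α a a' c c' : ℝ} (hα : 0 < α) (ha : α ≤ a) (ha' : α ≤ a') :
    |varFactor a c - varFactor a' c'| ≤ (α ^ 2)⁻¹ * |a - a'| + |c - c'| := by
  refine (abs_max_sub_max_le_abs _ _ _).trans ?_
  have h1 : (1 / a - c) - (1 / a' - c') = (a' - a) / (a * a') - (c - c') := by
    have := hα.trans_le ha
    have := hα.trans_le ha'
    field_simp; ring
  rw [h1]
  refine (abs_sub _ _).trans (add_le_add ?_ le_rfl)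
  have h2 : 0 < a * a' := mul_pos (hα.trans_le ha) (hα.trans_le ha')
  rw [abs_div, abs_of_pos h2, abs_sub_comm, div_eq_inv_mul]
  refine mul_le_mul_of_nonneg_right (inv_anti₀ (by positivity) ?_) (abs_nonneg _)
  rw [sq]; exact mul_le_mul ha ha' hα.le (hα.le.trans ha)

lemma varFactor_eq {a s n : ℝ} (ha : 0 < a) (hs : 0 < s) (hn : 0 < n) :
    s / n ^ 2 * ((1 - min (s * (a / n)) 1) / min (s * (a / n)) 1) = n⁻¹ * varFactor a (s / n) := by
  rw [varFactor]
  rcases le_total (s * (a / n)) 1 with h | h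
  · rw [min_eq_left h, max_eq_left]
    · field_simp
    · rw [sub_nonneg, le_div_iff₀ ha]; rw [← mul_div_assoc] at h; rw [div_mul_eq_mul_div]; exact h
  · rw [min_eq_right h, max_eq_right]
    · simp
    · rw [sub_nonpos, div_le_iff₀ ha]; rw [← mul_div_assoc] at h; rw [div_mul_eq_mul_div]; exact h

lemma measurable_varFactor : Measurable fun x : ℝ × ℝ => varFactor x.1 x.2 := by
  unfold varFactor; fun_prop

lemma scoreVar_apply {q d n : ℕ} (m : Obs q → Param d → ℝ) {s : ℕ} (hs : 0 < s) (hn : 0 < n)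
    {π a : Fin n → ℝ} (hπ : ∀ i, π i = a i / n) (ha : ∀ i, 0 < a i) (D : Fin n → Obs q)
    (θ : Param d) (k l : Fin d) :
    scoreVar m s π D θ k l = ∑ i, (n : ℝ)⁻¹ * (varFactor (a i) ((s : ℝ) / n) *
      (gradient (m (D i)) θ k * gradient (m (D i)) θ l)) := by
  rw [scoreVar, Matrix.smul_apply, Matrix.sum_apply, smul_eq_mul, Finset.mul_sum]
  refine Finset.sum_congr rfl fun i _ => ?_
  rw [Matrix.smul_apply, Matrix.vecMulVec_apply, smul_eq_mul, inclusionProb, hπ, ← mul_assoc,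
    varFactor_eq (ha i) (by exact_mod_cast hs) (by exact_mod_cast hn), mul_assoc]

section posDef

variable {q d : ℕ} {ν : Measure (Obs q)} {m : Obs q → Param d → ℝ} {Θ : Set (Param d)}
  {θ₀ : Param d}

lemma integrable_mul_gradient (h : Regularity ν m Θ θ₀) {c : Obs q → ℝ} (hc : Measurable c)
    {B : ℝ} (hB : ∀ z, |c z| ≤ B) (k l : Fin d) :
    Integrable (fun z => c z * (gradient (m z) θ₀ k * gradient (m z) θ₀ l)) ν := by
  have hk : ∀ k, MemLp (fun z => gradient (m z) θ₀ k) 2 ν := fun k =>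
    MemLp.of_le (h.grad_sq_integrable θ₀ h.mem)
      (h.measurable_gradient h.mem k).aestronglyMeasurable
      (ae_of_all _ fun z => PiLp.norm_apply_le _ k)
  exact ((hk k).integrable_mul (hk l)).bdd_mul hc.aestronglyMeasurable (ae_of_all _ hB)

lemma quadraticForm_integral (h : Regularity ν m Θ θ₀) {c : Obs q → ℝ} (hc : Measurable c)
    {B : ℝ} (hB : ∀ z, |c z| ≤ B) (x : Fin d → ℝ) :
    star x ⬝ᵥ ((Matrix.of fun k l =>
      ∫ z, c z * (gradient (m z) θ₀ k * gradient (m z) θ₀ l) ∂ν) *ᵥ x)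
      = ∫ z, c z * (∑ k, x k * gradient (m z) θ₀ k) ^ 2 ∂ν := by
  have hi := integrable_mul_gradient h hc hB
  simp only [dotProduct, Matrix.mulVec, Matrix.of_apply, star_trivial]
  have e : ∀ z, c z * (∑ k, x k * gradient (m z) θ₀ k) ^ 2 =
      ∑ k, ∑ l, x k * x l * (c z * (gradient (m z) θ₀ k * gradient (m z) θ₀ l)) := by
    intro z
    rw [sq, Finset.sum_mul_sum, Finset.mul_sum]
    refine Finset.sum_congr rfl fun k _ => ?_
    rw [Finset.mul_sum]
    exact Finset.sum_congr rfl fun l _ => by ring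
  simp only [e]
  rw [integral_finsetSum _ fun k _ => integrable_finsetSum _ fun l _ => (hi k l).const_mul _]
  refine Finset.sum_congr rfl fun k _ => ?_
  rw [integral_finsetSum _ fun l _ => (hi k l).const_mul _, Finset.mul_sum]
  refine Finset.sum_congr rfl fun l _ => ?_
  rw [integral_const_mul]; ring

/-- Positive definiteness of a weighted moment matrix of the gradient depends only on where the
weight is positive. -/
lemma posDef_weighted (h : Regularity ν m Θ θ₀) {c c' : Obs q → ℝ} (hc : Measurable c)
    (hc' : Measurable c') {B B' : ℝ} (hB : ∀ z, |c z| ≤ B) (hB' : ∀ z, |c' z| ≤ B')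
    (hc0 : ∀ z, 0 ≤ c z) (hzero : ∀ z, c z = 0 → c' z = 0)
    (hpos : (Matrix.of fun k l =>
      ∫ z, c' z * (gradient (m z) θ₀ k * gradient (m z) θ₀ l) ∂ν).PosDef) :
    (Matrix.of fun k l => ∫ z, c z * (gradient (m z) θ₀ k * gradient (m z) θ₀ l) ∂ν).PosDef := by
  refine Matrix.PosDef.of_dotProduct_mulVec_pos ?_ fun x hx => ?_
  · ext k l
    simp only [Matrix.conjTranspose_apply, Matrix.of_apply, star_trivial]
    exact integral_congr_ae (ae_of_all _ fun z => by ring)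
  · have h1 := hpos.dotProduct_mulVec_pos hx
    rw [quadraticForm_integral h hc hB]
    rw [quadraticForm_integral h hc' hB'] at h1
    have hint : Integrable (fun z => c z * (∑ k, x k * gradient (m z) θ₀ k) ^ 2) ν := by
      have e : ∀ z, c z * (∑ k, x k * gradient (m z) θ₀ k) ^ 2 =
          ∑ k, ∑ l, x k * x l * (c z * (gradient (m z) θ₀ k * gradient (m z) θ₀ l)) := by
        intro z
        rw [sq, Finset.sum_mul_sum, Finset.mul_sum]
        refine Finset.sum_congr rfl fun k _ => ?_
        rw [Finset.mul_sum]
        exact Finset.sum_congr rfl fun l _ => by ring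
      simp only [e]
      exact integrable_finsetSum _ fun k _ => integrable_finsetSum _ fun l _ =>
        (integrable_mul_gradient h hc hB k l).const_mul _
    have hnn : ∀ z, 0 ≤ c z * (∑ k, x k * gradient (m z) θ₀ k) ^ 2 := fun z =>
      mul_nonneg (hc0 z) (sq_nonneg _)
    refine lt_of_le_of_ne (integral_nonneg hnn) fun h0 => h1.ne' ?_
    have hae := (integral_eq_zero_iff_of_nonneg hnn hint).1 h0.symm
    refine (integral_congr_ae ?_).trans (integral_zero _ _)
    filter_upwards [hae] with z hz
    rcases mul_eq_zero.1 hz with h2 | h2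
    · simp [hzero z h2]
    · simp [h2]

end posDef

section variance

variable {q d : ℕ} {ν : Measure (Obs q)} [IsProbabilityMeasure ν] {m : Obs q → Param d → ℝ}
  {Θ : Set (Param d)} {θ₀ : Param d} {Ω : Type*} [MeasurableSpace Ω] {P : Measure Ω}
  [IsProbabilityMeasure P] {Z : ℕ → Ω → Obs q}

omit [IsProbabilityMeasure ν] [IsProbabilityMeasure P] in
lemma FourthMomentBounded.bddInProb {θhat : ℕ → Ω → Param d}
    (hf : FourthMomentBounded P Z m Θ θhat) (hΘ : ∀ n ω, θhat n ω ∈ Θ) :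
    BddInProb P fun x => ∑ i, (x.1 : ℝ)⁻¹ * gradNorm m (data Z x.1 x.2 i) (θhat x.1 x.2) ^ 4 := by
  obtain ⟨r, hr, hf⟩ := hf
  intro ε hε
  obtain ⟨K, hK⟩ := hf ε hε
  refine ⟨K, ?_⟩
  filter_upwards [hK] with n hn
  refine le_trans (measure_mono fun ω hω => ?_) hn
  refine ⟨θhat n ω, hΘ n ω, by simpa using hr, ?_⟩
  simp only [Set.mem_ofPred_eq] at hω
  rwa [abs_of_nonneg (Finset.sum_nonneg fun i _ => by positivity), ← Finset.mul_sum,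
    inv_mul_eq_div] at hω

/-- The score variance converges as soon as the truncated gradient norms, from which the
subsampling probabilities are formed, converge in mean. Optimal probabilities and those from the
pilot sample fall under this with the same limit. -/
theorem tendsto_scoreVar (h : Regularity ν m Θ θ₀) (hZ : ∀ i, Measurable (Z i))
    (hdata : ∀ n, P.map (data Z n) = Measure.pi fun _ : Fin n => ν) {θhat : ℕ → Ω → Param d}
    (hΘ : ∀ n ω, θhat n ω ∈ Θ)
    (hθ : Tendsto (fun x : ℕ × Ω => θhat x.1 x.2) (whp P) (𝓝 θ₀))
    (hf : FourthMomentBounded P Z m Θ θhat) {α κ μ : ℝ} (hα : α ∈ Set.Ioo (0 : ℝ) 1) (hμ : 0 < μ)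
    (hκ : 0 ≤ κ) {s : ℕ → ℕ} (hs : Tendsto s atTop atTop)
    (hsκ : Tendsto (fun n => (s n : ℝ) / n) atTop (𝓝 κ)) {w : Obs q → ℝ} (hw : MemLp w 2 ν)
    (hwm : Measurable w) (hw0 : ∀ z, 0 ≤ w z) {τ : (n : ℕ) → Ω → Fin n → ℝ} {Ψ : ℕ → Ω → ℝ}
    (hτ0 : ∀ n ω i, 0 ≤ τ n ω i) (hΨ0 : ∀ n ω, 0 ≤ Ψ n ω)
    (hτ : Tendsto (fun x : ℕ × Ω => ∑ i, (x.1 : ℝ)⁻¹ * |τ x.1 x.2 i - w (data Z x.1 x.2 i)|)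
      (whp P) (𝓝 0))
    (hΨ : Tendsto (fun x : ℕ × Ω => Ψ x.1 x.2) (whp P) (𝓝 μ)) :
    Tendsto (fun x : ℕ × Ω => scoreVar m (s x.1)
      (mixProb α fun i => τ x.1 x.2 i / (x.1 * Ψ x.1 x.2)) (data Z x.1 x.2) (θhat x.1 x.2))
      (whp P) (𝓝 (Matrix.of fun k l => ∫ z, varFactor ((1 - α) * (w z / μ) + α) κ *
        (gradient (m z) θ₀ k * gradient (m z) θ₀ l) ∂ν)) := by
  obtain ⟨hα0, hα1⟩ := hα
  set a : (n : ℕ) → Ω → Fin n → ℝ := fun n ω i => (1 - α) * (τ n ω i / Ψ n ω) + α with ha_def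
  set A : Obs q → ℝ := fun z => (1 - α) * (w z / μ) + α with hA_def
  have hαa : ∀ n ω i, α ≤ a n ω i := fun n ω i => by
    have := mul_nonneg (sub_nonneg.2 hα1.le) (div_nonneg (hτ0 n ω i) (hΨ0 n ω))
    simp only [ha_def]; linarith
  have hαA : ∀ z, α ≤ A z := fun z => by
    have := mul_nonneg (sub_nonneg.2 hα1.le) (div_nonneg (hw0 z) hμ.le)
    simp only [hA_def]; linarith
  have hAm : Measurable A := by fun_prop
  have hav : ∀ {f : Obs q → ℝ}, Integrable f ν → Tendsto (fun x : ℕ × Ω =>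
    ∑ i, (x.1 : ℝ)⁻¹ * f (data Z x.1 x.2 i)) (whp P) (𝓝 (∫ z, f z ∂ν)) :=
    fun hf => tendsto_average hZ hdata hf
  -- mean convergence of the scaled probabilities
  have h1 : Tendsto (fun x : ℕ × Ω => ∑ i, (x.1 : ℝ)⁻¹ *
      |a x.1 x.2 i - A (data Z x.1 x.2 i)|) (whp P) (𝓝 0) := by
    have hlim := ((hΨ.inv₀ hμ.ne').mul hτ).add
      ((((hΨ.inv₀ hμ.ne').sub_const μ⁻¹).abs).mul (hav (hw.integrable (by simp))))
    simp only [mul_zero, sub_self, abs_zero, zero_mul, add_zero] at hlim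
    refine squeeze_zero' (Eventually.of_forall fun x => by positivity) ?_ hlim
    filter_upwards [hΨ.eventually (lt_mem_nhds hμ)] with x hx
    rw [Finset.mul_sum, Finset.mul_sum, ← Finset.sum_add_distrib]
    refine Finset.sum_le_sum fun i _ => ?_
    generalize hwi : w (data Z x.1 x.2 i) = wi
    have hwi0 : 0 ≤ wi := hwi ▸ hw0 _
    have e : a x.1 x.2 i - A (data Z x.1 x.2 i) = (1 - α) *
        ((Ψ x.1 x.2)⁻¹ * (τ x.1 x.2 i - wi) + ((Ψ x.1 x.2)⁻¹ - μ⁻¹) * wi) := by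
      simp only [ha_def, hA_def, hwi]; ring
    have e2 : |a x.1 x.2 i - A (data Z x.1 x.2 i)| ≤ (Ψ x.1 x.2)⁻¹ * |τ x.1 x.2 i - wi| +
        |(Ψ x.1 x.2)⁻¹ - μ⁻¹| * wi := by
      rw [e, abs_mul, abs_of_pos (by linarith : 0 < 1 - α)]
      refine (mul_le_of_le_one_left (abs_nonneg _) (by linarith)).trans ?_
      refine (abs_add_le _ _).trans (le_of_eq ?_)
      rw [abs_mul, abs_mul, abs_of_pos (inv_pos.2 hx), abs_of_nonneg hwi0]
    calc _ ≤ (x.1 : ℝ)⁻¹ * ((Ψ x.1 x.2)⁻¹ * |τ x.1 x.2 i - wi| +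
        |(Ψ x.1 x.2)⁻¹ - μ⁻¹| * wi) := by gcongr
      _ = _ := by ring
  -- mean convergence of the factors
  set φ : (x : ℕ × Ω) → Fin x.1 → ℝ := fun x i => varFactor (a x.1 x.2 i) ((s x.1 : ℝ) / x.1)
  set φ₀ : Obs q → ℝ := fun z => varFactor (A z) κ with hφ₀
  have hφ₀m : Measurable φ₀ := measurable_varFactor.comp (hAm.prodMk measurable_const)
  have hφ₀b : ∀ z, |φ₀ z| ≤ 1 / α := fun z => by
    rw [abs_of_nonneg (varFactor_nonneg _ _)]; exact varFactor_le hα0 (hαA z) hκ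
  have hφd : ∀ x i, |φ x i - φ₀ (data Z x.1 x.2 i)| ≤ 1 / α := fun x i => by
    have e1 := varFactor_nonneg (a x.1 x.2 i) ((s x.1 : ℝ) / x.1)
    have e2 := varFactor_le hα0 (hαa x.1 x.2 i) (show 0 ≤ (s x.1 : ℝ) / x.1 by positivity)
    have e3 := varFactor_nonneg (A (data Z x.1 x.2 i)) κ
    have e4 := varFactor_le hα0 (hαA (data Z x.1 x.2 i)) hκ
    rw [abs_le]; constructor <;> simp only [φ, φ₀] <;> linarith
  have h2 : Tendsto (fun x : ℕ × Ω => ∑ i, (x.1 : ℝ)⁻¹ *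
      |φ x i - φ₀ (data Z x.1 x.2 i)|) (whp P) (𝓝 0) := by
    have hs' : Tendsto (fun x : ℕ × Ω => |(s x.1 : ℝ) / x.1 - κ|) (whp P) (𝓝 0) := by
      have := ((hsκ.sub_const κ).abs).comp (tendsto_fst_whp (P := P))
      simpa [Function.comp_def] using this
    have hlim := (h1.const_mul (α ^ 2)⁻¹).add (hs'.mul (hav (integrable_const (1 : ℝ))))
    simp only [mul_zero, zero_mul, add_zero] at hlim
    refine squeeze_zero (fun x => by positivity) (fun x => ?_) hlim
    rw [Finset.mul_sum, Finset.mul_sum, ← Finset.sum_add_distrib]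
    refine Finset.sum_le_sum fun i _ => ?_
    calc _ ≤ (x.1 : ℝ)⁻¹ * ((α ^ 2)⁻¹ * |a x.1 x.2 i - A (data Z x.1 x.2 i)| +
          |(s x.1 : ℝ) / x.1 - κ|) := by
          gcongr
          exact abs_varFactor_sub_le hα0 (hαa _ _ _) (hαA _)
      _ = _ := by ring
  -- the change of the factors is negligible, by the Cauchy-Schwarz inequality
  have h3 : Tendsto (fun x : ℕ × Ω => ∑ i, (x.1 : ℝ)⁻¹ * (|φ x i - φ₀ (data Z x.1 x.2 i)| *
      gradNorm m (data Z x.1 x.2 i) (θhat x.1 x.2) ^ 2)) (whp P) (𝓝 0) := by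
    have hlim := ((hf.bddInProb hΘ).mul_tendsto_zero (h2.const_mul (1 / α) |>.trans
      (by rw [mul_zero]))).sqrt
    rw [Real.sqrt_zero] at hlim
    refine squeeze_zero (fun x => by positivity) (fun x => Real.le_sqrt_of_sq_le ?_) hlim
    have hcs := Finset.sum_mul_sq_le_sq_mul_sq Finset.univ
      (fun i => √((x.1 : ℝ)⁻¹) * gradNorm m (data Z x.1 x.2 i) (θhat x.1 x.2) ^ 2)
      (fun i => √((x.1 : ℝ)⁻¹) * |φ x i - φ₀ (data Z x.1 x.2 i)|)
    have hsq : √((x.1 : ℝ)⁻¹) ^ 2 = (x.1 : ℝ)⁻¹ := Real.sq_sqrt (by positivity)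
    have e1 : ∑ i, (x.1 : ℝ)⁻¹ * (|φ x i - φ₀ (data Z x.1 x.2 i)| *
        gradNorm m (data Z x.1 x.2 i) (θhat x.1 x.2) ^ 2) =
        ∑ i, (√((x.1 : ℝ)⁻¹) * gradNorm m (data Z x.1 x.2 i) (θhat x.1 x.2) ^ 2) *
          (√((x.1 : ℝ)⁻¹) * |φ x i - φ₀ (data Z x.1 x.2 i)|) :=
      Finset.sum_congr rfl fun i _ => by
        conv_lhs => rw [← hsq]
        ring
    rw [e1]
    refine hcs.trans (mul_le_mul (le_of_eq ?_) ?_ (by positivity) (by positivity))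
    · exact Finset.sum_congr rfl fun i _ => by rw [mul_pow, hsq]; ring
    · rw [Finset.mul_sum]
      refine Finset.sum_le_sum fun i _ => ?_
      rw [mul_pow, hsq, sq, mul_left_comm]
      have := hφd x i
      gcongr
  refine tendsto_pi_nhds.2 fun k => tendsto_pi_nhds.2 fun l => ?_
  -- the plugged-in parameter is negligible
  obtain ⟨C₀, C₁, hC₀, hC₁, hC₀0, hC₁0, hg0, hg1, -, -⟩ := h.exists_envelopes
  have h4 : Tendsto (fun x : ℕ × Ω => ∑ i, (x.1 : ℝ)⁻¹ *
      (C₀ (data Z x.1 x.2 i) * C₁ (data Z x.1 x.2 i)) * (2 * (1 / α) * ‖θhat x.1 x.2 - θ₀‖))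
      (whp P) (𝓝 0) := by
    simp only [← Finset.sum_mul]
    have := (hav (hC₀.integrable_mul hC₁)).mul
      ((tendsto_iff_norm_sub_tendsto_zero.1 hθ).const_mul (2 * (1 / α)))
    simpa using this
  have h5 := hav (integrable_mul_gradient h hφ₀m hφ₀b k l)
  have h6 : Tendsto (fun x : ℕ × Ω => ∑ i, (x.1 : ℝ)⁻¹ * (φ x i *
      (gradient (m (data Z x.1 x.2 i)) (θhat x.1 x.2) k *
        gradient (m (data Z x.1 x.2 i)) (θhat x.1 x.2) l)) -
      ∑ i, (x.1 : ℝ)⁻¹ * (φ₀ (data Z x.1 x.2 i) * (gradient (m (data Z x.1 x.2 i)) θ₀ k *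
        gradient (m (data Z x.1 x.2 i)) θ₀ l))) (whp P) (𝓝 0) := by
    have hlim := h3.add h4
    rw [add_zero] at hlim
    refine squeeze_zero_norm (fun x => ?_) hlim
    rw [← Finset.sum_sub_distrib, ← Finset.sum_add_distrib]
    refine (norm_sum_le _ _).trans (Finset.sum_le_sum fun i _ => ?_)
    generalize data Z x.1 x.2 i = z
    generalize hgk : gradient (m z) (θhat x.1 x.2) = g
    generalize hgk0 : gradient (m z) θ₀ = g₀
    have b1 : ∀ j, |g j| ≤ C₀ z := fun j =>
      (PiLp.norm_apply_le g j).trans (hgk ▸ hg0 z _ (hΘ _ _))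
    have b2 : ∀ j, |g₀ j| ≤ C₀ z := fun j =>
      (PiLp.norm_apply_le g₀ j).trans (hgk0 ▸ hg0 z _ h.mem)
    have b3 : ∀ j, |g j - g₀ j| ≤ C₁ z * ‖θhat x.1 x.2 - θ₀‖ := fun j =>
      (PiLp.norm_apply_le (g - g₀) j).trans (hgk ▸ hgk0 ▸ hg1 z _ (hΘ _ _) _ h.mem)
    have b4 : ∀ j, |g j| ≤ gradNorm m z (θhat x.1 x.2) := fun j =>
      (PiLp.norm_apply_le g j).trans (le_of_eq (by rw [gradNorm, hgk]))
    have e : (x.1 : ℝ)⁻¹ * (φ x i * (g k * g l)) - (x.1 : ℝ)⁻¹ * (φ₀ z * (g₀ k * g₀ l)) =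
        (x.1 : ℝ)⁻¹ * ((φ x i - φ₀ z) * (g k * g l)) +
          (x.1 : ℝ)⁻¹ * (φ₀ z * (g k * (g l - g₀ l) + g₀ l * (g k - g₀ k))) := by ring
    rw [Real.norm_eq_abs, e]
    refine (abs_add_le _ _).trans (add_le_add ?_ ?_)
    · rw [abs_mul, abs_mul, abs_mul, abs_of_nonneg (by positivity : 0 ≤ (x.1 : ℝ)⁻¹), sq]
      have := b4 k
      have := b4 l
      have := norm_nonneg (gradient (m z) (θhat x.1 x.2))
      gcongr
    · rw [abs_mul, abs_mul, abs_of_nonneg (by positivity : 0 ≤ (x.1 : ℝ)⁻¹)]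
      have hle : |g k * (g l - g₀ l) + g₀ l * (g k - g₀ k)| ≤
          C₀ z * (C₁ z * ‖θhat x.1 x.2 - θ₀‖) + C₀ z * (C₁ z * ‖θhat x.1 x.2 - θ₀‖) := by
        refine (abs_add_le _ _).trans (add_le_add ?_ ?_)
        · rw [abs_mul]; exact mul_le_mul (b1 k) (b3 l) (abs_nonneg _) (hC₀0 z)
        · rw [abs_mul]; exact mul_le_mul (b2 l) (b3 k) (abs_nonneg _) (hC₀0 z)
      calc _ ≤ (x.1 : ℝ)⁻¹ * (1 / α * (C₀ z * (C₁ z * ‖θhat x.1 x.2 - θ₀‖) +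
            C₀ z * (C₁ z * ‖θhat x.1 x.2 - θ₀‖))) := by
            have := hφ₀b z
            gcongr
        _ = _ := by ring
  have h7 := h6.add h5
  rw [zero_add] at h7
  refine h7.congr' ?_
  filter_upwards [tendsto_fst_whp.eventually (eventually_gt_atTop 0),
    tendsto_fst_whp.eventually (hs.eventually_gt_atTop 0)] with x hx1 hx2
  rw [sub_add_cancel]
  refine (scoreVar_apply m hx2 hx1 (a := a x.1 x.2) (fun i => ?_)
    (fun i => hα0.trans_le (hαa _ _ _)) _ _ k l).symm
  have : (x.1 : ℝ) ≠ 0 := by positivity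
  simp only [mixProb, ha_def]
  field_simp

end variance

/-! ### Continuity and measurability of matrix square roots and inverses -/

section matrix

variable {d : ℕ}

lemma isClosed_posSemidef : IsClosed {M : Matrix (Fin d) (Fin d) ℝ | M.PosSemidef} := by
  have : {M : Matrix (Fin d) (Fin d) ℝ | M.PosSemidef} =
      {M | Mᴴ = M} ∩ ⋂ x : Fin d → ℝ, {M | 0 ≤ star x ⬝ᵥ (M *ᵥ x)} := by
    ext M
    simp only [Set.mem_inter_iff, Set.mem_ofPred_eq, Set.mem_iInter,
      Matrix.posSemidef_iff_dotProduct_mulVec]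
    rfl
  rw [this]
  refine (isClosed_eq (by fun_prop) continuous_id).inter (isClosed_iInter fun x => ?_)
  exact isClosed_le continuous_const (by fun_prop)

/-- The square root of positive semidefinite matrices is continuous: roots are bounded by the
diagonal entries, and all their cluster points are positive semidefinite roots of the limit. -/
lemma tendsto_matrix_sqrt {ι : Type*} {l : Filter ι} {V : ι → Matrix (Fin d) (Fin d) ℝ}
    {V₀ : Matrix (Fin d) (Fin d) ℝ} (hV : Tendsto V l (𝓝 V₀))
    (hpsd : ∀ᶠ x in l, (V x).PosSemidef) :
    Tendsto (fun x => CFC.sqrt (V x)) l (𝓝 (CFC.sqrt V₀)) := by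
  set R : Fin d → ℝ := fun i => |V₀ i i| + 1 with hR
  have hK : IsCompact (X := Matrix (Fin d) (Fin d) ℝ) (Set.univ.pi fun i =>
      Set.univ.pi fun _ : Fin d => Set.Icc (-R i) (R i)) :=
    isCompact_univ_pi fun i => isCompact_univ_pi fun j => isCompact_Icc
  have hdiag : ∀ᶠ x in l, ∀ i, V x i i < R i := by
    refine eventually_all.2 fun i => ?_
    have hi : Tendsto (fun x => V x i i) l (𝓝 (V₀ i i)) :=
      (tendsto_pi_nhds.1 ((tendsto_pi_nhds.1 hV) i)) i
    exact hi.eventually (gt_mem_nhds (by linarith [le_abs_self (V₀ i i)]))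
  have hsq : ∀ᶠ x in l, CFC.sqrt (V x) * CFC.sqrt (V x) = V x := by
    filter_upwards [hpsd] with x hx
    exact CFC.sqrt_mul_sqrt_self _ (Matrix.nonneg_iff_posSemidef.2 hx)
  refine hK.tendsto_nhds_of_unique_mapClusterPt ?_ fun S _ hS => ?_
  · filter_upwards [hsq, hdiag] with x hx hd i _ j _
    have hsymm : (CFC.sqrt (V x))ᴴ = CFC.sqrt (V x) :=
      (Matrix.nonneg_iff_posSemidef.1 (CFC.sqrt_nonneg (V x))).isHermitian
    generalize hT : CFC.sqrt (V x) = T at hx hsymm ⊢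
    have h1 : V x i i = ∑ k, T i k ^ 2 := by
      rw [← hx, Matrix.mul_apply]
      refine Finset.sum_congr rfl fun k _ => ?_
      have : T k i = T i k := by
        conv_lhs => rw [← hsymm]
        simp [Matrix.conjTranspose_apply]
      rw [this, sq]
    have h2 : T i j ^ 2 ≤ R i := (Finset.single_le_sum (f := fun k => T i k ^ 2)
      (fun _ _ => sq_nonneg _) (Finset.mem_univ j)).trans (h1 ▸ (hd i).le)
    have h3 : 1 ≤ R i := by simp only [hR]; linarith [abs_nonneg (V₀ i i)]
    exact abs_le.1 (abs_le_of_sq_le_sq (by nlinarith) (by linarith))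
  · have hS0 : S.PosSemidef := by
      have h1 : ClusterPt S (𝓟 {M : Matrix (Fin d) (Fin d) ℝ | M.PosSemidef}) :=
        ClusterPt.mono hS (le_principal_iff.2 (mem_map.2 (Eventually.of_forall fun x =>
          Matrix.nonneg_iff_posSemidef.1 (CFC.sqrt_nonneg (V x)))))
      exact isClosed_iff_clusterPt.1 isClosed_posSemidef S h1
    have hSS : S * S = V₀ := by
      have h1 : MapClusterPt (S * S) l fun x => CFC.sqrt (V x) * CFC.sqrt (V x) :=
        hS.continuousAt_comp (f := fun M : Matrix (Fin d) (Fin d) ℝ => M * M)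
          (by fun_prop : Continuous fun M : Matrix (Fin d) (Fin d) ℝ => M * M).continuousAt
      have h2 : ClusterPt (S * S) (𝓝 V₀) := by
        refine ClusterPt.mono h1 ?_
        have := hV.congr' (hsq.mono fun x hx => hx.symm)
        exact this
      exact @eq_of_nhds_neBot _ _ _ _ _ h2
    exact (CFC.sqrt_unique hSS (Matrix.nonneg_iff_posSemidef.2 hS0)).symm

variable {Ω : Type*} [MeasurableSpace Ω]

lemma measurable_of_continuous_entries {E : Type*} [TopologicalSpace E] [MeasurableSpace E]
    [BorelSpace E] {F : Matrix (Fin d) (Fin d) ℝ → E} (hF : Continuous F)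
    {V : Ω → Matrix (Fin d) (Fin d) ℝ} (hV : ∀ i j, Measurable fun ω => V ω i j) :
    Measurable fun ω => F (V ω) := by
  have h1 : Measurable fun ω i j => V ω i j :=
    measurable_pi_iff.2 fun i => measurable_pi_iff.2 fun j => hV i j
  have h2 : Measurable fun M : Fin d → Fin d → ℝ => F (Matrix.of M) := by
    have h3 : Continuous fun M : Fin d → Fin d → ℝ => Matrix.of M := continuous_id
    exact (hF.comp h3).measurable
  exact h2.comp h1

lemma measurable_inv_apply {V : Ω → Matrix (Fin d) (Fin d) ℝ}
    (hV : ∀ i j, Measurable fun ω => V ω i j) (i j : Fin d) :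
    Measurable fun ω => (V ω)⁻¹ i j := by
  simp only [Matrix.inv_def, Ring.inverse_eq_inv', Matrix.smul_apply, smul_eq_mul]
  refine Measurable.mul (Measurable.inv ?_) ?_
  · exact measurable_of_continuous_entries
      (F := fun M : Matrix (Fin d) (Fin d) ℝ => M.det) (by fun_prop) hV
  · exact measurable_of_continuous_entries
      (F := fun M : Matrix (Fin d) (Fin d) ℝ => M.adjugate i j)
      ((Continuous.matrix_adjugate continuous_id).matrix_elem i j) hV

lemma measurable_mul_apply {V V' : Ω → Matrix (Fin d) (Fin d) ℝ}
    (hV : ∀ i j, Measurable fun ω => V ω i j) (hV' : ∀ i j, Measurable fun ω => V' ω i j)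
    (i j : Fin d) : Measurable fun ω => (V ω * V' ω) i j := by
  simp only [Matrix.mul_apply]
  exact Finset.measurable_fun_sum _ fun k _ => (hV i k).mul (hV' k j)

lemma measurable_sqrt_apply {V : Ω → Matrix (Fin d) (Fin d) ℝ}
    (hV : ∀ i j, Measurable fun ω => V ω i j) (hpsd : ∀ ω, (V ω).PosSemidef) (i j : Fin d) :
    Measurable fun ω => CFC.sqrt (V ω) i j := by
  have h1 : Measurable fun ω i j => V ω i j :=
    measurable_pi_iff.2 fun i => measurable_pi_iff.2 fun j => hV i j
  have h2 : Continuous fun M : {M : Fin d → Fin d → ℝ // (Matrix.of M).PosSemidef} =>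
      CFC.sqrt (Matrix.of M.1) i j := by
    refine continuous_iff_continuousAt.2 fun M => ?_
    have h3 : Tendsto (fun N : {M : Fin d → Fin d → ℝ // (Matrix.of M).PosSemidef} =>
        Matrix.of N.1) (𝓝 M) (𝓝 (Matrix.of M.1)) := continuous_subtype_val.tendsto M
    exact (tendsto_pi_nhds.1 ((tendsto_pi_nhds.1 (tendsto_matrix_sqrt h3
      (Eventually.of_forall fun N => N.2))) i)) j
  exact h2.measurable.comp (h1.subtype_mk (h := hpsd))

end matrix

/-! ### Measurability of order statistics and thresholds -/

section measurability

variable {Ω : Type*} [MeasurableSpace Ω]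

lemma measurable_card_filter {ι : Type*} [Fintype ι] {p : Ω → ι → Prop}
    [∀ ω, DecidablePred (p ω)] (hp : ∀ i, MeasurableSet {ω | p ω i}) :
    Measurable fun ω => (Finset.univ.filter (p ω)).card := by
  classical
  simp only [Finset.card_filter]
  refine Finset.measurable_fun_sum _ fun i _ => ?_
  have : (fun ω => if p ω i then 1 else 0) = {ω | p ω i}.indicator fun _ => (1 : ℕ) := by
    funext ω; simp [Set.indicator]
  rw [this]
  exact measurable_const.indicator (hp i)

lemma measurable_card {ι : Type*} [Fintype ι] {S : Ω → Finset ι}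
    (hS : ∀ i, MeasurableSet {ω | i ∈ S ω}) : Measurable fun ω => (S ω).card := by
  classical
  have : (fun ω => (S ω).card) = fun ω => (Finset.univ.filter (fun i => i ∈ S ω)).card := by
    funext ω; congr 1; ext i; simp
  rw [this]
  exact measurable_card_filter hS

lemma measurable_orderStat {ι : Type*} [Fintype ι] {S : Ω → Finset ι} {t : Ω → ι → ℝ} {k : Ω → ℕ}
    (hS : ∀ i, MeasurableSet {ω | i ∈ S ω}) (ht : ∀ i, Measurable fun ω => t ω i)
    (hk : Measurable k) : Measurable fun ω => orderStat (S ω) (t ω) (k ω) := by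
  classical
  refine measurable_of_Iic fun x => ?_
  have hc : Measurable fun ω => ((S ω).filter fun i => t ω i ≤ x).card :=
    measurable_card fun i => by
      have : {ω | i ∈ (S ω).filter fun i => t ω i ≤ x} = {ω | i ∈ S ω} ∩ {ω | t ω i ≤ x} := by
        ext ω; simp
      rw [this]
      exact (hS i).inter (measurableSet_le (ht i) measurable_const)
  have hA : MeasurableSet {ω | 1 ≤ k ω ∧ k ω ≤ (S ω).card} :=
    (measurableSet_le measurable_const hk).inter (measurableSet_le hk (measurable_card hS))
  have e : (fun ω => orderStat (S ω) (t ω) (k ω)) ⁻¹' Set.Iic x =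
      ({ω | 1 ≤ k ω ∧ k ω ≤ (S ω).card} ∩ {ω | k ω ≤ ((S ω).filter fun i => t ω i ≤ x).card}) ∪
        ({ω | 1 ≤ k ω ∧ k ω ≤ (S ω).card}ᶜ ∩ {_ω | 0 ≤ x}) := by
    ext ω
    simp only [Set.mem_preimage, Set.mem_Iic, Set.mem_union, Set.mem_inter_iff, Set.mem_ofPred_eq,
      Set.mem_compl_iff]
    by_cases h : 1 ≤ k ω ∧ k ω ≤ (S ω).card
    · simp only [h, and_self, true_and, not_true_eq_false, false_and, or_false]
      refine ⟨fun hx => ?_, fun hx => orderStat_le h.1 h.2 hx⟩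
      refine (le_card_filter_orderStat (t := t ω) h.1 h.2).trans (Finset.card_le_card ?_)
      intro i hi
      simp only [Finset.mem_filter] at hi ⊢
      exact ⟨hi.1, hi.2.trans hx⟩
    · simp only [h, false_and, not_false_eq_true, true_and, false_or, orderStat_of_not h]
  rw [e]
  exact (hA.inter (measurableSet_le hk hc)).union (hA.compl.inter (MeasurableSet.const _))

lemma measurable_upperSampleQuantile {ι : Type*} [Fintype ι] {S : Ω → Finset ι} {t : Ω → ι → ℝ}
    (hS : ∀ i, MeasurableSet {ω | i ∈ S ω}) (ht : ∀ i, Measurable fun ω => t ω i) (ρ : ℝ) :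
    Measurable fun ω => upperSampleQuantile (S ω) (t ω) ρ := by
  refine measurable_orderStat hS ht (Nat.measurable_ceil.comp (Measurable.mul_const ?_ _))
  exact measurable_from_top.comp (measurable_card hS)

lemma measurable_sInf_nat {p : ℕ → Ω → Prop} (hp : ∀ g, MeasurableSet {ω | p g ω}) :
    Measurable fun ω => sInf {g | p g ω} := by
  refine measurable_of_Iic fun k => ?_
  have e : (fun ω => sInf {g | p g ω}) ⁻¹' Set.Iic k =
      (⋃ g ∈ Finset.range (k + 1), {ω | p g ω}) ∪ ⋂ g, {ω | p g ω}ᶜ := by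
    ext ω
    simp only [Set.mem_preimage, Set.mem_Iic, Set.mem_union, Set.mem_iUnion, Set.mem_iInter,
      Set.mem_compl_iff, Set.mem_ofPred_eq, Finset.mem_range, exists_prop, Nat.lt_succ_iff]
    constructor
    · intro h
      by_cases hne : ∃ g, p g ω
      · exact Or.inl ⟨_, h, Nat.sInf_mem (s := {g | p g ω}) hne⟩
      · exact Or.inr (not_exists.1 hne)
    · rintro (⟨g, hg, hpg⟩ | h)
      · exact (Nat.sInf_le (s := {g | p g ω}) hpg).trans hg
      · have : {g | p g ω} = ∅ := by ext g; simp [h g]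
        simp [this]
  rw [e]
  exact (Finset.measurableSet_biUnion _ fun g _ => hp g).union
    (MeasurableSet.iInter fun g => (hp g).compl)

lemma measurable_cutoff {n : ℕ} {t : Ω → Fin n → ℝ} (s : ℕ)
    (h : ∀ k, Measurable fun ω => orderStat Finset.univ (t ω) k /
      ∑ i ∈ Finset.Icc 1 k, orderStat Finset.univ (t ω) i) :
    Measurable fun ω => cutoff s (t ω) := by
  refine measurable_sInf_nat fun g => ?_
  have h1 : MeasurableSet {ω | orderStat Finset.univ (t ω) (n - g) /
      ∑ i ∈ Finset.Icc 1 (n - g), orderStat Finset.univ (t ω) i < 1 / ((s : ℝ) - g)} :=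
    measurableSet_lt (h _) measurable_const
  have h2 : MeasurableSet {ω | 1 / ((s : ℝ) - g + 1) ≤ orderStat Finset.univ (t ω) (n - g + 1) /
      ∑ i ∈ Finset.Icc 1 (n - g + 1), orderStat Finset.univ (t ω) i} :=
    measurableSet_le measurable_const (h _)
  exact (MeasurableSet.const (g < s)).inter (h1.inter ((MeasurableSet.const (g = 0)).union h2))

lemma measurable_optThreshold {n : ℕ} {t : Ω → Fin n → ℝ} (ht : ∀ i, Measurable fun ω => t ω i)
    (s : ℕ) : Measurable fun ω => optThreshold s (t ω) := by
  have ho : ∀ k : ℕ, Measurable fun ω => orderStat Finset.univ (t ω) k := fun k =>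
    measurable_orderStat (fun i => by simp) ht measurable_const
  have hs : ∀ k : ℕ, Measurable fun ω => ∑ i ∈ Finset.Icc 1 k, orderStat Finset.univ (t ω) i :=
    fun k => Finset.measurable_fun_sum _ fun i _ => ho i
  have hc : Measurable fun ω => cutoff s (t ω) := measurable_cutoff s fun k => (ho k).div (hs k)
  have hF : Measurable fun y : Ω × ℕ => (∑ i ∈ Finset.Icc 1 (n - y.2),
      orderStat Finset.univ (t y.1) i) / ((s : ℝ) - y.2) := by
    refine measurable_from_prod_countable_left fun g => ?_
    exact (hs (n - g)).div_const ((s : ℝ) - g)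
  have e : (fun ω => optThreshold s (t ω)) = (fun y : Ω × ℕ => (∑ i ∈ Finset.Icc 1 (n - y.2),
      orderStat Finset.univ (t y.1) i) / ((s : ℝ) - y.2)) ∘ fun ω => (ω, cutoff s (t ω)) := rfl
  rw [e]
  exact hF.comp (measurable_id.prodMk hc)

end measurability

/-! ### Conditional probabilities given a `σ`-algebra that is independent of the randomization -/

section conditional

variable {Ω : Type*}

lemma condExp_indicator_of_indepFun {β E : Type*} {mΩ : MeasurableSpace Ω} {P : Measure Ω}
    [IsProbabilityMeasure P] {mβ : MeasurableSpace β} [MeasurableSpace E] [StandardBorelSpace E]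
    [Nonempty E] {X : Ω → β} {V : Ω → E} (hX : Measurable X) (hV : Measurable V)
    (hind : IndepFun X V P) {B : Set (β × E)} (hB : MeasurableSet B) :
    P⟦{ω | (X ω, V ω) ∈ B} | MeasurableSpace.comap X mβ⟧ =ᵐ[P]
      fun ω => (P.map V).real {u | (X ω, u) ∈ B} := by
  have hp : IsProbabilityMeasure (P.map V) := Measure.isProbabilityMeasure_map hV.aemeasurable
  have h1 := condExp_prod_ae_eq_integral_condDistrib (μ := P) (f := B.indicator fun _ => (1 : ℝ))
    hX hV.aemeasurable (stronglyMeasurable_const.indicator hB)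
    ((integrable_const (1 : ℝ)).indicator ((hX.prodMk hV) hB))
  have h2 : condDistrib V X P =ᵐ[P.map X] Kernel.const β (P.map V) := by
    refine condDistrib_ae_eq_of_measure_eq_compProd_of_measurable hX hV ?_
    rw [Measure.compProd_const]
    exact (indepFun_iff_map_prod_eq_prod_map_map hX.aemeasurable hV.aemeasurable).1 hind
  have e : (fun ω => B.indicator (fun _ => (1 : ℝ)) (X ω, V ω)) =
      {ω | (X ω, V ω) ∈ B}.indicator fun _ => 1 := by
    funext ω; simp [Set.indicator]
  rw [e] at h1
  refine h1.trans ?_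
  filter_upwards [ae_of_ae_map hX.aemeasurable h2] with ω hω
  rw [hω, Kernel.const_apply]
  have hm : MeasurableSet {u | (X ω, u) ∈ B} := measurable_prodMk_left hB
  rw [← integral_indicator_one hm]
  rfl

/-- The conditional probability of an event that depends on the randomization `V` and otherwise
only on the `σ`-algebra `𝓖` is found by integrating out `V`. -/
lemma condExp_indicator_of_indep {E : Type*} {𝓖 mΩ : MeasurableSpace Ω} {P : Measure Ω}
    [IsProbabilityMeasure P] [MeasurableSpace E] [StandardBorelSpace E] [Nonempty E]
    (h𝓖 : 𝓖 ≤ mΩ) {V : Ω → E} (hV : Measurable V)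
    (hind : Indep 𝓖 (MeasurableSpace.comap V inferInstance) P) {B : Set (Ω × E)}
    (hB : @MeasurableSet _ (@Prod.instMeasurableSpace Ω E 𝓖 _) B) :
    P⟦{ω | (ω, V ω) ∈ B} | 𝓖⟧ =ᵐ[P] fun ω => (P.map V).real {u | (ω, u) ∈ B} := by
  have hi : @IndepFun Ω Ω E mΩ 𝓖 _ id V P := by
    refine (@IndepFun_iff_Indep Ω Ω _ mΩ 𝓖 _ id V P).2 ?_
    rw [MeasurableSpace.comap_id]
    exact hind
  have h := @condExp_indicator_of_indepFun Ω Ω E mΩ P _ 𝓖 _ _ _ id V (measurable_id'' h𝓖) hV hi B hB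
  rw [MeasurableSpace.comap_id] at h
  exact h

end conditional

/-! ### Conditional convergence in distribution of randomized sums with a remainder -/

lemma BddInProb.tendsto_zero_of_isLittleO {Ω : Type*} [MeasurableSpace Ω] {P : Measure Ω}
    {X Y : ℕ × Ω → ℝ} (hX : BddInProb P X) (hY : Y =o[whp P] X) : Tendsto Y (whp P) (𝓝 0) := by
  refine (hX.mul_tendsto_zero hY.tendsto_div_nhds_zero).congr' ?_
  filter_upwards [hY.def one_pos] with x hx
  by_cases h0 : X x = 0
  · simp only [h0, norm_zero, mul_zero, norm_le_zero_iff] at hx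
    simp [h0, hx]
  · field_simp

section conditionalCLT

variable {d : ℕ} {Ω : Type*} {mΩ : MeasurableSpace Ω} {P : Measure Ω} [IsProbabilityMeasure P]
  {𝓖 : ℕ → MeasurableSpace Ω} {V : (n : ℕ) → Ω → Fin n → ℝ}
  {v : (n : ℕ) → Ω → Fin n → Param d} {r : (n : ℕ) → Ω → Fin n → ℝ}

lemma htVec_apply {n : ℕ} (v : Fin n → Param d) (r u : Fin n → ℝ) (j : Fin d) :
    htVec v r u j = ∑ i, v i j * htNoise (r i) (u i) := by
  simp [htVec, mul_comm]

lemma measurable_htVec_apply {β : Type*} {mβ : MeasurableSpace β} {n : ℕ} {v : β → Fin n → Param d}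
    {r u : β → Fin n → ℝ} (hv : ∀ i j, Measurable fun ω => v ω i j)
    (hr : ∀ i, Measurable fun ω => r ω i) (hu : ∀ i, Measurable fun ω => u ω i) (j : Fin d) :
    Measurable fun ω => htVec (v ω) (r ω) (u ω) j := by
  simp only [htVec_apply]
  exact Finset.measurable_fun_sum _ fun i _ => (hv i j).mul ((hr i).htNoise (hu i))

lemma measurableSet_forall_le {β : Type*} {mβ : MeasurableSpace β} {f : β → Fin d → ℝ}
    (hf : ∀ j, Measurable fun ω => f ω j) (x : Fin d → ℝ) :
    MeasurableSet {ω | ∀ j, f ω j ≤ x j} := by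
  simp only [Set.ofPred_forall]
  exact MeasurableSet.iInter fun j => measurableSet_le (hf j) measurable_const

lemma condProb_htVec (h𝓖 : ∀ n, 𝓖 n ≤ mΩ) (hV : ∀ n, Measurable (V n))
    (hind : ∀ n, Indep (𝓖 n) (MeasurableSpace.comap (V n) inferInstance) P)
    (hlaw : ∀ n, P.map (V n) = Measure.pi fun _ => unif)
    (hv : ∀ n i j, Measurable[𝓖 n] fun ω => v n ω i j)
    (hr : ∀ n i, Measurable[𝓖 n] fun ω => r n ω i) (n : ℕ) (x : Fin d → ℝ) :
    P⟦{ω | ∀ j, htVec (v n ω) (r n ω) (V n ω) j ≤ x j} | 𝓖 n⟧ =ᵐ[P]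
      fun ω => (Measure.pi fun _ : Fin n => unif).real
        {u | ∀ j, htVec (v n ω) (r n ω) u j ≤ x j} := by
  have hB : @MeasurableSet _ (@Prod.instMeasurableSpace Ω (Fin n → ℝ) (𝓖 n) _)
      {p : Ω × (Fin n → ℝ) | ∀ j, htVec (v n p.1) (r n p.1) p.2 j ≤ x j} := by
    let : MeasurableSpace Ω := 𝓖 n
    exact measurableSet_forall_le (measurable_htVec_apply
      (fun i j => (hv n i j).comp measurable_fst) (fun i => (hr n i).comp measurable_fst)
      (fun i => (measurable_pi_apply i).comp measurable_snd)) x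
  have h := condExp_indicator_of_indep (h𝓖 n) (hV n) (hind n) hB
  rw [hlaw n] at h
  exact h

/-- If randomized sums satisfy, with high probability given `𝓖 n`, the variance and the Lyapunov
condition, then everything that differs from them by `o(1)` in probability is asymptotically
standard normal in conditional distribution. -/
theorem condConvStdGaussian_of_htVec (h𝓖 : ∀ n, 𝓖 n ≤ mΩ) (hV : ∀ n, Measurable (V n))
    (hind : ∀ n, Indep (𝓖 n) (MeasurableSpace.comap (V n) inferInstance) P)
    (hlaw : ∀ n, P.map (V n) = Measure.pi fun _ => unif)
    (hv : ∀ n i j, Measurable[𝓖 n] fun ω => v n ω i j)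
    (hr : ∀ n i, Measurable[𝓖 n] fun ω => r n ω i)
    (hr0 : ∀ᶠ n in atTop, ∀ ω i, 0 < r n ω i)
    (hvar : ∀ δ : ℝ, 0 < δ → ∀ᶠ x in whp P, ∀ τ : Param d,
      |∑ i, inner ℝ (v x.1 x.2 i) τ ^ 2 * ((1 - min (r x.1 x.2 i) 1) / min (r x.1 x.2 i) 1) -
        ‖τ‖ ^ 2| ≤ δ * ‖τ‖ ^ 2)
    (hfour : Tendsto (fun x : ℕ × Ω => ∑ i, ‖v x.1 x.2 i‖ ^ 4 / min (r x.1 x.2 i) 1 ^ 3)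
      (whp P) (𝓝 0))
    {Δ : ℕ → Ω → Fin d → ℝ} (hΔm : ∀ n j, Measurable fun ω => Δ n ω j)
    (hΔ : ∀ j, Tendsto (fun x : ℕ × Ω => Δ x.1 x.2 j -
      htVec (v x.1 x.2) (r x.1 x.2) (V x.1 x.2) j) (whp P) (𝓝 0)) :
    CondConvStdGaussian P 𝓖 Δ := by
  set Φ : (Fin d → ℝ) → ℝ := fun x => (stdGaussian (Param d)).real {y | ∀ j, y j ≤ x j} with hΦ
  have happrox : ∀ (y : Fin d → ℝ) (ε : ℝ), 0 < ε → ∀ᶠ x in whp P,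
      |(P⟦{ω | ∀ j, htVec (v x.1 ω) (r x.1 ω) (V x.1 ω) j ≤ y j} | 𝓖 x.1⟧) x.2 - Φ y| < ε := by
    intro y ε hε
    obtain ⟨δ, hδ, happ⟩ := exists_htVec_orthant_approx y hε
    have h1 := eventually_whp_of_ae (P := P) (p := fun x : ℕ × Ω =>
      (P⟦{ω | ∀ j, htVec (v x.1 ω) (r x.1 ω) (V x.1 ω) j ≤ y j} | 𝓖 x.1⟧) x.2 =
        (Measure.pi fun _ : Fin x.1 => unif).real
          {u | ∀ j, htVec (v x.1 x.2) (r x.1 x.2) u j ≤ y j})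
      (Eventually.of_forall fun n => condProb_htVec h𝓖 hV hind hlaw hv hr n y)
    filter_upwards [h1, tendsto_fst_whp.eventually hr0, hvar δ hδ,
      hfour.eventually (gt_mem_nhds hδ)] with x hx hx0 hx1 hx2
    rw [hx]
    exact happ x.1 (v x.1 x.2) (r x.1 x.2) (hx0 x.2) hx1 hx2.le
  intro x
  have key : ∀ ε : ℝ, 0 < ε → ∀ᶠ p in whp P,
      |(P⟦{ω | ∀ j, Δ p.1 ω j ≤ x j} | 𝓖 p.1⟧) p.2 - Φ x| < ε := by
    intro ε hε
    obtain ⟨η, hη, hΦη⟩ : ∃ η > 0, |Φ (fun j => x j + η) - Φ x| < ε / 4 ∧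
        |Φ (fun j => x j + -η) - Φ x| < ε / 4 := by
      obtain ⟨η, hη, h⟩ := Metric.eventually_nhds_iff.1
        ((tendsto_stdGaussian_orthant x).eventually (Metric.ball_mem_nhds _
          (show 0 < ε / 4 by linarith)))
      refine ⟨η / 2, by linarith, h ?_, h ?_⟩ <;>
        simp only [dist_zero_right, Real.norm_eq_abs, abs_neg] <;>
        rw [abs_of_pos (by linarith)] <;> linarith
    set A : ℕ → Set Ω := fun n => {ω | ∀ j, Δ n ω j ≤ x j}
    set L : (Fin d → ℝ) → ℕ → Set Ω := fun y n =>
      {ω | ∀ j, htVec (v n ω) (r n ω) (V n ω) j ≤ y j} with hL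
    set R : ℕ → Set Ω := fun n => {ω | ¬ ∀ j, |Δ n ω j - htVec (v n ω) (r n ω) (V n ω) j| < η}
    have hhm : ∀ n j, Measurable fun ω => htVec (v n ω) (r n ω) (V n ω) j := fun n =>
      measurable_htVec_apply (fun i j => (hv n i j).mono (h𝓖 n) le_rfl)
        (fun i => (hr n i).mono (h𝓖 n) le_rfl) (fun i => (measurable_pi_apply i).comp (hV n))
    have hAm : ∀ n, MeasurableSet (A n) := fun n => measurableSet_forall_le (hΔm n) x
    have hLm : ∀ y n, MeasurableSet (L y n) := fun y n =>
      measurableSet_forall_le (f := fun ω => htVec (v n ω) (r n ω) (V n ω)) (hhm n) y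
    have hRm : ∀ n, MeasurableSet (R n) := fun n => by
      have : MeasurableSet {ω | ∀ j, |Δ n ω j - htVec (v n ω) (r n ω) (V n ω) j| < η} := by
        simp only [Set.ofPred_forall]
        exact MeasurableSet.iInter fun j =>
          measurableSet_lt ((hΔm n j).sub (hhm n j)).abs measurable_const
      exact this.compl
    have hint : ∀ {B : Set Ω}, MeasurableSet B → Integrable (B.indicator fun _ => (1 : ℝ)) P :=
      fun hB => (integrable_const _).indicator hB
    -- events that contain each other up to the event of a large remainder
    have hmono : ∀ (n : ℕ) (B C : Set Ω), MeasurableSet B → MeasurableSet C → B ⊆ C ∪ R n →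
        ∀ᵐ ω ∂P, (P⟦B | 𝓖 n⟧) ω ≤ (P⟦C | 𝓖 n⟧) ω + (P⟦R n | 𝓖 n⟧) ω := by
      intro n B C hB hC hBC
      have h1 : B.indicator (fun _ => (1 : ℝ)) ≤ᵐ[P]
          C.indicator (fun _ => (1 : ℝ)) + (R n).indicator fun _ => (1 : ℝ) := by
        refine ae_of_all _ fun ω => ?_
        change B.indicator (fun _ => (1 : ℝ)) ω ≤
          C.indicator (fun _ => (1 : ℝ)) ω + (R n).indicator (fun _ => (1 : ℝ)) ω
        have hnn : ∀ S : Set Ω, 0 ≤ S.indicator (fun _ => (1 : ℝ)) ω := fun S =>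
          Set.indicator_nonneg (fun _ _ => zero_le_one) ω
        by_cases hω : ω ∈ B
        · rw [Set.indicator_of_mem hω]
          rcases hBC hω with h | h
          · rw [Set.indicator_of_mem h]; linarith [hnn (R n)]
          · rw [Set.indicator_of_mem h]; linarith [hnn C]
        · rw [Set.indicator_of_notMem hω]; linarith [hnn C, hnn (R n)]
      have h2 := condExp_mono (m := 𝓖 n) (hint hB) ((hint hC).add (hint (hRm n))) h1
      filter_upwards [h2, condExp_add (hint hC) (hint (hRm n)) (𝓖 n)] with ω h3 h4
      rw [h4] at h3
      exact h3
    have hR0 : Tendsto (fun n => P (R n)) atTop (𝓝 0) :=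
      eventually_whp.1 (eventually_all.2 fun j => by
        have h := (hΔ j).abs
        rw [abs_zero] at h
        exact h.eventually (gt_mem_nhds hη))
    have hRc : ∀ᶠ p in whp P, (P⟦R p.1 | 𝓖 p.1⟧) p.2 < ε / 4 := by
      refine eventually_whp.2 ?_
      have hlim : Tendsto (fun n => ENNReal.ofReal (P.real (R n) / (ε / 4))) atTop (𝓝 0) := by
        have h1 : Tendsto (fun n => P.real (R n)) atTop (𝓝 0) := by
          simpa [Measure.real, Function.comp_def] using
            (ENNReal.tendsto_toReal ENNReal.zero_ne_top).comp hR0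
        have h2 := ENNReal.tendsto_ofReal (h1.div_const (ε / 4))
        simpa using h2
      refine tendsto_of_tendsto_of_tendsto_of_le_of_le tendsto_const_nhds hlim (fun _ => zero_le)
        fun n => ?_
      have h0 : 0 ≤ᵐ[P] P⟦R n | 𝓖 n⟧ := condExp_nonneg (ae_of_all _ fun ω =>
        Set.indicator_nonneg (fun _ _ => zero_le_one) ω)
      have h1 := mul_meas_ge_le_integral_of_nonneg h0 integrable_condExp (ε / 4)
      rw [integral_condExp (h𝓖 n), integral_indicator_const _ (hRm n), smul_eq_mul, mul_one] at h1
      simp only [not_lt]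
      rw [ENNReal.le_ofReal_iff_toReal_le (measure_ne_top _ _) (by positivity),
        le_div_iff₀ (by linarith), mul_comm]
      exact h1
    have h1 := eventually_whp_of_ae (P := P) (p := fun p : ℕ × Ω => (P⟦A p.1 | 𝓖 p.1⟧) p.2 ≤
        (P⟦L (fun j => x j + η) p.1 | 𝓖 p.1⟧) p.2 + (P⟦R p.1 | 𝓖 p.1⟧) p.2)
      (Eventually.of_forall fun n => hmono n _ _ (hAm n) (hLm _ n) fun ω hω => by
        by_cases hR : ω ∈ R n
        · exact Or.inr hR
        · refine Or.inl fun j => ?_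
          have := (abs_lt.1 ((not_not.1 hR) j)).1
          linarith [hω j])
    have h2 := eventually_whp_of_ae (P := P) (p := fun p : ℕ × Ω =>
        (P⟦L (fun j => x j + -η) p.1 | 𝓖 p.1⟧) p.2 ≤
        (P⟦A p.1 | 𝓖 p.1⟧) p.2 + (P⟦R p.1 | 𝓖 p.1⟧) p.2)
      (Eventually.of_forall fun n => hmono n _ _ (hLm _ n) (hAm n) fun ω hω => by
        by_cases hR : ω ∈ R n
        · exact Or.inr hR
        · refine Or.inl fun j => ?_
          have := (abs_lt.1 ((not_not.1 hR) j)).2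
          have := hω j
          linarith)
    filter_upwards [h1, h2, hRc, happrox (fun j => x j + η) (ε / 4) (by linarith),
      happrox (fun j => x j + -η) (ε / 4) (by linarith)] with p g1 g2 g3 g4 g5
    have := abs_lt.1 hΦη.1
    have := abs_lt.1 hΦη.2
    have := abs_lt.1 g4
    have := abs_lt.1 g5
    exact abs_lt.2 ⟨by linarith, by linarith⟩
  rw [tendstoInMeasure_iff_dist]
  intro ε hε
  have := eventually_whp.1 (key ε hε)
  simpa only [not_lt, Real.dist_eq] using this

end conditionalCLT

/-! ### Linearization of the estimating equations -/

section linearization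

variable {q d : ℕ} {ν : Measure (Obs q)} {m : Obs q → Param d → ℝ} {Θ : Set (Param d)}
  {θ₀ : Param d}

/-- The estimating equation of a weighted objective at an interior maximizer. -/
lemma sum_mul_gradient_eq_zero_of_isMaximizer (h : Regularity ν m Θ θ₀) {N : ℕ} (z : Fin N → Obs q)
    (w : Fin N → ℝ) {θ : Param d} (hθ : IsMaximizer Θ (fun θ => ∑ i, w i * m (z i) θ) θ)
    (hint : θ ∈ interior Θ) (l : Fin d) : ∑ i, w i * gradient (m (z i)) θ l = 0 := by
  have hmax : IsLocalMax (fun θ => ∑ i, w i * m (z i) θ) θ :=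
    hθ.2.isLocalMax (mem_interior_iff_mem_nhds.1 hint)
  have hd : HasFDerivAt (fun θ => ∑ i, w i * m (z i) θ) (∑ i, w i • fderiv ℝ (m (z i)) θ) θ :=
    HasFDerivAt.fun_sum fun i _ => ((h.differentiableAt (z i) hθ.1).hasFDerivAt.const_mul (w i))
  have h0 := hmax.hasFDerivAt_eq_zero hd
  have := congrArg (fun φ : Param d →L[ℝ] ℝ => φ (EuclideanSpace.single l 1)) h0
  simpa [sum_apply, gradient_apply] using this

lemma Regularity.continuousOn_gradNorm (h : Regularity ν m Θ θ₀) (z : Obs q) :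
    ContinuousOn (gradNorm m z) Θ := by
  have : gradNorm m z = fun θ => √(∑ k, ‖gradient (m z) θ k‖ ^ 2) := by
    funext θ; rw [gradNorm, EuclideanSpace.norm_eq]
  rw [this]
  exact (continuousOn_finsetSum _ fun k _ => ((h.continuousOn_gradient z k).norm.pow 2)).sqrt

lemma measurable_gradNorm_eval (h : Regularity ν m Θ θ₀) {β : Type*} {mβ : MeasurableSpace β}
    {n : ℕ} {D : β → Fin n → Obs q} {T : β → Param d} (hD : Measurable D) (hT : Measurable T)
    (hTΘ : ∀ ω, T ω ∈ Θ) (i : Fin n) : Measurable fun ω => gradNorm m (D ω i) (T ω) :=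
  measurable_eval_of_continuousOn h.continuousOn_gradNorm (fun _ hθ => h.measurable_gradNorm hθ)
    ((measurable_pi_apply i).comp hD) hT hTΘ

lemma measurableSet_mem_pilotSet {β : Type*} {mβ : MeasurableSpace β} {n s₀ : ℕ} {u : β → Fin n → ℝ}
    (hu : Measurable u) (i : Fin n) : MeasurableSet {ω | i ∈ pilotSet s₀ (u ω)} := by
  simp only [pilotSet, Finset.mem_filter, Finset.mem_univ, true_and]
  exact measurableSet_le ((measurable_pi_apply i).comp hu) measurable_const

section measurability

variable {β : Type*} {mβ : MeasurableSpace β} {n : ℕ} {D : β → Fin n → Obs q} {u : β → Fin n → ℝ}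
  {T : β → Param d} {η ψ : β → ℝ}

lemma measurable_pilotThreshold (h : Regularity ν m Θ θ₀) (hD : Measurable D) (hu : Measurable u)
    (hT : Measurable T) (hTΘ : ∀ ω, T ω ∈ Θ) (s₀ : ℕ) (ρ : ℝ) :
    Measurable fun ω => pilotThreshold m (D ω) (pilotSet s₀ (u ω)) ρ (T ω) :=
  measurable_upperSampleQuantile (measurableSet_mem_pilotSet hu)
    (measurable_gradNorm_eval h hD hT hTΘ) _

lemma measurable_pilotMean (h : Regularity ν m Θ θ₀) (hD : Measurable D) (hu : Measurable u)
    (hT : Measurable T) (hTΘ : ∀ ω, T ω ∈ Θ) (hη : Measurable η) (s₀ : ℕ) :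
    Measurable fun ω => pilotMean m (D ω) (pilotSet s₀ (u ω)) (η ω) (T ω) := by
  have hS := measurableSet_mem_pilotSet (s₀ := s₀) hu
  simp only [pilotMean, ← sum_meanWeight_mul]
  refine Finset.measurable_fun_sum _ fun i _ => Measurable.mul (Measurable.ite (hS i)
    (Measurable.inv (measurable_from_top.comp (measurable_card hS))) measurable_const) ?_
  exact (measurable_gradNorm_eval h hD hT hTΘ i).min hη

lemma measurable_approxProb (h : Regularity ν m Θ θ₀) (hD : Measurable D) (hT : Measurable T)
    (hTΘ : ∀ ω, T ω ∈ Θ) (hη : Measurable η) (hψ : Measurable ψ) (i : Fin n) :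
    Measurable fun ω => approxProb m (D ω) (T ω) (η ω) (ψ ω) i :=
  ((measurable_gradNorm_eval h hD hT hTΘ i).min hη).div (hψ.const_mul _)

lemma measurable_gradient_eval (h : Regularity ν m Θ θ₀) (hD : Measurable D) (hT : Measurable T)
    (hTΘ : ∀ ω, T ω ∈ Θ) (i : Fin n) (l : Fin d) :
    Measurable fun ω => gradient (m (D ω i)) (T ω) l :=
  measurable_eval_of_continuousOn (F := fun z θ => gradient (m z) θ l)
    (fun z => h.continuousOn_gradient z l) (fun _ hθ => h.measurable_gradient hθ l)
    ((measurable_pi_apply i).comp hD) hT hTΘ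

lemma measurable_mul_gradient (h : Regularity ν m Θ θ₀) (hD : Measurable D) (hT : Measurable T)
    (hTΘ : ∀ ω, T ω ∈ Θ) (c : ℝ) (l : Fin d) :
    Measurable fun ω (i : Fin n) => c * gradient (m (D ω i)) (T ω) l :=
  measurable_pi_iff.2 fun i => (measurable_gradient_eval h hD hT hTΘ i l).const_mul c

lemma measurable_hess_eval (h : Regularity ν m Θ θ₀) (hD : Measurable D) (hT : Measurable T)
    (hTΘ : ∀ ω, T ω ∈ Θ) (i : Fin n) (k l : Fin d) :
    Measurable fun ω => hess m (D ω i) (T ω) k l :=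
  measurable_eval_of_continuousOn (F := fun z θ => hess m z θ k l)
    (fun z => h.continuousOn_hess z k l) (fun _ hθ => h.measurable_hess hθ k l)
    ((measurable_pi_apply i).comp hD) hT hTΘ

end measurability

variable [IsProbabilityMeasure ν] {Ω : Type*} [MeasurableSpace Ω] {P : Measure Ω}
  {Z : ℕ → Ω → Obs q} {W : (n : ℕ) → Ω → Fin n → ℝ}

/-- The expected Hessian matrix at the true parameter. -/
noncomputable def meanHess (ν : Measure (Obs q)) (m : Obs q → Param d → ℝ) (θ₀ : Param d) :
    Matrix (Fin d) (Fin d) ℝ := Matrix.of fun k l => ∫ z, hess m z θ₀ k l ∂ν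

/-- The score of a weighted objective at a consistent estimator `T'` is linear, up to smaller terms,
in the distance to the maximizer `T` of this objective. -/
lemma eventually_score_linear (h : Regularity ν m Θ θ₀) (hW : LLN P ν Z W)
    (hW0 : ∀ n ω i, 0 ≤ W n ω i) {T T' : ℕ → Ω → Param d}
    (hT : ∀ n ω, IsMaximizer Θ (fun θ => ∑ i, W n ω i * m (data Z n ω i) θ) (T n ω))
    (hT'Θ : ∀ n ω, T' n ω ∈ Θ) (hT' : Tendsto (fun x : ℕ × Ω => T' x.1 x.2) (whp P) (𝓝 θ₀))
    {ε : ℝ} (hε : 0 < ε) : ∀ᶠ x in whp P, ∀ l,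
      |∑ i, W x.1 x.2 i * gradient (m (data Z x.1 x.2 i)) (T' x.1 x.2) l +
        ∑ k, (T x.1 x.2 - T' x.1 x.2) k * meanHess ν m θ₀ k l| ≤ ε * ‖T x.1 x.2 - T' x.1 x.2‖ := by
  obtain ⟨ρ, hρ, hH⟩ := eventually_hess_near h hW hW0 (show 0 < ε / (d + 1) by positivity)
  have hTlim := tendsto_argmax h hW hW0 hT
  filter_upwards [hH, hTlim.eventually (Metric.ball_mem_nhds _ hρ),
    hT'.eventually (Metric.ball_mem_nhds _ hρ),
    hTlim.eventually (isOpen_interior.mem_nhds h.interior)] with x hx h1 h2 h3 l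
  have key := weighted_score_expansion h (data Z x.1 x.2) (W x.1 x.2) (meanHess ν m θ₀)
    (s := Θ ∩ Metric.ball θ₀ ρ) (h.convex.inter (convex_ball _ _)) Set.inter_subset_left
    (η := ε / (d + 1))
    (fun θ hθ k l => hx θ hθ.1 (by simpa [dist_eq_norm] using hθ.2) k l)
    ⟨(hT x.1 x.2).1, h1⟩ ⟨hT'Θ x.1 x.2, h2⟩ l
  rw [sum_mul_gradient_eq_zero_of_isMaximizer h _ _ (hT x.1 x.2) h3, zero_sub, ← neg_add', abs_neg]
    at key
  refine key.trans (mul_le_mul_of_nonneg_right ?_ (norm_nonneg _))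
  rw [mul_div_assoc', div_le_iff₀ (by positivity)]
  nlinarith

end linearization

/-! ### The two-step experiment -/

lemma indepFun_of_map_eq_prod {Ω β γ δ : Type*} {mΩ : MeasurableSpace Ω} {mβ : MeasurableSpace β}
    {mγ : MeasurableSpace γ} {mδ : MeasurableSpace δ} {P : Measure Ω} {X : Ω → β} {Y : Ω → γ}
    {W : Ω → δ} {μ : Measure β} {ρ : Measure γ} {σ : Measure δ} [IsProbabilityMeasure P]
    [IsProbabilityMeasure μ] [IsProbabilityMeasure ρ] [IsProbabilityMeasure σ] (hX : Measurable X)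
    (hY : Measurable Y) (hW : Measurable W)
    (h : P.map (fun ω => (X ω, Y ω, W ω)) = μ.prod (ρ.prod σ)) :
    P.map X = μ ∧ P.map Y = ρ ∧ P.map W = σ ∧ IndepFun X Y P ∧
      IndepFun (fun ω => (X ω, Y ω)) W P := by
  have hT : Measurable fun ω => (X ω, Y ω, W ω) := hX.prodMk (hY.prodMk hW)
  have h1 : P.map X = μ := by
    have := congrArg (Measure.map Prod.fst) h
    rwa [Measure.map_map measurable_fst hT, Measure.map_fst_prod, measure_univ, one_smul] at this
  have h2 : P.map (fun ω => (Y ω, W ω)) = ρ.prod σ := by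
    have := congrArg (Measure.map Prod.snd) h
    rwa [Measure.map_map measurable_snd hT, Measure.map_snd_prod, measure_univ, one_smul] at this
  have h3 : P.map Y = ρ := by
    have := congrArg (Measure.map Prod.fst) h2
    rwa [Measure.map_map measurable_fst (hY.prodMk hW), Measure.map_fst_prod, measure_univ,
      one_smul] at this
  have h4 : P.map W = σ := by
    have := congrArg (Measure.map Prod.snd) h2
    rwa [Measure.map_map measurable_snd (hY.prodMk hW), Measure.map_snd_prod, measure_univ,
      one_smul] at this
  have h5 : P.map (fun ω => ((X ω, Y ω), W ω)) = (μ.prod ρ).prod σ := by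
    have := congrArg (Measure.map MeasurableEquiv.prodAssoc.symm) h
    rw [Measure.map_map (MeasurableEquiv.measurable _) hT, ← Measure.prodAssoc_prod,
      MeasurableEquiv.map_symm_map] at this
    exact this
  have h6 : P.map (fun ω => (X ω, Y ω)) = μ.prod ρ := by
    have := congrArg (Measure.map Prod.fst) h5
    rwa [Measure.map_map measurable_fst ((hX.prodMk hY).prodMk hW), Measure.map_fst_prod,
      measure_univ, one_smul] at this
  refine ⟨h1, h3, h4, ?_, ?_⟩
  · rw [indepFun_iff_map_prod_eq_prod_map_map hX.aemeasurable hY.aemeasurable, h1, h3, h6]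
  · rw [indepFun_iff_map_prod_eq_prod_map_map (hX.prodMk hY).aemeasurable hW.aemeasurable, h4, h5,
      h6]

/-- The two-step subsampling experiment: regularity of the objective, asymptotics of the sample
sizes, the joint law of the data and the random numbers, and the estimators of the two steps. -/
structure Experiment {q d : ℕ} {Ω : Type*} [MeasurableSpace Ω] (ν : Measure (Obs q))
    (m : Obs q → Param d → ℝ) (Θ : Set (Param d)) (θ₀ : Param d) (α b ϱ : ℝ) (s₀ s : ℕ → ℕ)
    (P : Measure Ω) (Z : ℕ → Ω → Obs q) (U₀ U : (n : ℕ) → Ω → Fin n → ℝ) (θhat θp : ℕ → Ω → Param d)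
    (H Ψ : ℕ → Ω → ℝ) (θsub : ℕ → Ω → Param d) : Prop where
  reg : Regularity ν m Θ θ₀
  α_mem : α ∈ Set.Ioo (0 : ℝ) 1
  one_le_b : 1 ≤ b
  ϱ_mem : ϱ ∈ Set.Ico (0 : ℝ) 1
  s₀_tendsto : Tendsto s₀ atTop atTop
  s_tendsto : Tendsto s atTop atTop
  s_lt : ∀ᶠ n in atTop, s n < n
  s₀_small : (fun n => (s₀ n : ℝ)) =o[atTop] (fun n => (n : ℝ))
  s_ratio : Tendsto (fun n => (s n : ℝ) / (b * n)) atTop (𝓝 ϱ)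
  measurable_Z : ∀ i, Measurable (Z i)
  measurable_U₀ : ∀ n, Measurable (U₀ n)
  measurable_U : ∀ n, Measurable (U n)
  law : ∀ n, P.map (fun ω => (data Z n ω, U₀ n ω, U n ω)) =
    (Measure.pi fun _ : Fin n => ν).prod
      ((Measure.pi fun _ : Fin n => unif).prod (Measure.pi fun _ : Fin n => unif))
  measurable_θhat : ∀ n, Measurable[MeasurableSpace.comap (data Z n) inferInstance] (θhat n)
  θhat_max : ∀ n ω, IsMaximizer Θ (fullObjective m (data Z n ω)) (θhat n ω)
  fourth : FourthMomentBounded P Z m Θ θhat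
  measurable_θp : ∀ n, Measurable[MeasurableSpace.comap (data Z n) inferInstance ⊔
    MeasurableSpace.comap (U₀ n) inferInstance] (θp n)
  θp_max : ∀ n ω, IsMaximizer Θ
    (pilotObjective m (data Z n ω) (pilotSet (s₀ n) (U₀ n ω))) (θp n ω)
  H_eq : ∀ n ω, H n ω = pilotThreshold m (data Z n ω) (pilotSet (s₀ n) (U₀ n ω))
    ((s n : ℝ) / (b * n)) (θp n ω)
  Ψ_eq : ∀ n ω, Ψ n ω = pilotMean m (data Z n ω) (pilotSet (s₀ n) (U₀ n ω)) (H n ω) (θp n ω)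
  measurable_θsub : ∀ n, Measurable (θsub n)
  θsub_max : ∀ n ω, IsMaximizer Θ
    (subObjective m (data Z n ω) (s n)
      (mixProb α (approxProb m (data Z n ω) (θp n ω) (H n ω) (Ψ n ω))) (U n ω)) (θsub n ω)

/-- The nominal inclusion probabilities `s π_i` of the second step, before they are cut at one. -/
noncomputable def stepProb {q d : ℕ} {Ω : Type*} (m : Obs q → Param d → ℝ) (α : ℝ) (s : ℕ → ℕ)
    (Z : ℕ → Ω → Obs q) (θp : ℕ → Ω → Param d) (H Ψ : ℕ → Ω → ℝ) (n : ℕ) (ω : Ω) (i : Fin n) : ℝ :=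
  s n * mixProb α (approxProb m (data Z n ω) (θp n ω) (H n ω) (Ψ n ω)) i

lemma measurable_stepProb {q d : ℕ} {Ω : Type*} {mΩ : MeasurableSpace Ω} {ν : Measure (Obs q)}
    {m : Obs q → Param d → ℝ} {Θ : Set (Param d)} {θ₀ : Param d} (h : Regularity ν m Θ θ₀)
    {Z : ℕ → Ω → Obs q} {θp : ℕ → Ω → Param d} {H Ψ : ℕ → Ω → ℝ} {n : ℕ}
    (hD : Measurable (data Z n)) (hθ : Measurable (θp n)) (hθΘ : ∀ ω, θp n ω ∈ Θ)
    (hH : Measurable (H n)) (hΨ : Measurable (Ψ n)) (α : ℝ) (s : ℕ → ℕ) :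
    Measurable (stepProb m α s Z θp H Ψ n) :=
  measurable_pi_iff.2 fun i => (((measurable_approxProb h hD hθ hθΘ hH hΨ i).const_mul _).add_const
    _).const_mul _

namespace Experiment

variable {q d : ℕ} {Ω : Type*} {mΩ : MeasurableSpace Ω} {ν : Measure (Obs q)}
  {m : Obs q → Param d → ℝ} {Θ : Set (Param d)} {θ₀ : Param d} {α b ϱ : ℝ} {s₀ s : ℕ → ℕ}
  {P : Measure Ω} {Z : ℕ → Ω → Obs q} {U₀ U : (n : ℕ) → Ω → Fin n → ℝ} {θhat θp : ℕ → Ω → Param d}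
  {H Ψ : ℕ → Ω → ℝ} {θsub : ℕ → Ω → Param d}

section deterministic

variable (h : Experiment ν m Θ θ₀ α b ϱ s₀ s P Z U₀ U θhat θp H Ψ θsub)
include h

lemma H_nonneg (n : ℕ) (ω : Ω) : 0 ≤ H n ω := by
  rw [h.H_eq]; exact upperSampleQuantile_nonneg (fun i => gradNorm_nonneg _ _) _

lemma min_nonneg (n : ℕ) (ω : Ω) (i : Fin n) :
    0 ≤ min (gradNorm m (data Z n ω i) (θp n ω)) (H n ω) :=
  le_min (gradNorm_nonneg _ _) (h.H_nonneg n ω)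

lemma Ψ_nonneg (n : ℕ) (ω : Ω) : 0 ≤ Ψ n ω := by
  rw [h.Ψ_eq]
  exact Finset.sum_nonneg fun i _ => div_nonneg (h.min_nonneg n ω i) (Nat.cast_nonneg _)

lemma div_le_mixProb (n : ℕ) (ω : Ω) (i : Fin n) :
    α / n ≤ mixProb α (approxProb m (data Z n ω) (θp n ω) (H n ω) (Ψ n ω)) i := by
  have h1 := mul_nonneg (sub_nonneg.2 h.α_mem.2.le) (div_nonneg (h.min_nonneg n ω i)
    (mul_nonneg (Nat.cast_nonneg n) (h.Ψ_nonneg n ω)))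
  simp only [mixProb, approxProb]
  linarith

lemma le_stepProb (n : ℕ) (ω : Ω) (i : Fin n) :
    (s n : ℝ) * (α / n) ≤ stepProb m α s Z θp H Ψ n ω i :=
  mul_le_mul_of_nonneg_left (h.div_le_mixProb n ω i) (Nat.cast_nonneg _)

lemma stepProb_nonneg (n : ℕ) (ω : Ω) (i : Fin n) : 0 ≤ stepProb m α s Z θp H Ψ n ω i :=
  le_trans (mul_nonneg (Nat.cast_nonneg _) (div_nonneg h.α_mem.1.le (Nat.cast_nonneg _)))
    (h.le_stepProb n ω i)

lemma weight_nonneg (n : ℕ) (ω : Ω) (i : Fin n) :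
    0 ≤ (n : ℝ)⁻¹ * (1 + htNoise (stepProb m α s Z θp H Ψ n ω i) (U n ω i)) := by
  refine mul_nonneg (by positivity) ?_
  rw [htNoise, add_sub_cancel]
  have := h.stepProb_nonneg n ω i
  split_ifs <;> positivity

lemma θhat_max' (n : ℕ) (ω : Ω) :
    IsMaximizer Θ (fun θ => ∑ i, (n : ℝ)⁻¹ * m (data Z n ω i) θ) (θhat n ω) := by
  have e : (fun θ => ∑ i, (n : ℝ)⁻¹ * m (data Z n ω i) θ) = fullObjective m (data Z n ω) := by
    funext θ; rw [fullObjective, ← Finset.mul_sum, inv_mul_eq_div]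
  rw [e]; exact h.θhat_max n ω

lemma θp_max' (n : ℕ) (ω : Ω) :
    IsMaximizer Θ (fun θ => ∑ i, meanWeight (pilotSet (s₀ n) (U₀ n ω)) i * m (data Z n ω i) θ)
      (θp n ω) := by
  simp only [sum_meanWeight_mul]
  exact h.θp_max n ω

lemma θsub_max' (n : ℕ) (ω : Ω) :
    IsMaximizer Θ (fun θ => ∑ i, (n : ℝ)⁻¹ *
      (1 + htNoise (stepProb m α s Z θp H Ψ n ω i) (U n ω i)) * m (data Z n ω i) θ)
      (θsub n ω) := by
  convert! h.θsub_max n ω using 1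
  funext θ
  rw [subObjective, Finset.mul_sum, Finset.sum_filter]
  refine Finset.sum_congr rfl fun i _ => ?_
  rw [htNoise, add_sub_cancel, stepProb]
  split_ifs <;> ring

lemma θhat_mem (n : ℕ) (ω : Ω) : θhat n ω ∈ Θ := (h.θhat_max n ω).1

lemma θp_mem (n : ℕ) (ω : Ω) : θp n ω ∈ Θ := (h.θp_max n ω).1

lemma tendsto_ratio : Tendsto (fun n => (s n : ℝ) / n) atTop (𝓝 (b * ϱ)) := by
  have hb : b ≠ 0 := by linarith [h.one_le_b]
  refine (h.s_ratio.const_mul b).congr fun n => ?_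
  rw [mul_div_assoc', mul_div_mul_left _ _ hb]

lemma pilot_le (n : ℕ) : MeasurableSpace.comap (data Z n) inferInstance ⊔
    MeasurableSpace.comap (U₀ n) inferInstance ≤ mΩ :=
  sup_le (measurable_data h.measurable_Z n).comap_le (h.measurable_U₀ n).comap_le

lemma eventually_rate : ∀ᶠ n in atTop, 0 < (s n : ℝ) * (α / n) ∧ (s n : ℝ) * (α / n) ≤ 1 := by
  filter_upwards [h.s_lt, h.s_tendsto.eventually_gt_atTop 0] with n h1 h2
  have h3 : (0 : ℝ) < s n := by exact_mod_cast h2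
  have h4 : (s n : ℝ) < n := by exact_mod_cast h1
  have h5 : (0 : ℝ) < n := by linarith
  have := h.α_mem.1
  refine ⟨by positivity, ?_⟩
  rw [mul_div_assoc', div_le_one h5]
  nlinarith [h.α_mem.2]

end deterministic

section probabilistic

variable [IsProbabilityMeasure ν] [IsProbabilityMeasure P]
  (h : Experiment ν m Θ θ₀ α b ϱ s₀ s P Z U₀ U θhat θp H Ψ θsub)
include h

lemma map_data (n : ℕ) : P.map (data Z n) = Measure.pi fun _ => ν :=
  (indepFun_of_map_eq_prod (measurable_data h.measurable_Z n) (h.measurable_U₀ n)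
    (h.measurable_U n) (h.law n)).1

lemma map_U₀ (n : ℕ) : P.map (U₀ n) = Measure.pi fun _ => unif :=
  (indepFun_of_map_eq_prod (measurable_data h.measurable_Z n) (h.measurable_U₀ n)
    (h.measurable_U n) (h.law n)).2.1

lemma map_U (n : ℕ) : P.map (U n) = Measure.pi fun _ => unif :=
  (indepFun_of_map_eq_prod (measurable_data h.measurable_Z n) (h.measurable_U₀ n)
    (h.measurable_U n) (h.law n)).2.2.1

lemma indep_U₀ (n : ℕ) : Indep (MeasurableSpace.comap (data Z n) inferInstance)
    (MeasurableSpace.comap (U₀ n) inferInstance) P :=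
  (IndepFun_iff_Indep _ _ _).1 (indepFun_of_map_eq_prod (measurable_data h.measurable_Z n)
    (h.measurable_U₀ n) (h.measurable_U n) (h.law n)).2.2.2.1

lemma indep_U (n : ℕ) : Indep (MeasurableSpace.comap (data Z n) inferInstance ⊔
    MeasurableSpace.comap (U₀ n) inferInstance) (MeasurableSpace.comap (U n) inferInstance) P := by
  have h1 := (IndepFun_iff_Indep _ _ _).1 (indepFun_of_map_eq_prod
    (measurable_data h.measurable_Z n) (h.measurable_U₀ n) (h.measurable_U n) (h.law n)).2.2.2.2
  rwa [← MeasurableSpace.comap_prodMk]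

end probabilistic

end Experiment

/-! ### Expansion of the subsampling estimator around the full data estimator -/

/-- The score of the subsample objective at the full data estimator, multiplied by `√s`: a sum of
centred inclusion indicators. -/
noncomputable def noiseScore {q d : ℕ} {Ω : Type*} (m : Obs q → Param d → ℝ) (α : ℝ) (s : ℕ → ℕ)
    (Z : ℕ → Ω → Obs q) (U : (n : ℕ) → Ω → Fin n → ℝ) (θhat θp : ℕ → Ω → Param d) (H Ψ : ℕ → Ω → ℝ)
    (n : ℕ) (ω : Ω) (l : Fin d) : ℝ :=
  ∑ i, √(s n) / n * gradient (m (data Z n ω i)) (θhat n ω) l *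
    htNoise (stepProb m α s Z θp H Ψ n ω i) (U n ω i)

lemma meanHess_symm {q d : ℕ} {ν : Measure (Obs q)} {m : Obs q → Param d → ℝ} {Θ : Set (Param d)}
    {θ₀ : Param d} (h : Regularity ν m Θ θ₀) (k l : Fin d) :
    meanHess ν m θ₀ k l = meanHess ν m θ₀ l k :=
  integral_congr_ae (ae_of_all _ fun z => h.hess_symm z h.mem k l)

lemma isUnit_meanHess {q d : ℕ} {ν : Measure (Obs q)} {m : Obs q → Param d → ℝ} {Θ : Set (Param d)}
    {θ₀ : Param d} (h : Regularity ν m Θ θ₀) : IsUnit (meanHess ν m θ₀) := by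
  have := (h.hess_posDef θ₀ h.mem).isUnit.neg
  rwa [neg_neg] at this

lemma norm_le_sum_abs {d : ℕ} (v : Param d) : ‖v‖ ≤ ∑ k, |v k| := by
  conv_lhs => rw [← sum_smul_single v]
  refine (norm_sum_le _ _).trans (Finset.sum_le_sum fun k _ => ?_)
  simp [norm_smul]

lemma measurable_data_pilot {q : ℕ} {Ω : Type*} (Z : ℕ → Ω → Obs q)
    (U₀ : (n : ℕ) → Ω → Fin n → ℝ) (n : ℕ) :
    Measurable[MeasurableSpace.comap (data Z n) inferInstance ⊔
      MeasurableSpace.comap (U₀ n) inferInstance] (data Z n) :=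
  (comap_measurable (data Z n)).mono le_sup_left le_rfl

lemma measurable_U₀_pilot {q : ℕ} {Ω : Type*} (Z : ℕ → Ω → Obs q)
    (U₀ : (n : ℕ) → Ω → Fin n → ℝ) (n : ℕ) :
    Measurable[MeasurableSpace.comap (data Z n) inferInstance ⊔
      MeasurableSpace.comap (U₀ n) inferInstance] (U₀ n) :=
  (comap_measurable (U₀ n)).mono le_sup_right le_rfl

namespace Experiment

variable {q d : ℕ} {Ω : Type*} {mΩ : MeasurableSpace Ω} {ν : Measure (Obs q)}
  {m : Obs q → Param d → ℝ} {Θ : Set (Param d)} {θ₀ : Param d} {α b ϱ : ℝ} {s₀ s : ℕ → ℕ}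
  {P : Measure Ω} {Z : ℕ → Ω → Obs q} {U₀ U : (n : ℕ) → Ω → Fin n → ℝ} {θhat θp : ℕ → Ω → Param d}
  {H Ψ : ℕ → Ω → ℝ} {θsub : ℕ → Ω → Param d} [IsProbabilityMeasure ν] [IsProbabilityMeasure P]
  (h : Experiment ν m Θ θ₀ α b ϱ s₀ s P Z U₀ U θhat θp H Ψ θsub)
include h

lemma lln_full : LLN P ν Z fun n _ _ => (n : ℝ)⁻¹ :=
  PoissonSubsampling.lln_full h.measurable_Z h.map_data

lemma lln_pilot : LLN P ν Z fun n ω => meanWeight (pilotSet (s₀ n) (U₀ n ω)) :=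
  PoissonSubsampling.lln_pilot h.measurable_Z h.map_data h.measurable_U₀ h.indep_U₀ h.map_U₀
    h.s₀_tendsto h.s₀_small

omit [IsProbabilityMeasure ν] [IsProbabilityMeasure P] in
lemma measurable_H (n : ℕ) : Measurable[MeasurableSpace.comap (data Z n) inferInstance ⊔
    MeasurableSpace.comap (U₀ n) inferInstance] (H n) := by
  rw [show H n = _ from funext (h.H_eq n)]
  exact measurable_pilotThreshold h.reg (measurable_data_pilot Z U₀ n) (measurable_U₀_pilot Z U₀ n)
    (h.measurable_θp n) (h.θp_mem n) _ _

omit [IsProbabilityMeasure ν] [IsProbabilityMeasure P] in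
lemma measurable_Ψ (n : ℕ) : Measurable[MeasurableSpace.comap (data Z n) inferInstance ⊔
    MeasurableSpace.comap (U₀ n) inferInstance] (Ψ n) := by
  rw [show Ψ n = _ from funext (h.Ψ_eq n)]
  exact measurable_pilotMean h.reg (measurable_data_pilot Z U₀ n) (measurable_U₀_pilot Z U₀ n)
    (h.measurable_θp n) (h.θp_mem n) (h.measurable_H n) _

omit [IsProbabilityMeasure ν] [IsProbabilityMeasure P] in
lemma measurable_stepProb_pilot (n : ℕ) :
    Measurable[MeasurableSpace.comap (data Z n) inferInstance ⊔
      MeasurableSpace.comap (U₀ n) inferInstance] (stepProb m α s Z θp H Ψ n) :=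
  measurable_stepProb h.reg (measurable_data_pilot Z U₀ n) (h.measurable_θp n) (h.θp_mem n)
    (h.measurable_H n) (h.measurable_Ψ n) α s

lemma lln_sub : LLN P ν Z fun n ω i =>
    (n : ℝ)⁻¹ * (1 + htNoise (stepProb m α s Z θp H Ψ n ω i) (U n ω i)) := by
  refine lln_ht h.measurable_Z h.map_data h.pilot_le (measurable_data_pilot Z U₀) h.measurable_U
    h.indep_U h.map_U h.measurable_stepProb_pilot (ρ := fun n => (s n : ℝ) * (α / n)) ?_ ?_
  · filter_upwards [h.eventually_rate] with n hn
    exact ⟨hn.1, hn.2, fun ω i => h.le_stepProb n ω i⟩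
  · refine ((tendsto_natCast_atTop_atTop (R := ℝ)).comp h.s_tendsto |>.const_mul_atTop
      h.α_mem.1).congr' ?_
    filter_upwards [eventually_gt_atTop 0] with n hn
    simp only [Function.comp]
    field_simp

lemma tendsto_θhat : Tendsto (fun x : ℕ × Ω => θhat x.1 x.2) (whp P) (𝓝 θ₀) :=
  tendsto_argmax h.reg h.lln_full (fun _ _ _ => by positivity) h.θhat_max'

lemma tendsto_θp : Tendsto (fun x : ℕ × Ω => θp x.1 x.2) (whp P) (𝓝 θ₀) :=
  tendsto_argmax h.reg h.lln_pilot (fun _ _ _ => meanWeight_nonneg _ _) h.θp_max'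

lemma tendsto_fullHess : Tendsto (fun x : ℕ × Ω => fullHess m (data Z x.1 x.2) (θhat x.1 x.2))
    (whp P) (𝓝 (meanHess ν m θ₀)) := by
  refine tendsto_pi_nhds.2 fun k => tendsto_pi_nhds.2 fun l => ?_
  rw [Metric.tendsto_nhds]
  intro ε hε
  obtain ⟨ρ, hρ, hH⟩ := eventually_hess_near h.reg h.lln_full (fun _ _ _ => by positivity)
    (half_pos hε)
  filter_upwards [hH, h.tendsto_θhat.eventually (Metric.ball_mem_nhds _ hρ)] with x h1 h2
  have h3 := h1 (θhat x.1 x.2) (h.θhat_mem _ _) (by simpa [dist_eq_norm] using h2) k l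
  rw [Real.dist_eq]
  refine lt_of_le_of_lt (le_of_eq_of_le ?_ h3) (half_lt_self hε)
  simp [fullHess, meanHess, Matrix.sum_apply, Finset.mul_sum]

/-- The inclusion probabilities are at least `α s / n`, so the second moment of the noise is at most
`1 / α` times that of the envelope of the gradients. -/
lemma bddInProb_noiseScore (l : Fin d) :
    BddInProb P fun x => noiseScore m α s Z U θhat θp H Ψ x.1 x.2 l := by
  obtain ⟨C₀, C₁, hC₀, -, hC₀0, -, hg, -, -, -⟩ := h.reg.exists_envelopes
  have hc : ∀ n, Measurable[MeasurableSpace.comap (data Z n) inferInstance ⊔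
      MeasurableSpace.comap (U₀ n) inferInstance] fun ω (i : Fin n) =>
      √(s n) / n * gradient (m (data Z n ω i)) (θhat n ω) l := fun n =>
    measurable_mul_gradient h.reg (measurable_data_pilot Z U₀ n)
      ((h.measurable_θhat n).mono le_sup_left le_rfl) (h.θhat_mem n) _ l
  refine BddInProb.of_lintegral_sq_le
    (X := fun n ω => noiseScore m α s Z U θhat θp H Ψ n ω l) (fun n => ?_)
    (α⁻¹ * ∫ z, C₀ z ^ 2 ∂ν) ?_
  · exact (measurable_htSum ((hc n).mono (h.pilot_le n) le_rfl)
      ((h.measurable_stepProb_pilot n).mono (h.pilot_le n) le_rfl) (h.measurable_U n)).aemeasurable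
  · filter_upwards [h.eventually_rate, h.s_tendsto.eventually_gt_atTop 0,
      eventually_gt_atTop 0] with n hn hs hn0
    have hα := h.α_mem.1
    refine (lintegral_htSum_sq_le_of_indep (h.pilot_le n) (h.measurable_U n) (h.indep_U n)
      (h.map_U n) (hc n) (h.measurable_stepProb_pilot n) hn.1 hn.2
      (fun ω i => h.le_stepProb n ω i)).trans ?_
    have hint : ∀ i : Fin n, Integrable (fun ω => C₀ (data Z n ω i) ^ 2) P := fun i =>
      (measurePreserving_obs h.measurable_Z h.map_data i).integrable_comp_of_integrable
        hC₀.integrable_sq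
    have hval : ∀ i : Fin n, ∫ ω, C₀ (data Z n ω i) ^ 2 ∂P = ∫ z, C₀ z ^ 2 ∂ν := fun i => by
      have hp := measurePreserving_obs h.measurable_Z h.map_data (i : ℕ)
      rw [← hp.map_eq, integral_map hp.measurable.aemeasurable
        (by rw [hp.map_eq]; exact hC₀.integrable_sq.aestronglyMeasurable)]
      rfl
    calc _ ≤ ∫⁻ ω, ENNReal.ofReal (α⁻¹ * ∑ i, (n : ℝ)⁻¹ * C₀ (data Z n ω i) ^ 2) ∂P := by
          refine lintegral_mono fun ω => ENNReal.ofReal_le_ofReal ?_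
          have hs' : (0 : ℝ) < s n := by exact_mod_cast hs
          have hn' : (0 : ℝ) < n := by exact_mod_cast hn0
          have e : ∀ i : Fin n, (√(s n) / n * gradient (m (data Z n ω i)) (θhat n ω) l) ^ 2 ≤
              s n / n ^ 2 * C₀ (data Z n ω i) ^ 2 := fun i => by
            rw [mul_pow, div_pow, Real.sq_sqrt hs'.le]
            have := (PiLp.norm_apply_le (gradient (m (data Z n ω i)) (θhat n ω)) l).trans
              (hg (data Z n ω i) _ (h.θhat_mem n ω))
            have h2 : gradient (m (data Z n ω i)) (θhat n ω) l ^ 2 ≤ C₀ (data Z n ω i) ^ 2 := by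
              rw [← sq_abs]
              exact pow_le_pow_left₀ (abs_nonneg _) this 2
            gcongr
          calc _ ≤ ((s n : ℝ) * (α / n))⁻¹ * ∑ i, s n / n ^ 2 * C₀ (data Z n ω i) ^ 2 := by
                gcongr with i; exact e i
            _ = _ := by
                rw [← Finset.mul_sum, ← Finset.mul_sum]
                field_simp
      _ = ENNReal.ofReal (∫ ω, α⁻¹ * ∑ i, (n : ℝ)⁻¹ * C₀ (data Z n ω i) ^ 2 ∂P) := by
          rw [ofReal_integral_eq_lintegral_ofReal]
          · exact (integrable_finsetSum _ fun i _ => (hint i).const_mul _).const_mul _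
          · exact ae_of_all _ fun ω => by positivity
      _ = _ := by
          rw [integral_const_mul, integral_finsetSum _ fun i _ => (hint i).const_mul _]
          simp only [integral_const_mul, hval, Finset.sum_const, Finset.card_univ, Fintype.card_fin,
            nsmul_eq_mul]
          congr 2
          field_simp

/-- The scaled error of the subsampling estimator solves, up to smaller terms, the linear system
given by the mean Hessian matrix and the noise in the score. -/
lemma eventually_noiseScore_add {ε : ℝ} (hε : 0 < ε) : ∀ᶠ x in whp P, ∀ l,
    |noiseScore m α s Z U θhat θp H Ψ x.1 x.2 l +
      (meanHess ν m θ₀ *ᵥ (√(s x.1) • (θsub x.1 x.2 - θhat x.1 x.2).ofLp)) l| ≤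
      ε * (√(s x.1) * ‖θsub x.1 x.2 - θhat x.1 x.2‖) := by
  filter_upwards [eventually_score_linear h.reg h.lln_sub h.weight_nonneg h.θsub_max' h.θhat_mem
    h.tendsto_θhat hε, h.tendsto_θhat.eventually (isOpen_interior.mem_nhds h.reg.interior)]
    with x hx hx2 l
  have h0 := sum_mul_gradient_eq_zero_of_isMaximizer h.reg _ _ (h.θhat_max' x.1 x.2) hx2 l
  have h1 := mul_le_mul_of_nonneg_left (hx l) (Real.sqrt_nonneg (s x.1))
  rw [← abs_of_nonneg (Real.sqrt_nonneg (s x.1)), ← abs_mul,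
    abs_of_nonneg (Real.sqrt_nonneg (s x.1))] at h1
  refine (le_of_eq (congrArg _ ?_)).trans (h1.trans (le_of_eq (by ring)))
  rw [mul_add]
  congr 1
  · have e : ∑ i, (x.1 : ℝ)⁻¹ * (1 + htNoise (stepProb m α s Z θp H Ψ x.1 x.2 i) (U x.1 x.2 i)) *
        gradient (m (data Z x.1 x.2 i)) (θhat x.1 x.2) l =
        ∑ i, (x.1 : ℝ)⁻¹ * gradient (m (data Z x.1 x.2 i)) (θhat x.1 x.2) l +
        ∑ i, (x.1 : ℝ)⁻¹ * htNoise (stepProb m α s Z θp H Ψ x.1 x.2 i) (U x.1 x.2 i) *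
          gradient (m (data Z x.1 x.2 i)) (θhat x.1 x.2) l := by
      rw [← Finset.sum_add_distrib]; exact Finset.sum_congr rfl fun i _ => by ring
    rw [e, h0, zero_add, Finset.mul_sum, noiseScore]
    exact Finset.sum_congr rfl fun i _ => by ring
  · rw [Matrix.mulVec_smul, Pi.smul_apply, smul_eq_mul]
    congr 1
    rw [Matrix.mulVec, dotProduct]
    exact Finset.sum_congr rfl fun k _ => by rw [meanHess_symm h.reg l k, mul_comm]

/-- The subsampling estimator is within `O(1 / √s)` of the full data estimator: the smaller terms in
the linear system are absorbed into the left-hand side. -/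
lemma bddInProb_error :
    BddInProb P fun x => √(s x.1) * ‖θsub x.1 x.2 - θhat x.1 x.2‖ := by
  set A := meanHess ν m θ₀
  set K : ℝ := ∑ k, ∑ l, |A⁻¹ k l| with hK
  have hK0 : 0 ≤ K := by positivity
  have hb : BddInProb P fun x => 2 * K * ∑ l, |noiseScore m α s Z U θhat θp H Ψ x.1 x.2 l| :=
    (BddInProb.sum _ fun l _ => (h.bddInProb_noiseScore l).of_le
      (Eventually.of_forall fun x => by rw [abs_abs])).const_mul _
  refine hb.of_le ?_
  filter_upwards [h.eventually_noiseScore_add (show 0 < 1 / (2 * (K + 1)) by positivity)] with x hx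
  generalize noiseScore m α s Z U θhat θp H Ψ x.1 x.2 = N at hx ⊢
  generalize θsub x.1 x.2 - θhat x.1 x.2 = δ at hx ⊢
  have hσ := Real.sqrt_nonneg (s x.1 : ℝ)
  generalize √(s x.1 : ℝ) = σ at hx hσ ⊢
  set Y : ℝ := σ * ‖δ‖ with hY
  set S : ℝ := ∑ l, |N l| with hS
  have hY0 : 0 ≤ Y := by positivity
  have hS0 : 0 ≤ S := by positivity
  have hAy : ∀ l, |(A *ᵥ (σ • δ.ofLp)) l| ≤ S + 1 / (2 * (K + 1)) * Y := fun l => by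
    have h1 := hx l
    have h2 : |N l| ≤ S := Finset.single_le_sum (f := fun l => |N l|) (fun _ _ => abs_nonneg _)
      (Finset.mem_univ l)
    have h3 := abs_sub_abs_le_abs_sub ((A *ᵥ (σ • δ.ofLp)) l) (-(N l))
    rw [sub_neg_eq_add, add_comm _ (N l), abs_neg] at h3
    linarith
  have hy : ∀ k, |σ * δ k| ≤ (∑ l, |A⁻¹ k l|) * (S + 1 / (2 * (K + 1)) * Y) := fun k => by
    have e : σ • δ.ofLp = A⁻¹ *ᵥ (A *ᵥ (σ • δ.ofLp)) := by
      rw [Matrix.mulVec_mulVec, Matrix.nonsing_inv_mul _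
        ((Matrix.isUnit_iff_isUnit_det _).1 (isUnit_meanHess h.reg)), Matrix.one_mulVec]
    have e2 : σ * δ k = ∑ l, A⁻¹ k l * (A *ᵥ (σ • δ.ofLp)) l := congrFun e k
    rw [e2, Finset.sum_mul]
    refine (Finset.abs_sum_le_sum_abs _ _).trans (Finset.sum_le_sum fun l _ => ?_)
    rw [abs_mul]
    exact mul_le_mul_of_nonneg_left (hAy l) (abs_nonneg _)
  have hYle : Y ≤ K * (S + 1 / (2 * (K + 1)) * Y) := by
    calc Y ≤ σ * ∑ k, |δ k| := mul_le_mul_of_nonneg_left (norm_le_sum_abs δ) hσ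
      _ = ∑ k, |σ * δ k| := by
        rw [Finset.mul_sum]; exact Finset.sum_congr rfl fun k _ => by rw [abs_mul, abs_of_nonneg hσ]
      _ ≤ ∑ k, (∑ l, |A⁻¹ k l|) * (S + 1 / (2 * (K + 1)) * Y) := Finset.sum_le_sum fun k _ => hy k
      _ = _ := by rw [← Finset.sum_mul]
  have hK2 : K * (1 / (2 * (K + 1)) * Y) ≤ 1 / 2 * Y := by
    rw [← mul_assoc]
    refine mul_le_mul_of_nonneg_right ?_ hY0
    rw [mul_one_div, div_le_div_iff₀ (by positivity) (by norm_num)]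
    linarith
  rw [abs_of_nonneg hY0, abs_of_nonneg (by positivity)]
  linarith

lemma tendsto_noiseScore_add (l : Fin d) : Tendsto (fun x : ℕ × Ω =>
    noiseScore m α s Z U θhat θp H Ψ x.1 x.2 l +
      (meanHess ν m θ₀ *ᵥ (√(s x.1) • (θsub x.1 x.2 - θhat x.1 x.2).ofLp)) l) (whp P) (𝓝 0) := by
  refine h.bddInProb_error.tendsto_zero_of_isLittleO (Asymptotics.isLittleO_iff.2 fun ε hε => ?_)
  filter_upwards [h.eventually_noiseScore_add hε] with x hx
  rw [Real.norm_eq_abs, Real.norm_of_nonneg (by positivity)]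
  exact hx l

end Experiment

/-! ### The estimated variance matrix -/

lemma LLN.tendsto_weighted_mean {q : ℕ} {Ω : Type*} [MeasurableSpace Ω] {P : Measure Ω}
    {ν : Measure (Obs q)} {Z : ℕ → Ω → Obs q} {W : (n : ℕ) → Ω → Fin n → ℝ} (hW : LLN P ν Z W)
    (hW0 : ∀ n ω i, 0 ≤ W n ω i) {w : Obs q → ℝ} (hw : MemLp w 2 ν) {τ : (n : ℕ) → Ω → Fin n → ℝ}
    (hτ : Tendsto (fun x : ℕ × Ω => ∑ i, W x.1 x.2 i * |τ x.1 x.2 i - w (data Z x.1 x.2 i)|)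
      (whp P) (𝓝 0)) :
    Tendsto (fun x : ℕ × Ω => ∑ i, W x.1 x.2 i * τ x.1 x.2 i) (whp P) (𝓝 (∫ z, w z ∂ν)) := by
  have h1 : Tendsto (fun x : ℕ × Ω => ∑ i, W x.1 x.2 i * (τ x.1 x.2 i - w (data Z x.1 x.2 i)))
      (whp P) (𝓝 0) := by
    refine squeeze_zero_norm (fun x => ?_) hτ
    refine (norm_sum_le _ _).trans (Finset.sum_le_sum fun i _ => le_of_eq ?_)
    rw [norm_mul, Real.norm_of_nonneg (hW0 _ _ _), Real.norm_eq_abs]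
  have h2 := h1.add (hW w hw)
  rw [zero_add] at h2
  refine h2.congr fun x => ?_
  rw [← Finset.sum_add_distrib]
  exact Finset.sum_congr rfl fun i _ => by ring

section matrices

variable {q d n : ℕ} {m : Obs q → Param d → ℝ}

lemma scoreVar_entry (s : ℕ) (p : Fin n → ℝ) (D : Fin n → Obs q) (θ : Param d) (k l : Fin d) :
    scoreVar m s p D θ k l = (s : ℝ) / (n : ℝ) ^ 2 * ∑ i, (1 - inclusionProb s p i) /
      inclusionProb s p i * (gradient (m (D i)) θ k * gradient (m (D i)) θ l) := by
  simp [scoreVar, Matrix.sum_apply, Matrix.vecMulVec_apply]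

lemma odds_nonneg {s : ℕ} {p : Fin n → ℝ} (hp : ∀ i, 0 ≤ p i) (i : Fin n) :
    0 ≤ (1 - inclusionProb s p i) / inclusionProb s p i :=
  div_nonneg (sub_nonneg.2 (min_le_right _ _))
    (le_min (mul_nonneg (Nat.cast_nonneg _) (hp i)) zero_le_one)

lemma posSemidef_scoreVar {s : ℕ} {p : Fin n → ℝ} (hp : ∀ i, 0 ≤ p i) (D : Fin n → Obs q)
    (θ : Param d) : (scoreVar m s p D θ).PosSemidef := by
  refine Matrix.PosSemidef.smul (Matrix.posSemidef_sum _ fun i _ => ?_) (by positivity)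
  refine Matrix.PosSemidef.smul ?_ (odds_nonneg hp i)
  have := Matrix.posSemidef_vecMulVec_self_star (gradient (m (D i)) θ).ofLp
  rwa [star_trivial] at this

lemma fullHess_apply (D : Fin n → Obs q) (θ : Param d) (k l : Fin d) :
    fullHess m D θ k l = (n : ℝ)⁻¹ * ∑ i, hess m (D i) θ k l := by
  simp [fullHess, Matrix.sum_apply]

lemma posSemidef_asympVar {ν : Measure (Obs q)} {Θ : Set (Param d)} {θ₀ : Param d}
    (h : Regularity ν m Θ θ₀) {s : ℕ} {p : Fin n → ℝ} (hp : ∀ i, 0 ≤ p i) (D : Fin n → Obs q)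
    {θ : Param d} (hθ : θ ∈ Θ) : (asympVar m s p D θ).PosSemidef := by
  have hH : (fullHess m D θ).IsHermitian := by
    ext k l
    rw [Matrix.conjTranspose_apply, star_trivial, fullHess_apply, fullHess_apply]
    simp only [h.hess_symm _ hθ k l]
  have := (posSemidef_scoreVar (m := m) (s := s) hp D θ).mul_mul_conjTranspose_same
    (fullHess m D θ)⁻¹
  rwa [hH.inv.eq] at this

/-- The conditional variance of the noise in a linear image of the score, as a quadratic form. -/
lemma sum_inner_sq_mul_odds (B : Matrix (Fin d) (Fin d) ℝ) (s : ℕ) (p : Fin n → ℝ)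
    (D : Fin n → Obs q) (θ τ : Param d) :
    ∑ i, inner ℝ (WithLp.toLp 2 (B *ᵥ ((√s / n) • (gradient (m (D i)) θ).ofLp)) : Param d) τ ^ 2 *
      ((1 - inclusionProb s p i) / inclusionProb s p i) =
      τ.ofLp ⬝ᵥ ((B * scoreVar m s p D θ * Bᵀ) *ᵥ τ.ofLp) := by
  have e : τ.ofLp ⬝ᵥ ((B * scoreVar m s p D θ * Bᵀ) *ᵥ τ.ofLp) =
      (Bᵀ *ᵥ τ.ofLp) ⬝ᵥ (scoreVar m s p D θ *ᵥ (Bᵀ *ᵥ τ.ofLp)) := by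
    rw [← Matrix.mulVec_mulVec, ← Matrix.mulVec_mulVec, Matrix.dotProduct_mulVec _ B,
      ← Matrix.mulVec_transpose]
  rw [e, scoreVar, Matrix.smul_mulVec, Matrix.sum_mulVec, dotProduct_smul, dotProduct_sum,
    smul_eq_mul, Finset.mul_sum]
  refine Finset.sum_congr rfl fun i _ => ?_
  rw [EuclideanSpace.inner_eq_star_dotProduct, star_trivial, Matrix.mulVec_smul, dotProduct_smul,
    Matrix.dotProduct_mulVec, ← Matrix.mulVec_transpose, Matrix.smul_mulVec,
    Matrix.vecMulVec_mulVec, dotProduct_smul, op_smul_eq_smul, dotProduct_smul]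
  simp only [smul_eq_mul]
  rw [mul_pow, div_pow, Real.sq_sqrt (Nat.cast_nonneg s),
    dotProduct_comm (gradient (m (D i)) θ).ofLp]
  ring

lemma abs_quadraticForm_sub_le (M : Matrix (Fin d) (Fin d) ℝ) (τ : Param d) :
    |τ.ofLp ⬝ᵥ (M *ᵥ τ.ofLp) - ‖τ‖ ^ 2| ≤
      (∑ k, ∑ l, |M k l - (1 : Matrix (Fin d) (Fin d) ℝ) k l|) * ‖τ‖ ^ 2 := by
  have e : τ.ofLp ⬝ᵥ (M *ᵥ τ.ofLp) - ‖τ‖ ^ 2 =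
      ∑ k, ∑ l, τ k * ((M k l - (1 : Matrix (Fin d) (Fin d) ℝ) k l) * τ l) := by
    have h1 : ‖τ‖ ^ 2 = τ.ofLp ⬝ᵥ ((1 : Matrix (Fin d) (Fin d) ℝ) *ᵥ τ.ofLp) := by
      rw [Matrix.one_mulVec, EuclideanSpace.real_norm_sq_eq, dotProduct]
      exact Finset.sum_congr rfl fun k _ => sq _
    rw [h1, ← dotProduct_sub, ← Matrix.sub_mulVec]
    simp only [dotProduct, Matrix.mulVec, Finset.mul_sum, Matrix.sub_apply]
  rw [e, Finset.sum_mul]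
  refine (Finset.abs_sum_le_sum_abs _ _).trans (Finset.sum_le_sum fun k _ => ?_)
  rw [Finset.sum_mul]
  refine (Finset.abs_sum_le_sum_abs _ _).trans (Finset.sum_le_sum fun l _ => ?_)
  have hk : |τ k| ≤ ‖τ‖ := PiLp.norm_apply_le τ k
  have hl : |τ l| ≤ ‖τ‖ := PiLp.norm_apply_le τ l
  rw [abs_mul, abs_mul]
  calc _ ≤ ‖τ‖ * (|M k l - (1 : Matrix (Fin d) (Fin d) ℝ) k l| * ‖τ‖) := by gcongr
    _ = _ := by ring

lemma norm_mulVec_le (B : Matrix (Fin d) (Fin d) ℝ) (c : ℝ) (g : Param d) :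
    ‖(WithLp.toLp 2 (B *ᵥ (c • g.ofLp)) : Param d)‖ ≤ (∑ k, ∑ l, |B k l|) * (|c| * ‖g‖) := by
  refine (norm_le_sum_abs _).trans ?_
  rw [Finset.sum_mul]
  refine Finset.sum_le_sum fun k _ => ?_
  change |∑ l, B k l * (c * g l)| ≤ _
  rw [Finset.sum_mul]
  refine (Finset.abs_sum_le_sum_abs _ _).trans (Finset.sum_le_sum fun l _ => ?_)
  have hl : |g l| ≤ ‖g‖ := PiLp.norm_apply_le g l
  rw [abs_mul, abs_mul]
  gcongr

lemma htVec_mulVec (B : Matrix (Fin d) (Fin d) ℝ) (c : ℝ) (g : Fin n → Param d) (r u : Fin n → ℝ)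
    (j : Fin d) : htVec (fun i => WithLp.toLp 2 (B *ᵥ (c • (g i).ofLp))) r u j =
      (B *ᵥ fun l => ∑ i, c * g i l * htNoise (r i) (u i)) j := by
  simp only [htVec_apply, Matrix.mulVec, dotProduct, Pi.smul_apply, smul_eq_mul, Finset.sum_mul,
    Finset.mul_sum]
  rw [Finset.sum_comm]
  exact Finset.sum_congr rfl fun i _ => Finset.sum_congr rfl fun k _ => by ring

variable {β : Type*} {mβ : MeasurableSpace β} {ν : Measure (Obs q)} {Θ : Set (Param d)}
  {θ₀ : Param d} {D : β → Fin n → Obs q} {T : β → Param d}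

lemma measurable_mulVec_gradient (h : Regularity ν m Θ θ₀) (hD : Measurable D) (hT : Measurable T)
    (hTΘ : ∀ ω, T ω ∈ Θ) (B : Matrix (Fin d) (Fin d) ℝ) (c : ℝ) (i : Fin n) (j : Fin d) :
    Measurable fun ω =>
      (WithLp.toLp 2 (B *ᵥ (c • (gradient (m (D ω i)) (T ω)).ofLp)) : Param d) j := by
  simp only [Matrix.mulVec, dotProduct, Pi.smul_apply, smul_eq_mul]
  exact Finset.measurable_fun_sum _ fun k _ =>
    ((measurable_gradient_eval h hD hT hTΘ i k).const_mul c).const_mul _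

lemma measurable_asympVar (h : Regularity ν m Θ θ₀) (hD : Measurable D) (hT : Measurable T)
    (hTΘ : ∀ ω, T ω ∈ Θ) {p : β → Fin n → ℝ} (hp : ∀ i, Measurable fun ω => p ω i) (s : ℕ)
    (k l : Fin d) : Measurable fun ω => asympVar m s (p ω) (D ω) (T ω) k l := by
  have hH : ∀ i j, Measurable fun ω => (fullHess m (D ω) (T ω))⁻¹ i j :=
    measurable_inv_apply fun i j => by
      simp only [fullHess_apply]
      exact (Finset.measurable_fun_sum _ fun a _ =>
        measurable_hess_eval h hD hT hTΘ a i j).const_mul _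
  have hS : ∀ i j, Measurable fun ω => scoreVar m s (p ω) (D ω) (T ω) i j := fun i j => by
    simp only [scoreVar_entry, inclusionProb]
    refine (Finset.measurable_fun_sum _ fun a _ => Measurable.mul ?_ ?_).const_mul _
    · have := ((hp a).const_mul (s : ℝ)).min (measurable_const (a := (1 : ℝ)))
      exact (this.const_sub 1).div this
    · exact (measurable_gradient_eval h hD hT hTΘ a i).mul
        (measurable_gradient_eval h hD hT hTΘ a j)
  exact measurable_mul_apply (measurable_mul_apply hH hS) hH k l

lemma measurable_standardized {V : β → Matrix (Fin d) (Fin d) ℝ}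
    (hV : ∀ i j, Measurable fun ω => V ω i j) (hpsd : ∀ ω, (V ω).PosSemidef) {T' : β → Param d}
    (hT : Measurable T) (hT' : Measurable T') (s : ℕ) (j : Fin d) :
    Measurable fun ω => standardized s (V ω) (T ω) (T' ω) j := by
  simp only [standardized, Pi.smul_apply, Matrix.mulVec, dotProduct, smul_eq_mul]
  refine (Finset.measurable_fun_sum _ fun k _ => Measurable.mul ?_ ?_).const_mul _
  · exact measurable_inv_apply (measurable_sqrt_apply hV hpsd) j k
  · exact (EuclideanSpace.proj (𝕜 := ℝ) k).continuous.measurable.comp (hT.sub hT')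

end matrices

/-! ### Asymptotic normality for convergent subsampling probabilities -/

namespace Experiment

variable {q d : ℕ} {Ω : Type*} {mΩ : MeasurableSpace Ω} {ν : Measure (Obs q)}
  {m : Obs q → Param d → ℝ} {Θ : Set (Param d)} {θ₀ : Param d} {α b ϱ : ℝ} {s₀ s : ℕ → ℕ}
  {P : Measure Ω} {Z : ℕ → Ω → Obs q} {U₀ U : (n : ℕ) → Ω → Fin n → ℝ} {θhat θp : ℕ → Ω → Param d}
  {H Ψ : ℕ → Ω → ℝ} {θsub : ℕ → Ω → Param d} [IsProbabilityMeasure ν] [IsProbabilityMeasure P]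
  (h : Experiment ν m Θ θ₀ α b ϱ s₀ s P Z U₀ U θhat θp H Ψ θsub)

/-- The limit of the score variance if the truncated gradient norms, to which the subsampling
probabilities are proportional before mixing, converge to `w`. -/
noncomputable def limitScoreVar (ν : Measure (Obs q)) (m : Obs q → Param d → ℝ) (θ₀ : Param d)
    (α κ : ℝ) (w : Obs q → ℝ) : Matrix (Fin d) (Fin d) ℝ :=
  Matrix.of fun k l => ∫ z, varFactor ((1 - α) * (w z / ∫ y, w y ∂ν) + α) κ *
    (gradient (m z) θ₀ k * gradient (m z) θ₀ l) ∂ν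

variable {w : Obs q → ℝ} (hw : MemLp w 2 ν) (hwm : Measurable w) (hw0 : ∀ z, 0 ≤ w z)
  (hμ : 0 < ∫ z, w z ∂ν)

include h in
omit [IsProbabilityMeasure ν] [IsProbabilityMeasure P] in
lemma bϱ_nonneg : 0 ≤ b * ϱ := mul_nonneg (by linarith [h.one_le_b]) h.ϱ_mem.1

include h hw hwm hw0 hμ

lemma tendsto_scoreVar_pilot
    (hτ : Tendsto (fun x : ℕ × Ω => ∑ i, (x.1 : ℝ)⁻¹ *
      |min (gradNorm m (data Z x.1 x.2 i) (θp x.1 x.2)) (H x.1 x.2) - w (data Z x.1 x.2 i)|)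
      (whp P) (𝓝 0))
    (hΨ : Tendsto (fun x : ℕ × Ω => Ψ x.1 x.2) (whp P) (𝓝 (∫ z, w z ∂ν))) :
    Tendsto (fun x : ℕ × Ω => scoreVar m (s x.1)
      (mixProb α (approxProb m (data Z x.1 x.2) (θp x.1 x.2) (H x.1 x.2) (Ψ x.1 x.2)))
      (data Z x.1 x.2) (θhat x.1 x.2)) (whp P) (𝓝 (limitScoreVar ν m θ₀ α (b * ϱ) w)) := by
  have := tendsto_scoreVar h.reg h.measurable_Z h.map_data h.θhat_mem h.tendsto_θhat h.fourth
    h.α_mem hμ h.bϱ_nonneg h.s_tendsto h.tendsto_ratio hw hwm hw0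
    (τ := fun n ω i => min (gradNorm m (data Z n ω i) (θp n ω)) (H n ω)) (Ψ := Ψ)
    h.min_nonneg h.Ψ_nonneg hτ hΨ
  exact this

lemma tendsto_scoreVar_full {η : ℕ → Ω → ℝ} (hη0 : ∀ n ω, 0 ≤ η n ω)
    (hτ : Tendsto (fun x : ℕ × Ω => ∑ i, (x.1 : ℝ)⁻¹ *
      |min (gradNorm m (data Z x.1 x.2 i) (θhat x.1 x.2)) (η x.1 x.2) - w (data Z x.1 x.2 i)|)
      (whp P) (𝓝 0)) :
    Tendsto (fun x : ℕ × Ω => scoreVar m (s x.1)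
      (mixProb α (thresholdProb (fun i => gradNorm m (data Z x.1 x.2 i) (θhat x.1 x.2))
        (η x.1 x.2)))
      (data Z x.1 x.2) (θhat x.1 x.2)) (whp P) (𝓝 (limitScoreVar ν m θ₀ α (b * ϱ) w)) := by
  have hτ0 : ∀ n ω (i : Fin n), 0 ≤ min (gradNorm m (data Z n ω i) (θhat n ω)) (η n ω) :=
    fun n ω i => le_min (gradNorm_nonneg _ _) (hη0 n ω)
  have hmean : Tendsto (fun x : ℕ × Ω => ∑ i, (x.1 : ℝ)⁻¹ *
      min (gradNorm m (data Z x.1 x.2 i) (θhat x.1 x.2)) (η x.1 x.2)) (whp P)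
      (𝓝 (∫ z, w z ∂ν)) := h.lln_full.tendsto_weighted_mean (fun _ _ _ => by positivity) hw
        (τ := fun n ω i => min (gradNorm m (data Z n ω i) (θhat n ω)) (η n ω)) hτ
  refine (tendsto_scoreVar h.reg h.measurable_Z h.map_data h.θhat_mem h.tendsto_θhat h.fourth
    h.α_mem hμ h.bϱ_nonneg h.s_tendsto h.tendsto_ratio hw hwm hw0 hτ0
    (Ψ := fun n ω => ∑ i, (n : ℝ)⁻¹ * min (gradNorm m (data Z n ω i) (θhat n ω)) (η n ω))
    (fun n ω => Finset.sum_nonneg fun i _ => mul_nonneg (by positivity) (hτ0 n ω i)) hτ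
    hmean).congr fun x => ?_
  congr 1
  funext i
  have hn : (x.1 : ℝ) ≠ 0 := Nat.cast_ne_zero.2 (Fin.pos i).ne'
  rw [mixProb, mixProb, thresholdProb, ← Finset.mul_sum, mul_inv_cancel_left₀ hn]

/-- Asymptotic normality of the standardized error whenever the pilot thresholds and the thresholds
in the variance formula both lead to asymptotic subsampling probabilities that are proportional to
`w` before mixing. -/
theorem condConvStdGaussian_of_tendsto
    (hτ : Tendsto (fun x : ℕ × Ω => ∑ i, (x.1 : ℝ)⁻¹ *
      |min (gradNorm m (data Z x.1 x.2 i) (θp x.1 x.2)) (H x.1 x.2) - w (data Z x.1 x.2 i)|)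
      (whp P) (𝓝 0))
    (hΨ : Tendsto (fun x : ℕ × Ω => Ψ x.1 x.2) (whp P) (𝓝 (∫ z, w z ∂ν)))
    {η : ℕ → Ω → ℝ} (hηm : ∀ n, Measurable (η n)) (hη0 : ∀ n ω, 0 ≤ η n ω)
    (hη : Tendsto (fun x : ℕ × Ω => ∑ i, (x.1 : ℝ)⁻¹ *
      |min (gradNorm m (data Z x.1 x.2 i) (θhat x.1 x.2)) (η x.1 x.2) - w (data Z x.1 x.2 i)|)
      (whp P) (𝓝 0))
    (hpos : (limitScoreVar ν m θ₀ α (b * ϱ) w).PosDef) {𝓖 : ℕ → MeasurableSpace Ω}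
    (h𝓖 : ∀ n, 𝓖 n = MeasurableSpace.comap (data Z n) inferInstance ⊔
      MeasurableSpace.comap (fun ω => (θp n ω, H n ω, Ψ n ω)) inferInstance) :
    CondConvStdGaussian P 𝓖 fun n ω => standardized (s n)
      (asympVar m (s n) (mixProb α (thresholdProb
        (fun i => gradNorm m (data Z n ω i) (θhat n ω)) (η n ω))) (data Z n ω) (θhat n ω))
      (θsub n ω) (θhat n ω) := by
  set A := meanHess ν m θ₀ with hA
  set Λ := limitScoreVar ν m θ₀ α (b * ϱ) w with hΛ
  have hAu : IsUnit A := isUnit_meanHess h.reg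
  have hAdet : IsUnit A.det := (Matrix.isUnit_iff_isUnit_det _).1 hAu
  have hAt : (A⁻¹)ᵀ = A⁻¹ := by
    rw [Matrix.transpose_nonsing_inv]
    congr 1
    ext k l
    exact meanHess_symm h.reg l k
  -- the limit of the variance matrices and of their inverse roots
  set V : Matrix (Fin d) (Fin d) ℝ := A⁻¹ * Λ * A⁻¹ with hV
  have hVpd : V.PosDef := by
    have h1 : Function.Injective fun v => v ᵥ* A⁻¹ :=
      Matrix.vecMul_injective_of_isUnit (Matrix.isUnit_nonsing_inv_iff.2 hAu)
    have h2 := hpos.mul_mul_conjTranspose_same (B := A⁻¹) h1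
    rwa [Matrix.conjTranspose_eq_transpose_of_trivial, hAt] at h2
  set C := CFC.sqrt V with hC
  have hCC : C * C = V := CFC.sqrt_mul_sqrt_self V (Matrix.nonneg_iff_posSemidef.2 hVpd.posSemidef)
  have hCdet : IsUnit C.det := by
    have h1 := (Matrix.isUnit_iff_isUnit_det _).1 hVpd.isUnit
    rw [← hCC, Matrix.det_mul] at h1
    exact isUnit_of_mul_isUnit_left h1
  have hCt : Cᵀ = C := by
    rw [← Matrix.conjTranspose_eq_transpose_of_trivial]
    exact (Matrix.nonneg_iff_posSemidef.1 (CFC.sqrt_nonneg V)).isHermitian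
  set Vn : ℕ → Ω → Matrix (Fin d) (Fin d) ℝ := fun n ω => asympVar m (s n) (mixProb α (thresholdProb
    (fun i => gradNorm m (data Z n ω i) (θhat n ω)) (η n ω))) (data Z n ω) (θhat n ω) with hVn
  have hprob0 : ∀ n ω (i : Fin n), 0 ≤ mixProb α (thresholdProb
      (fun i => gradNorm m (data Z n ω i) (θhat n ω)) (η n ω)) i := fun n ω i => by
    have h1 : ∀ j : Fin n, 0 ≤ min (gradNorm m (data Z n ω j) (θhat n ω)) (η n ω) := fun j =>
      le_min (gradNorm_nonneg _ _) (hη0 n ω)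
    exact add_nonneg (mul_nonneg (sub_nonneg.2 h.α_mem.2.le)
      (div_nonneg (h1 i) (Finset.sum_nonneg fun j _ => h1 j)))
      (div_nonneg h.α_mem.1.le (Nat.cast_nonneg _))
  have hVn0 : ∀ n ω, (Vn n ω).PosSemidef := fun n ω =>
    posSemidef_asympVar h.reg (hprob0 n ω) _ (h.θhat_mem n ω)
  have hinv : ∀ {M : Matrix (Fin d) (Fin d) ℝ}, IsUnit M.det →
      ContinuousAt (fun N : Matrix (Fin d) (Fin d) ℝ => N⁻¹) M := fun hM =>
    continuousAt_matrix_inv _ (by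
      rw [Ring.inverse_eq_inv']
      exact continuousAt_inv₀ hM.ne_zero)
  have hVlim : Tendsto (fun x : ℕ × Ω => Vn x.1 x.2) (whp P) (𝓝 V) := by
    have h1 := (hinv hAdet).tendsto.comp h.tendsto_fullHess
    exact (h1.mul (h.tendsto_scoreVar_full hw hwm hw0 hμ hη0 hη)).mul h1
  have hQlim : Tendsto (fun x : ℕ × Ω => (CFC.sqrt (Vn x.1 x.2))⁻¹) (whp P) (𝓝 C⁻¹) :=
    (hinv hCdet).tendsto.comp (tendsto_matrix_sqrt hVlim (Eventually.of_forall fun x => hVn0 _ _))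
  set B : Matrix (Fin d) (Fin d) ℝ := -(C⁻¹ * A⁻¹) with hB
  have hBΛB : B * Λ * Bᵀ = 1 := by
    have e : B * Λ * Bᵀ = C⁻¹ * V * C⁻¹ := by
      rw [hB, Matrix.transpose_neg, Matrix.transpose_mul, hAt, Matrix.transpose_nonsing_inv, hCt,
        hV]
      simp only [Matrix.neg_mul, Matrix.mul_neg, neg_neg, Matrix.mul_assoc]
    rw [e, ← hCC, ← Matrix.mul_assoc, Matrix.nonsing_inv_mul _ hCdet, Matrix.one_mul,
      Matrix.mul_nonsing_inv _ hCdet]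
  -- measurability with respect to the conditioning information
  have hle1 : ∀ n, MeasurableSpace.comap (data Z n) inferInstance ≤ 𝓖 n := fun n => by
    rw [h𝓖]; exact le_sup_left
  have hle2 : ∀ n, MeasurableSpace.comap (fun ω => (θp n ω, H n ω, Ψ n ω)) inferInstance ≤ 𝓖 n :=
    fun n => by rw [h𝓖]; exact le_sup_right
  have hle3 : ∀ n, 𝓖 n ≤ MeasurableSpace.comap (data Z n) inferInstance ⊔
      MeasurableSpace.comap (U₀ n) inferInstance := fun n => by
    rw [h𝓖]
    exact sup_le le_sup_left
      ((h.measurable_θp n).prodMk ((h.measurable_H n).prodMk (h.measurable_Ψ n))).comap_le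
  have hle : ∀ n, 𝓖 n ≤ mΩ := fun n => (hle3 n).trans (h.pilot_le n)
  have hD : ∀ n, Measurable[𝓖 n] (data Z n) := fun n =>
    (comap_measurable (data Z n)).mono (hle1 n) le_rfl
  have hθ : ∀ n, Measurable[𝓖 n] (θhat n) := fun n => (h.measurable_θhat n).mono (hle1 n) le_rfl
  have hpil : ∀ n, Measurable[𝓖 n] (fun ω => (θp n ω, H n ω, Ψ n ω)) := fun n =>
    (comap_measurable _).mono (hle2 n) le_rfl
  have hr : ∀ n, Measurable[𝓖 n] (stepProb m α s Z θp H Ψ n) := fun n =>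
    measurable_stepProb h.reg (hD n) (measurable_fst.comp (hpil n)) (h.θp_mem n)
      (measurable_fst.comp (measurable_snd.comp (hpil n)))
      (measurable_snd.comp (measurable_snd.comp (hpil n))) α s
  refine condConvStdGaussian_of_htVec hle h.measurable_U
    (fun n => indep_of_indep_of_le_left (h.indep_U n) (hle3 n)) h.map_U
    (v := fun n ω i => WithLp.toLp 2 (B *ᵥ ((√(s n) / n) •
      (gradient (m (data Z n ω i)) (θhat n ω)).ofLp)))
    (r := stepProb m α s Z θp H Ψ)
    (fun n i j => measurable_mulVec_gradient h.reg (hD n) (hθ n) (h.θhat_mem n) B _ i j)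
    (fun n i => (measurable_pi_apply i).comp (hr n)) ?_ ?_ ?_ ?_ ?_
  · filter_upwards [h.eventually_rate] with n hn ω i
    exact hn.1.trans_le (h.le_stepProb n ω i)
  · -- the conditional variance
    intro δ hδ
    have h1 : Tendsto (fun x : ℕ × Ω => B * scoreVar m (s x.1)
        (mixProb α (approxProb m (data Z x.1 x.2) (θp x.1 x.2) (H x.1 x.2) (Ψ x.1 x.2)))
        (data Z x.1 x.2) (θhat x.1 x.2) * Bᵀ) (whp P) (𝓝 1) := by
      rw [← hBΛB]
      exact ((h.tendsto_scoreVar_pilot hw hwm hw0 hμ hτ hΨ).const_mul B).mul_const Bᵀ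
    have h2 : Tendsto (fun M : Matrix (Fin d) (Fin d) ℝ =>
        ∑ k, ∑ l, |M k l - (1 : Matrix (Fin d) (Fin d) ℝ) k l|) (𝓝 1) (𝓝 0) := by
      have hcont : Continuous fun M : Matrix (Fin d) (Fin d) ℝ =>
          ∑ k, ∑ l, |M k l - (1 : Matrix (Fin d) (Fin d) ℝ) k l| := by fun_prop
      simpa using hcont.tendsto 1
    filter_upwards [(h2.comp h1).eventually (gt_mem_nhds hδ)] with x hx τ
    have h3 := abs_quadraticForm_sub_le (B * scoreVar m (s x.1)
      (mixProb α (approxProb m (data Z x.1 x.2) (θp x.1 x.2) (H x.1 x.2) (Ψ x.1 x.2)))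
      (data Z x.1 x.2) (θhat x.1 x.2) * Bᵀ) τ
    rw [← sum_inner_sq_mul_odds] at h3
    exact h3.trans (mul_le_mul_of_nonneg_right hx.le (sq_nonneg _))
  · -- the Lyapunov condition
    set K : ℝ := ∑ k, ∑ l, |B k l| with hK
    have hK0 : 0 ≤ K := by positivity
    have hα := h.α_mem.1
    have hs0 : Tendsto (fun x : ℕ × Ω => K ^ 4 / α ^ 3 * (s x.1 : ℝ)⁻¹) (whp P) (𝓝 0) := by
      have := ((tendsto_inv_atTop_zero.comp
        ((tendsto_natCast_atTop_atTop (R := ℝ)).comp h.s_tendsto)).comp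
        (tendsto_fst_whp (P := P))).const_mul (K ^ 4 / α ^ 3)
      simpa [Function.comp_def] using this
    have hlim := (h.fourth.bddInProb h.θhat_mem).mul_tendsto_zero hs0
    refine squeeze_zero' (Eventually.of_forall fun x => ?_) ?_ hlim
    · refine Finset.sum_nonneg fun i _ => div_nonneg (by positivity) (pow_nonneg ?_ 3)
      exact le_min (h.stepProb_nonneg _ _ _) zero_le_one
    filter_upwards [tendsto_fst_whp.eventually h.eventually_rate,
      tendsto_fst_whp.eventually (h.s_tendsto.eventually_gt_atTop 0),
      tendsto_fst_whp.eventually (eventually_gt_atTop 0)] with x hx hs hn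
    have hs' : (0 : ℝ) < s x.1 := by exact_mod_cast hs
    have hn' : (0 : ℝ) < x.1 := by exact_mod_cast hn
    rw [Finset.sum_mul]
    refine Finset.sum_le_sum fun i _ => ?_
    have h1 := norm_mulVec_le B (√(s x.1) / x.1) (gradient (m (data Z x.1 x.2 i)) (θhat x.1 x.2))
    rw [← hK, abs_of_nonneg (by positivity)] at h1
    have h2 : (s x.1 : ℝ) * (α / x.1) ≤ min (stepProb m α s Z θp H Ψ x.1 x.2 i) 1 :=
      le_min (h.le_stepProb _ _ _) hx.2
    have h3 : √(s x.1 : ℝ) ^ 4 = (s x.1 : ℝ) ^ 2 := by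
      rw [show 4 = 2 * 2 from rfl, pow_mul, Real.sq_sqrt hs'.le]
    calc _ ≤ (K * (√(s x.1) / x.1 * ‖gradient (m (data Z x.1 x.2 i)) (θhat x.1 x.2)‖)) ^ 4 /
          ((s x.1 : ℝ) * (α / x.1)) ^ 3 := by
          have := hx.1
          gcongr
      _ = _ := by
          rw [mul_pow, mul_pow, div_pow, h3, gradNorm]
          field_simp
  · exact fun n j => measurable_standardized
      (measurable_asympVar h.reg ((hD n).mono (hle n) le_rfl) ((hθ n).mono (hle n) le_rfl)
        (h.θhat_mem n) (fun i => by
          have hg := fun i => measurable_gradNorm_eval h.reg ((hD n).mono (hle n) le_rfl)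
            ((hθ n).mono (hle n) le_rfl) (h.θhat_mem n) i
          simp only [mixProb, thresholdProb]
          exact ((((hg i).min (hηm n)).div (Finset.measurable_fun_sum _ fun j _ =>
            (hg j).min (hηm n))).const_mul _).add_const _) (s n)) (hVn0 n)
      (h.measurable_θsub n) ((hθ n).mono (hle n) le_rfl) (s n) j
  · -- the remainder
    intro j
    set y : ℕ × Ω → Fin d → ℝ := fun x => √(s x.1) • (θsub x.1 x.2 - θhat x.1 x.2).ofLp with hy
    set N : ℕ × Ω → Fin d → ℝ := fun x => noiseScore m α s Z U θhat θp H Ψ x.1 x.2 with hN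
    have hyb : ∀ k, BddInProb P fun x => y x k := fun k => h.bddInProb_error.of_le
      (Eventually.of_forall fun x => by
        have h1 : |(θsub x.1 x.2 - θhat x.1 x.2).ofLp k| ≤ ‖θsub x.1 x.2 - θhat x.1 x.2‖ :=
          PiLp.norm_apply_le (θsub x.1 x.2 - θhat x.1 x.2) k
        rw [abs_of_nonneg (by positivity : 0 ≤ √(s x.1 : ℝ) * ‖θsub x.1 x.2 - θhat x.1 x.2‖)]
        simp only [hy, Pi.smul_apply, smul_eq_mul, abs_mul]
        rw [abs_of_nonneg (Real.sqrt_nonneg _)]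
        gcongr)
    have h1 : Tendsto (fun x => ∑ k, y x k * ((CFC.sqrt (Vn x.1 x.2))⁻¹ j k - C⁻¹ j k)) (whp P)
        (𝓝 (∑ _k : Fin d, 0)) := tendsto_finsetSum _ fun k _ => by
      refine (hyb k).mul_tendsto_zero ?_
      have := (tendsto_pi_nhds.1 ((tendsto_pi_nhds.1 hQlim) j) k).sub_const (C⁻¹ j k)
      rwa [sub_self] at this
    have h2 : Tendsto (fun x => ∑ k, (C⁻¹ * A⁻¹) j k * (N x k + (A *ᵥ y x) k)) (whp P)
        (𝓝 (∑ k, (C⁻¹ * A⁻¹) j k * 0)) := tendsto_finsetSum _ fun k _ =>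
      (h.tendsto_noiseScore_add k).const_mul _
    have h3 := h1.add h2
    simp only [mul_zero, Finset.sum_const_zero, add_zero] at h3
    refine h3.congr fun x => ?_
    rw [htVec_mulVec]
    have e1 : standardized (s x.1) (Vn x.1 x.2) (θsub x.1 x.2) (θhat x.1 x.2) j =
        ((CFC.sqrt (Vn x.1 x.2))⁻¹ *ᵥ y x) j := by
      rw [standardized, hy, Matrix.mulVec_smul]
    have e2 : ∑ k, y x k * ((CFC.sqrt (Vn x.1 x.2))⁻¹ j k - C⁻¹ j k) =
        ((CFC.sqrt (Vn x.1 x.2))⁻¹ *ᵥ y x) j - (C⁻¹ *ᵥ y x) j := by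
      simp only [Matrix.mulVec, dotProduct, ← Finset.sum_sub_distrib]
      exact Finset.sum_congr rfl fun k _ => by ring
    have e3 : ∑ k, (C⁻¹ * A⁻¹) j k * (N x k + (A *ᵥ y x) k) =
        ((C⁻¹ * A⁻¹) *ᵥ N x) j + (C⁻¹ *ᵥ y x) j := by
      change ((C⁻¹ * A⁻¹) *ᵥ (N x + A *ᵥ y x)) j = _
      rw [Matrix.mulVec_add, Matrix.mulVec_mulVec, Matrix.mul_assoc, Matrix.nonsing_inv_mul _ hAdet,
        Matrix.mul_one]
      rfl
    have e4 : (B *ᵥ N x) j = -((C⁻¹ * A⁻¹) *ᵥ N x) j := by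
      rw [hB, Matrix.neg_mulVec]; rfl
    change _ = standardized (s x.1) (Vn x.1 x.2) (θsub x.1 x.2) (θhat x.1 x.2) j - (B *ᵥ N x) j
    rw [e1, e2, e3, e4]
    ring

end Experiment

lemma condConvStdGaussian_of_isEmpty {d : ℕ} [IsEmpty (Fin d)] {Ω : Type*} {mΩ : MeasurableSpace Ω}
    {P : Measure Ω} [IsProbabilityMeasure P] {𝓖 : ℕ → MeasurableSpace Ω} (h𝓖 : ∀ n, 𝓖 n ≤ mΩ)
    (Δ : ℕ → Ω → Fin d → ℝ) : CondConvStdGaussian P 𝓖 Δ := by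
  intro x ε hε
  have h1 : ∀ n, P⟦{ω | ∀ j, Δ n ω j ≤ x j} | 𝓖 n⟧ = fun _ => 1 := fun n => by
    have : {ω | ∀ j, Δ n ω j ≤ x j} = Set.univ := Set.eq_univ_of_forall fun ω => isEmptyElim
    rw [this, Set.indicator_univ]
    exact condExp_const (h𝓖 n) 1
  have h2 : {y : Param d | ∀ j, y j ≤ x j} = Set.univ :=
    Set.eq_univ_of_forall fun y => isEmptyElim
  simp only [h1, h2, probReal_univ, edist_self]
  simp [hε.ne']

/-! ### Limits of the thresholds -/

section quantile

variable {q d : ℕ} {ν : Measure (Obs q)} {m : Obs q → Param d → ℝ} {Θ : Set (Param d)}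
  {θ₀ : Param d} [IsProbabilityMeasure ν]

/-- The gradient at `θ₀` does not vanish almost surely, since its second moment matrix is positive
definite. -/
lemma exists_pos_level (h : Regularity ν m Θ θ₀) (hd : 0 < d) :
    ∃ K : ℝ, 0 < K ∧ 0 < ν.real {z | K < gradNorm m z θ₀} := by
  by_contra! hcon
  have h0 : ∀ᵐ z ∂ν, gradient (m z) θ₀ = 0 := by
    have h1 : ∀ n : ℕ, ∀ᵐ z ∂ν, gradNorm m z θ₀ ≤ 1 / ((n : ℝ) + 1) := fun n => by
      have := le_antisymm (hcon (1 / ((n : ℝ) + 1)) (by positivity)) measureReal_nonneg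
      rw [measureReal_eq_zero_iff] at this
      rw [ae_iff]
      simpa only [not_le] using this
    filter_upwards [ae_all_iff.2 h1] with z hz
    have : gradNorm m z θ₀ ≤ 0 := ge_of_tendsto' tendsto_one_div_add_atTop_nhds_zero_nat hz
    exact norm_le_zero_iff.1 this
  have h1 := (h.grad_posDef θ₀ h.mem).diag_pos (i := ⟨0, hd⟩)
  rw [Matrix.of_apply, integral_congr_ae (g := fun _ => (0 : ℝ))
    (by filter_upwards [h0] with z hz; simp [hz]), integral_zero] at h1
  exact h1.false

/-- By uniqueness of the quantile, levels below it are exceeded with a probability strictly larger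
than `ϱ`. -/
lemma lt_measureReal_of_lt_quantile {t : Obs q → ℝ} {ϱ ζ K : ℝ}
    (hζ : ∀ x, IsUpperQuantile ν t ϱ x ↔ x = ζ) (hK : K < ζ) : ϱ < ν.real {z | K < t z} := by
  by_contra! hcon
  refine hK.ne ((hζ K).1 ⟨hcon, ((hζ ζ).2 rfl).2.trans ?_⟩)
  exact measureReal_mono fun z hz => hK.le.trans hz

lemma measureReal_lt_of_quantile_lt {t : Obs q → ℝ} {ϱ ζ K : ℝ}
    (hζ : ∀ x, IsUpperQuantile ν t ϱ x ↔ x = ζ) (hK : ζ < K) : ν.real {z | K < t z} < ϱ := by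
  by_contra! hcon
  refine hK.ne' ((hζ K).1 ⟨le_trans ?_ ((hζ ζ).2 rfl).1, hcon.trans ?_⟩)
  · exact measureReal_mono fun z hz => hK.trans hz
  · exact measureReal_mono fun z hz => (show K < t z from hz).le

lemma memLp_min_gradNorm (h : Regularity ν m Θ θ₀) {ζ : ℝ} (hζ : 0 ≤ ζ) :
    MemLp (fun z => min (gradNorm m z θ₀) ζ) 2 ν :=
  MemLp.of_bound ((h.measurable_gradNorm h.mem).min measurable_const).aestronglyMeasurable ζ
    (ae_of_all _ fun z => by
      rw [Real.norm_of_nonneg (le_min (gradNorm_nonneg _ _) hζ)]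
      exact min_le_right _ _)

lemma mul_measureReal_le_integral_min (h : Regularity ν m Θ θ₀) {ζ : ℝ} (hζ : 0 ≤ ζ) :
    ζ * ν.real {z | ζ ≤ gradNorm m z θ₀} ≤ ∫ z, min (gradNorm m z θ₀) ζ ∂ν := by
  have h1 := mul_meas_ge_le_integral_of_nonneg (μ := ν) (f := fun z => min (gradNorm m z θ₀) ζ)
    (ae_of_all _ fun z => le_min (gradNorm_nonneg _ _) hζ)
    ((memLp_min_gradNorm h hζ).integrable (by simp)) ζ
  simpa using h1

lemma integral_gradNorm_pos (h : Regularity ν m Θ θ₀) (hd : 0 < d) :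
    0 < ∫ z, gradNorm m z θ₀ ∂ν := by
  obtain ⟨K, hK, hK'⟩ := exists_pos_level h hd
  have h1 := mul_meas_ge_le_integral_of_nonneg (μ := ν) (f := fun z => gradNorm m z θ₀)
    (ae_of_all _ fun z => gradNorm_nonneg _ _)
    ((h.memLp_gradNorm h.mem).integrable (by simp)) K
  have h2 : ν.real {z | K < gradNorm m z θ₀} ≤ ν.real {z | K ≤ gradNorm m z θ₀} :=
    measureReal_mono fun z hz => (show K < gradNorm m z θ₀ from hz).le
  exact (mul_pos hK (hK'.trans_le h2)).trans_le h1

end quantile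

lemma optThreshold_nonneg {n s : ℕ} {t : Fin n → ℝ} (ht : ∀ i, 0 ≤ t i) : 0 ≤ optThreshold s t := by
  refine div_nonneg (Finset.sum_nonneg fun i _ => orderStat_nonneg ht) (sub_nonneg.2 ?_)
  rw [Nat.cast_le, cutoff]
  by_cases hne : {g | IsCutoff s t g}.Nonempty
  · exact (Nat.sInf_mem hne).1.le
  · rw [Set.not_nonempty_iff_eq_empty.1 hne, Nat.sInf_empty]
    exact Nat.zero_le _

namespace Experiment

variable {q d : ℕ} {Ω : Type*} {mΩ : MeasurableSpace Ω} {ν : Measure (Obs q)}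
  {m : Obs q → Param d → ℝ} {Θ : Set (Param d)} {θ₀ : Param d} {α b ϱ : ℝ} {s₀ s : ℕ → ℕ}
  {P : Measure Ω} {Z : ℕ → Ω → Obs q} {U₀ U : (n : ℕ) → Ω → Fin n → ℝ} {θhat θp : ℕ → Ω → Param d}
  {H Ψ : ℕ → Ω → ℝ} {θsub : ℕ → Ω → Param d} [IsProbabilityMeasure ν] [IsProbabilityMeasure P]
  (h : Experiment ν m Θ θ₀ α b ϱ s₀ s P Z U₀ U θhat θp H Ψ θsub)
include h

lemma tendsto_Ψ {w : Obs q → ℝ} (hw : MemLp w 2 ν)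
    (hτ : Tendsto (fun x : ℕ × Ω => ∑ i, meanWeight (pilotSet (s₀ x.1) (U₀ x.1 x.2)) i *
      |min (gradNorm m (data Z x.1 x.2 i) (θp x.1 x.2)) (H x.1 x.2) - w (data Z x.1 x.2 i)|)
      (whp P) (𝓝 0)) :
    Tendsto (fun x : ℕ × Ω => Ψ x.1 x.2) (whp P) (𝓝 (∫ z, w z ∂ν)) := by
  refine (h.lln_pilot.tendsto_weighted_mean (fun _ _ _ => meanWeight_nonneg _ _) hw
    (τ := fun n ω i => min (gradNorm m (data Z n ω i) (θp n ω)) (H n ω)) hτ).congr fun x => ?_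
  rw [h.Ψ_eq, pilotMean, sum_meanWeight_mul]

lemma lln_univ : LLN P ν Z fun n _ => meanWeight (Finset.univ : Finset (Fin n)) := by
  have e : ∀ n, meanWeight (Finset.univ : Finset (Fin n)) = fun _ => (n : ℝ)⁻¹ := fun n => by
    funext i; simp [meanWeight]
  simp only [e]
  exact h.lln_full

omit [IsProbabilityMeasure ν] [IsProbabilityMeasure P] in
lemma ratio_nonneg (n : ℕ) : 0 ≤ (s n : ℝ) / (b * n) := by
  have := h.one_le_b
  positivity

lemma eventually_lt_H {K K' : ℝ} (hK : K < K') (hc : ϱ < ν.real {z | K' < gradNorm m z θ₀}) :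
    ∀ᶠ x in whp P, K < H x.1 x.2 := by
  simp only [h.H_eq]
  exact eventually_lt_quantile h.reg h.lln_pilot h.θp_mem h.tendsto_θp h.s_ratio h.ratio_nonneg
    h.ϱ_mem.2 hK hc

/-- If the sampling fraction vanishes, the optimal thresholds eventually exceed every level that the
gradient norms exceed with positive probability: fewer than `s` data points are above the
threshold. -/
lemma eventually_lt_optThreshold (hϱ : ϱ = 0) (hd : 0 < d) {K K' : ℝ} (hK : K < K')
    (hc : 0 < ν.real {z | K' < gradNorm m z θ₀}) :
    ∀ᶠ x in whp P, K < optThreshold (s x.1)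
      (fun i => gradNorm m (data Z x.1 x.2 i) (θhat x.1 x.2)) := by
  obtain ⟨L, hL, hL'⟩ := exists_pos_level h.reg hd
  obtain ⟨c, hc1, hc2⟩ := exists_between (lt_min hc hL')
  have hlim : Tendsto (fun n => (s n : ℝ) / n) atTop (𝓝 0) := by
    have := h.tendsto_ratio
    rwa [hϱ, mul_zero] at this
  filter_upwards [eventually_lt_fraction h.reg h.lln_univ (fun _ _ _ => meanWeight_nonneg _ _)
      h.θhat_mem h.tendsto_θhat hK (hc2.trans_le (min_le_left _ _)),
    eventually_lt_fraction h.reg h.lln_univ (fun _ _ _ => meanWeight_nonneg _ _)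
      h.θhat_mem h.tendsto_θhat hL (hc2.trans_le (min_le_right _ _)),
    tendsto_fst_whp.eventually (hlim.eventually (gt_mem_nhds hc1)),
    tendsto_fst_whp.eventually h.s_lt,
    tendsto_fst_whp.eventually (h.s_tendsto.eventually_gt_atTop 0)] with x h1 h2 h3 h4 h5
  generalize ht : (fun i => gradNorm m (data Z x.1 x.2 i) (θhat x.1 x.2)) = t
  have ht0 : ∀ i, 0 ≤ t i := fun i => ht ▸ gradNorm_nonneg _ _
  have ht' : ∀ i, gradNorm m (data Z x.1 x.2 i) (θhat x.1 x.2) = t i := fun i => congrFun ht i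
  simp only [ht'] at h1 h2
  rw [sum_meanWeight_indicator, Finset.card_univ, Fintype.card_fin] at h1 h2
  have hn : (0 : ℝ) < x.1 := by exact_mod_cast h5.trans h4
  have hs1 : s x.1 < (Finset.univ.filter fun i => K < t i).card := by
    have := (div_lt_div_iff_of_pos_right hn).1 (h3.trans h1)
    exact_mod_cast this
  have hs2 : s x.1 < (Finset.univ.filter fun i => 0 < t i).card := by
    have := (div_lt_div_iff_of_pos_right hn).1 (h3.trans h2)
    exact_mod_cast this
  by_contra! hcon
  have h6 := card_optThreshold_lt ht0 h4 (exists_isCutoff ht0 h5 h4 hs2)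
  have h7 : (Finset.univ.filter fun i => K < t i).card ≤
      (Finset.univ.filter fun i => optThreshold (s x.1) t < t i).card :=
    Finset.card_le_card fun i hi => by
      simp only [Finset.mem_filter, Finset.mem_univ, true_and] at hi ⊢
      exact lt_of_le_of_lt hcon hi
  omega

variable {𝓖 : ℕ → MeasurableSpace Ω}
    (h𝓖 : ∀ n, 𝓖 n = MeasurableSpace.comap (data Z n) inferInstance ⊔
      MeasurableSpace.comap (fun ω => (θp n ω, H n ω, Ψ n ω)) inferInstance)

omit [IsProbabilityMeasure ν] [IsProbabilityMeasure P] in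
lemma measurable_gradNorm_θhat (n : ℕ) (i : Fin n) :
    Measurable fun ω => gradNorm m (data Z n ω i) (θhat n ω) :=
  measurable_gradNorm_eval h.reg (measurable_data h.measurable_Z n)
    ((h.measurable_θhat n).mono (measurable_data h.measurable_Z n).comap_le le_rfl)
    (h.θhat_mem n) i

include h𝓖

/-- Vanishing sampling fraction: the truncation of the gradient norms is asymptotically
negligible. -/
theorem condConvStdGaussian_of_eq_zero (hϱ : ϱ = 0) (hd : 0 < d) :
    CondConvStdGaussian P 𝓖 fun n ω => standardized (s n)
      (asympVar m (s n) (mixProb α (thresholdProb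
        (fun i => gradNorm m (data Z n ω i) (θhat n ω))
        (optThreshold (s n) fun i => gradNorm m (data Z n ω i) (θhat n ω))))
        (data Z n ω) (θhat n ω))
      (θsub n ω) (θhat n ω) := by
  obtain ⟨L, hL, hL'⟩ := exists_pos_level h.reg hd
  have hpos : 0 < ν.real {z | 0 < gradNorm m z θ₀} :=
    hL'.trans_le (measureReal_mono fun z hz => hL.trans hz)
  have hH : ∀ K K' : ℝ, K < K' → 0 < ν.real {z | K' < gradNorm m z θ₀} →
      ∀ᶠ x in whp P, K < H x.1 x.2 := fun K K' hK hc => h.eventually_lt_H hK (hϱ ▸ hc)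
  have hα := h.α_mem.1
  have hμ := integral_gradNorm_pos h.reg hd
  have hw0 : ∀ z, 0 ≤ gradNorm m z θ₀ := fun z => gradNorm_nonneg _ _
  have hwm := h.reg.measurable_gradNorm h.reg.mem
  have hτ : Tendsto (fun x : ℕ × Ω => ∑ i, (x.1 : ℝ)⁻¹ *
      |min (gradNorm m (data Z x.1 x.2 i) (θp x.1 x.2)) (H x.1 x.2) -
        gradNorm m (data Z x.1 x.2 i) θ₀|) (whp P) (𝓝 0) :=
    tendsto_sum_abs_min_sub h.reg h.lln_full (fun _ _ _ => by positivity) h.θp_mem h.tendsto_θp hpos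
      hH
  have hΨ := h.tendsto_Ψ (h.reg.memLp_gradNorm h.reg.mem) (tendsto_sum_abs_min_sub h.reg
    h.lln_pilot (fun _ _ _ => meanWeight_nonneg _ _) h.θp_mem h.tendsto_θp hpos hH)
  set η : ℕ → Ω → ℝ := fun n ω =>
    optThreshold (s n) fun i => gradNorm m (data Z n ω i) (θhat n ω) with hη_def
  have hηm : ∀ n, Measurable (η n) := fun n =>
    measurable_optThreshold (h.measurable_gradNorm_θhat n) (s n)
  have hη0 : ∀ n ω, 0 ≤ η n ω := fun n ω => optThreshold_nonneg fun i => gradNorm_nonneg _ _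
  have hη : Tendsto (fun x : ℕ × Ω => ∑ i, (x.1 : ℝ)⁻¹ *
      |min (gradNorm m (data Z x.1 x.2 i) (θhat x.1 x.2)) (η x.1 x.2) -
        gradNorm m (data Z x.1 x.2 i) θ₀|) (whp P) (𝓝 0) :=
    tendsto_sum_abs_min_sub h.reg h.lln_full (fun _ _ _ => by positivity) h.θhat_mem h.tendsto_θhat
      hpos fun K K' hK hc => h.eventually_lt_optThreshold hϱ hd hK hc
  refine h.condConvStdGaussian_of_tendsto (h.reg.memLp_gradNorm h.reg.mem) hwm hw0 hμ hτ hΨ hηm hη0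
    hη ?_ h𝓖
  unfold limitScoreVar
  have ha : ∀ z, α ≤ (1 - α) * (gradNorm m z θ₀ / ∫ y, gradNorm m y θ₀ ∂ν) + α := fun z => by
    have := mul_nonneg (sub_nonneg.2 h.α_mem.2.le) (div_nonneg (hw0 z) hμ.le)
    linarith
  refine posDef_weighted h.reg (c' := fun _ => 1) (measurable_varFactor.comp
    (Measurable.prodMk (by fun_prop) measurable_const)) measurable_const (B := 1 / α) (B' := 1)
    (fun z => ?_) (fun _ => by simp) (fun z => varFactor_nonneg _ _) (fun z hz => ?_)
    (by simpa only [one_mul] using h.reg.grad_posDef θ₀ h.reg.mem)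
  · rw [abs_of_nonneg (varFactor_nonneg _ _)]
    exact varFactor_le hα (ha z) h.bϱ_nonneg
  · rw [hϱ, mul_zero, varFactor, sub_zero] at hz
    have h1 := one_div_pos.2 (hα.trans_le (ha z))
    exact absurd hz (lt_max_of_lt_left h1).ne'

/-- Positive sampling fraction: the thresholds converge to the population quantile. -/
theorem condConvStdGaussian_of_pos (hϱ : 0 < ϱ) (hq : QuantileRegular ν m b α ϱ θ₀) :
    CondConvStdGaussian P 𝓖 fun n ω => standardized (s n)
      (asympVar m (s n) (mixProb α (thresholdProb
        (fun i => gradNorm m (data Z n ω i) (θhat n ω))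
        (upperSampleQuantile Finset.univ (fun i => gradNorm m (data Z n ω i) (θhat n ω))
          ((s n : ℝ) / (b * n))))) (data Z n ω) (θhat n ω))
      (θsub n ω) (θhat n ω) := by
  obtain ⟨ζ, hζ0, hζ, hpd⟩ := hq
  have hlow : ∀ K < ζ, ϱ < ν.real {z | K < gradNorm m z θ₀} := fun K hK =>
    lt_measureReal_of_lt_quantile hζ hK
  have hup : ∀ K, ζ < K → ν.real {z | K < gradNorm m z θ₀} < ϱ := fun K hK =>
    measureReal_lt_of_quantile_lt hζ hK
  have hH : Tendsto (fun x : ℕ × Ω => H x.1 x.2) (whp P) (𝓝 ζ) := by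
    simp only [h.H_eq]
    exact tendsto_quantile h.reg h.lln_pilot h.θp_mem h.tendsto_θp h.s_ratio h.ratio_nonneg
      h.ϱ_mem.2 hζ0 hlow hup
  have hη : Tendsto (fun x : ℕ × Ω => upperSampleQuantile Finset.univ
      (fun i => gradNorm m (data Z x.1 x.2 i) (θhat x.1 x.2)) ((s x.1 : ℝ) / (b * x.1)))
      (whp P) (𝓝 ζ) :=
    tendsto_quantile h.reg h.lln_univ h.θhat_mem h.tendsto_θhat h.s_ratio h.ratio_nonneg
      h.ϱ_mem.2 hζ0 hlow hup
  have hα := h.α_mem.1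
  have hw0 : ∀ z, 0 ≤ min (gradNorm m z θ₀) ζ := fun z => le_min (gradNorm_nonneg _ _) hζ0.le
  have hwm : Measurable fun z => min (gradNorm m z θ₀) ζ :=
    (h.reg.measurable_gradNorm h.reg.mem).min measurable_const
  have hw := memLp_min_gradNorm h.reg hζ0.le
  have hζμ : ζ * ϱ ≤ ∫ z, min (gradNorm m z θ₀) ζ ∂ν :=
    (mul_le_mul_of_nonneg_left ((hζ ζ).2 rfl).2 hζ0.le).trans
      (mul_measureReal_le_integral_min h.reg hζ0.le)
  have hμ : 0 < ∫ z, min (gradNorm m z θ₀) ζ ∂ν := (mul_pos hζ0 hϱ).trans_le hζμ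
  have hτ : Tendsto (fun x : ℕ × Ω => ∑ i, (x.1 : ℝ)⁻¹ *
      |min (gradNorm m (data Z x.1 x.2 i) (θp x.1 x.2)) (H x.1 x.2) -
        min (gradNorm m (data Z x.1 x.2 i) θ₀) ζ|) (whp P) (𝓝 0) :=
    tendsto_sum_abs_min_sub_min h.reg h.lln_full (fun _ _ _ => by positivity) h.θp_mem h.tendsto_θp
      hH
  have hΨ := h.tendsto_Ψ hw (tendsto_sum_abs_min_sub_min h.reg h.lln_pilot
    (fun _ _ _ => meanWeight_nonneg _ _) h.θp_mem h.tendsto_θp hH)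
  set η : ℕ → Ω → ℝ := fun n ω => upperSampleQuantile Finset.univ
    (fun i => gradNorm m (data Z n ω i) (θhat n ω)) ((s n : ℝ) / (b * n)) with hη_def
  have hηm : ∀ n, Measurable (η n) := fun n =>
    measurable_upperSampleQuantile (fun i => by simp) (h.measurable_gradNorm_θhat n) _
  have hη0 : ∀ n ω, 0 ≤ η n ω := fun n ω =>
    upperSampleQuantile_nonneg (fun i => gradNorm_nonneg _ _) _
  have hη' : Tendsto (fun x : ℕ × Ω => ∑ i, (x.1 : ℝ)⁻¹ *
      |min (gradNorm m (data Z x.1 x.2 i) (θhat x.1 x.2)) (η x.1 x.2) -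
        min (gradNorm m (data Z x.1 x.2 i) θ₀) ζ|) (whp P) (𝓝 0) :=
    tendsto_sum_abs_min_sub_min h.reg h.lln_full (fun _ _ _ => by positivity) h.θhat_mem
      h.tendsto_θhat hη
  refine h.condConvStdGaussian_of_tendsto hw hwm hw0 hμ hτ hΨ hηm hη0 hη' ?_ h𝓖
  unfold limitScoreVar
  have ha : ∀ z, α ≤ (1 - α) * (min (gradNorm m z θ₀) ζ / ∫ y, min (gradNorm m y θ₀) ζ ∂ν) + α :=
    fun z => by
      have := mul_nonneg (sub_nonneg.2 h.α_mem.2.le) (div_nonneg (hw0 z) hμ.le)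
      linarith
  have hcm : Measurable fun z => varFactor ((1 - α) * (min (gradNorm m z θ₀) ζ /
      ∫ y, min (gradNorm m y θ₀) ζ ∂ν) + α) (b * ϱ) :=
    measurable_varFactor.comp (Measurable.prodMk (by fun_prop) measurable_const)
  have hcb : ∀ z, |varFactor ((1 - α) * (min (gradNorm m z θ₀) ζ /
      ∫ y, min (gradNorm m y θ₀) ζ ∂ν) + α) (b * ϱ)| ≤ 1 / α := fun z => by
    rw [abs_of_nonneg (varFactor_nonneg _ _)]
    exact varFactor_le hα (ha z) h.bϱ_nonneg
  -- the variance factor vanishes only where inclusion is certain in the limit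
  have hzero : ∀ z, varFactor ((1 - α) * (min (gradNorm m z θ₀) ζ /
      ∫ y, min (gradNorm m y θ₀) ζ ∂ν) + α) (b * ϱ) = 0 →
      1 ≤ b * ϱ * ((1 - α) * (min (gradNorm m z θ₀) ζ /
        ∫ y, min (gradNorm m y θ₀) ζ ∂ν) + α) := fun z hz => by
    have h1 := (le_max_left _ _).trans_eq hz
    rw [sub_nonpos, div_le_iff₀ (hα.trans_le (ha z))] at h1
    exact h1
  rcases h.one_le_b.eq_or_lt with hb | hb
  · refine posDef_weighted h.reg (c' := fun _ => 1) hcm measurable_const (B' := 1) hcb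
      (fun _ => by simp) (fun z => varFactor_nonneg _ _) (fun z hz => ?_)
      (by simpa only [one_mul] using h.reg.grad_posDef θ₀ h.reg.mem)
    -- for `b = 1` the limiting inclusion probabilities are less than one, as `ζ * ϱ ≤ E (t ∧ ζ)`
    exfalso
    have h1 := hzero z hz
    rw [← hb, one_mul, mul_add] at h1
    have h2 : ϱ * (min (gradNorm m z θ₀) ζ / ∫ y, min (gradNorm m y θ₀) ζ ∂ν) ≤ 1 := by
      rw [mul_div_assoc', div_le_one hμ]
      refine le_trans ?_ hζμ
      rw [mul_comm]
      exact mul_le_mul_of_nonneg_right (min_le_right _ _) hϱ.le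
    have h3 := mul_le_mul_of_nonneg_left h2 (sub_nonneg.2 h.α_mem.2.le)
    have h4 := mul_lt_mul_of_pos_right h.ϱ_mem.2 hα
    linarith
  · have hlm : Measurable fun z => 1 - limitInclusion ν m b α ϱ θ₀ ζ z := by
      unfold limitInclusion
      exact (Measurable.min (by fun_prop) measurable_const).const_sub 1
    have hl0 : ∀ z, 0 ≤ limitInclusion ν m b α ϱ θ₀ ζ z := fun z =>
      le_min (mul_nonneg h.bϱ_nonneg (hα.le.trans (ha z))) zero_le_one
    refine posDef_weighted h.reg hcm hlm (B' := 1) hcb (fun z => ?_)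
      (fun z => varFactor_nonneg _ _) (fun z hz => ?_) (hpd hb)
    · have h1 : limitInclusion ν m b α ϱ θ₀ ζ z ≤ 1 := min_le_right _ _
      rw [abs_of_nonneg (by linarith)]
      linarith [hl0 z]
    · rw [limitInclusion, min_eq_right (hzero z hz), sub_self]

end Experiment

end PoissonSubsampling

open PoissonSubsampling in
theorem theorem6 {q d : ℕ}
    -- the law of one observation, which is continuous
    (ν : Measure (Obs q)) [IsProbabilityMeasure ν] (hν : ∀ z, ν {z} = 0)
    -- the objective, the parameter set and the true parameter
    (m : Obs q → Param d → ℝ) (Θ : Set (Param d)) (θ₀ : Param d)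
    (hreg : Regularity ν m Θ θ₀)
    -- tuning parameters and sample sizes
    (α b ϱ : ℝ) (hα : α ∈ Set.Ioo (0 : ℝ) 1) (hb : 1 ≤ b) (hϱ : ϱ ∈ Set.Ico (0 : ℝ) 1)
    (s₀ s : ℕ → ℕ) (hs₀ : Tendsto s₀ atTop atTop) (hs : Tendsto s atTop atTop)
    (hs_lt : ∀ᶠ n in atTop, s n < n)
    (hs₀_small : (fun n => (s₀ n : ℝ)) =o[atTop] (fun n => (n : ℝ)))
    (hs_ratio : Tendsto (fun n => (s n : ℝ) / (b * n)) atTop (𝓝 ϱ))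
    -- i.i.d. observations and, for every `n`, independent uniform random numbers for the two steps
    {Ω : Type*} [MeasurableSpace Ω] (P : Measure Ω) [IsProbabilityMeasure P]
    (Z : ℕ → Ω → Obs q) (U₀ U : (n : ℕ) → Ω → Fin n → ℝ)
    (hZ : ∀ i, Measurable (Z i)) (hU₀ : ∀ n, Measurable (U₀ n)) (hU : ∀ n, Measurable (U n))
    (hlaw : ∀ n, P.map (fun ω => (data Z n ω, U₀ n ω, U n ω)) =
      (Measure.pi fun _ : Fin n => ν).prod
        ((Measure.pi fun _ : Fin n => unif).prod (Measure.pi fun _ : Fin n => unif)))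
    -- the full data estimator, a function of the data
    (θhat : ℕ → Ω → Param d)
    (hθhat_meas : ∀ n, Measurable[MeasurableSpace.comap (data Z n) inferInstance] (θhat n))
    (hθhat : ∀ n ω, IsMaximizer Θ (fullObjective m (data Z n ω)) (θhat n ω))
    (hfourth : FourthMomentBounded P Z m Θ θhat)
    -- the pilot estimates, functions of the data and of the random numbers of the pilot step
    (θp : ℕ → Ω → Param d) (H Ψ : ℕ → Ω → ℝ)
    (hθp_meas : ∀ n, Measurable[MeasurableSpace.comap (data Z n) inferInstance ⊔
      MeasurableSpace.comap (U₀ n) inferInstance] (θp n))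
    (hθp : ∀ n ω, IsMaximizer Θ
      (pilotObjective m (data Z n ω) (pilotSet (s₀ n) (U₀ n ω))) (θp n ω))
    (hH : ∀ n ω, H n ω = pilotThreshold m (data Z n ω) (pilotSet (s₀ n) (U₀ n ω))
      ((s n : ℝ) / (b * n)) (θp n ω))
    (hΨ : ∀ n ω, Ψ n ω = pilotMean m (data Z n ω) (pilotSet (s₀ n) (U₀ n ω)) (H n ω) (θp n ω))
    -- the estimator of the second step
    (θsub : ℕ → Ω → Param d) (hθsub_meas : ∀ n, Measurable (θsub n))
    (hθsub : ∀ n ω, IsMaximizer Θ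
      (subObjective m (data Z n ω) (s n)
        (mixProb α (approxProb m (data Z n ω) (θp n ω) (H n ω) (Ψ n ω))) (U n ω)) (θsub n ω))
    -- the information in the data and the pilot estimates
    (𝓖 : ℕ → MeasurableSpace Ω)
    (h𝓖 : ∀ n, 𝓖 n = MeasurableSpace.comap (data Z n) inferInstance ⊔
      MeasurableSpace.comap (fun ω => (θp n ω, H n ω, Ψ n ω)) inferInstance) :
    (ϱ = 0 →
      CondConvStdGaussian P 𝓖 fun n ω =>
        let t : Fin n → ℝ := fun i => gradNorm m (data Z n ω i) (θhat n ω)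
        standardized (s n)
          (asympVar m (s n) (mixProb α (thresholdProb t (optThreshold (s n) t)))
            (data Z n ω) (θhat n ω))
          (θsub n ω) (θhat n ω)) ∧
    (0 < ϱ → QuantileRegular ν m b α ϱ θ₀ →
      CondConvStdGaussian P 𝓖 fun n ω =>
        let t : Fin n → ℝ := fun i => gradNorm m (data Z n ω i) (θhat n ω)
        standardized (s n)
          (asympVar m (s n)
            (mixProb α (thresholdProb t
              (upperSampleQuantile Finset.univ t ((s n : ℝ) / (b * n)))))
            (data Z n ω) (θhat n ω))
          (θsub n ω) (θhat n ω)) := by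
  have h : Experiment ν m Θ θ₀ α b ϱ s₀ s P Z U₀ U θhat θp H Ψ θsub :=
    ⟨hreg, hα, hb, hϱ, hs₀, hs, hs_lt, hs₀_small, hs_ratio, hZ, hU₀, hU, hlaw, hθhat_meas, hθhat,
      hfourth, hθp_meas, hθp, hH, hΨ, hθsub_meas, hθsub⟩
  have h𝓖le : ∀ n, 𝓖 n ≤ ‹MeasurableSpace Ω› := fun n => by
    rw [h𝓖]
    exact (sup_le le_sup_left ((h.measurable_θp n).prodMk
      ((h.measurable_H n).prodMk (h.measurable_Ψ n))).comap_le).trans (h.pilot_le n)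
  refine ⟨fun hϱ0 => ?_, fun hϱ0 hq => h.condConvStdGaussian_of_pos h𝓖 hϱ0 hq⟩
  rcases Nat.eq_zero_or_pos d with hd | hd
  · have : IsEmpty (Fin d) := hd ▸ Fin.isEmpty
    exact condConvStdGaussian_of_isEmpty h𝓖le _
  · exact h.condConvStdGaussian_of_eq_zero h𝓖 hϱ0 hd
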